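/- **Setting.** Let $\mathcal X,\mathcal Y,\mathcal Z$ be finite sets and let $P_{YZ|X}:\mathcal X\to\mathcal Y\times\mathcal Z$ be a semi-deterministic discrete memoryless wiretap channel: there is a surjective function $f:\mathcal X\to\mathcal Y$ with $P_{Y|X}(y|x)=\mathbf 1\{y=f(x)\}$, while $P_{Z|X}$ is arbitrary. Here $Y$ is the legitimate receiver's output and $Z$ the eavesdropper's; for blocklength $n$ the channel is $P_{Y^nZ^n|X^n}=\prod_{k=1}^n P_{YZ|X}$. Write $d$ for total variation distance and $\log$ for the natural logarithm. **Codes and rates.** An $(n,M)$ code consists of a message $W$ on $\{1,\dots,M\}$ with an arbitrary distribution $P_W$, a randomized encoder $P_{X^n|W}$, and a decoder $g:\mathcal Y^n\to\{1,\dots,M\}$. It is an $(n,M,\epsilon,\delta)_{\mathrm{avg}}$ secrecy code if $\Pr[g(Y^n)\ne W]\le\epsilon$ and $d(P_{WZ^n},Q^{\mathrm{unif}}P_{Z^n})\le\delta$, where $Q^{\mathrm{unif}}$ is uniform on $\{1,\dots,M\}$. It is an $(n,M,\epsilon,\delta)_{\max}$ secrecy code if $\max_m P_{Y^n|W=m}[g(Y^n)\ne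 m]\le\epsilon$ and $\max_m d(P_{Z^n|W=m},Q_{Z^n})\le\delta$, where $Q_{Z^n}=\frac1M\sum_m P_{Z^n|W=m}$. For $i\in\{\mathrm{avg},\max\}$ let $R_i^*(n,\epsilon,\delta)\in[0,\infty]$ be the supremum of $\frac{\log M}{n}$ over all $M$ for which an $(n,M,\epsilon,\delta)_i$ secrecy code exists. **Constants.** Let $C_{\mathrm S}=\max_{P_X}H(Y|Z)$. For distributions $P_A$ and transition probabilities $P_{B|A}$ on finite sets, with $P_B$ the induced output distribution, put $$V(P_A,P_{B|A})=\sum_a P_A(a)\Big(\sum_b P_{B|A}(b|a)\log^2\frac{P_{B|A}(b|a)}{P_B(b)}-D(P_{B|A=a}\|P_B)^2\Big).$$ Let $Q^{-1}$ be the inverse of $Q(x)=\int_x^\infty\frac1{\sqrt{2\pi}}e^{-t^2/2}\,dt$. **Theorem.** Assume that there is a unique input distribution $P_X^*$ attaining the maximum $C_{\mathrm S}$ and that $V_{\mathrm S}:=V(P_Y^*,P_{Z|Y}^*)>0$, where $P_Y^*$ and $P_{Z|Y}^*$ are the marginal and conditional distributions of $P_X^*P_{YZ|X}$. 1. If $\epsilon\ge0$,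 $\delta>0$ and $\epsilon+\delta<1$, then for each $i\in\{\mathrm{avg},\max\}$ the supremum $R_i^*(n,\epsilon,\delta)$ is finite and attained for every $n\ge1$, and, as $n\to\infty$, $$R_i^*(n,\epsilon,\delta)=C_{\mathrm S}-\sqrt{\frac{V_{\mathrm S}}{n}}\,Q^{-1}\!\Big(\frac{\delta}{1-\epsilon}\Big)+O\!\Big(\frac{\log n}{n}\Big).$$ 2. If $\epsilon,\delta\ge0$ and $\epsilon+\delta\ge1$, then for every $n\ge1$ $$R^*_{\mathrm{avg}}(n,\epsilon,\delta)\ge R^*_{\max}(n,\epsilon,\delta)\ge\log|\mathcal Y|.$$ -/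

import Mathlib

namespace Wiretap

noncomputable section

/-! Probability distributions on a finite set `A` are the points of `stdSimplex ℝ A`; a random
transformation from `A` to `B` is a map `A → B → ℝ` all of whose values lie in `stdSimplex ℝ B`.
All logarithms are natural. -/

/-- The output distribution `K ∘ P` of the random transformation `K` with input distribution `P`. -/
def outDist {A B : Type*} [Fintype A] (K : A → B → ℝ) (P : A → ℝ) : B → ℝ :=
  fun b => ∑ a, P a * K a b

/-- First marginal. -/
def marginalFst {B C : Type*} [Fintype C] (P : B × C → ℝ) : B → ℝ := fun b => ∑ c, P (b, c)

/-- Second marginal. -/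
def marginalSnd {B C : Type*} [Fintype B] (P : B × C → ℝ) : C → ℝ := fun c => ∑ b, P (b, c)

/-- Conditional distribution of the second coordinate given the first one
(identically `0` given a value of probability `0`). -/
def condSndGivenFst {B C : Type*} [Fintype C] (P : B × C → ℝ) : B → C → ℝ :=
  fun b c => P (b, c) / marginalFst P b

/-- Total variation distance of two distributions on a finite set. -/
def tvDist {A : Type*} [Fintype A] (P Q : A → ℝ) : ℝ := (1 / 2) * ∑ a, |P a - Q a|

/-- Relative entropy `D(P ‖ Q)`, for `P` absolutely continuous with respect to `Q`. -/
def relEntropy {A : Type*} [Fintype A] (P Q : A → ℝ) : ℝ := ∑ a, P a * Real.log (P a / Q a)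

/-- Conditional entropy `H(Y|Z) = ∑ P(y,z) log (P(z) / P(y,z))` of a joint distribution. -/
def condEntropyFstGivenSnd {B C : Type*} [Fintype B] [Fintype C] (P : B × C → ℝ) : ℝ :=
  ∑ b, ∑ c, P (b, c) * Real.log (marginalSnd P c / P (b, c))

/-- The conditional information variance
`V(P, K) = ∑ P(a) (∑ K(b|a) log² (K(b|a) / (K ∘ P)(b)) - D(K(·|a) ‖ K ∘ P)²)`. -/
def infoVariance {A B : Type*} [Fintype A] [Fintype B] (P : A → ℝ) (K : A → B → ℝ) : ℝ :=
  ∑ a, P a * ((∑ b, K a b * Real.log (K a b / outDist K P b) ^ 2)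
    - relEntropy (K a) (outDist K P) ^ 2)

/-- The Gaussian `Q`-function. -/
def gaussianQ (x : ℝ) : ℝ :=
  ∫ t in Set.Ioi x, 1 / Real.sqrt (2 * Real.pi) * Real.exp (-t ^ 2 / 2)

/-- The inverse of the (injective) Gaussian `Q`-function; meaningful on its range `(0, 1)`. -/
def gaussianQInv (p : ℝ) : ℝ := Function.invFun gaussianQ p

/-! ### Secrecy codes for a wiretap channel `K : A → B × C → ℝ` -/

/-- A secrecy code with message set `Fin M`, channel input alphabet `A` and legitimate output
alphabet `B`: a (not necessarily uniform) message distribution, a randomized encoder and a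
decoder. -/
structure SecrecyCode (A B : Type*) [Fintype A] (M : ℕ) where
  msg : Fin M → ℝ
  msg_mem : msg ∈ stdSimplex ℝ (Fin M)
  enc : Fin M → A → ℝ
  enc_mem : ∀ m, enc m ∈ stdSimplex ℝ A
  dec : B → Fin M

namespace SecrecyCode

variable {A B C : Type*} [Fintype A] [Fintype B] [Fintype C] {M : ℕ}

/-- `P_{Y|W}`: distribution of the legitimate output given the message. -/
def legitGivenMsg (c : SecrecyCode A B M) (K : A → B × C → ℝ) (m : Fin M) : B → ℝ :=
  marginalFst (outDist K (c.enc m))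

/-- `P_{Z|W}`: distribution of the eavesdropper's output given the message. -/
def eveGivenMsg (c : SecrecyCode A B M) (K : A → B × C → ℝ) (m : Fin M) : C → ℝ :=
  marginalSnd (outDist K (c.enc m))

/-- Probability `P_{Y|W=m}[g(Y) ≠ m]` of a decoding error given the message `m`. -/
def errorGivenMsg (c : SecrecyCode A B M) (K : A → B × C → ℝ) (m : Fin M) : ℝ :=
  ∑ b, if c.dec b ≠ m then c.legitGivenMsg K m b else 0

/-- Average error probability `ℙ[g(Y) ≠ W]`. -/
def avgError (c : SecrecyCode A B M) (K : A → B × C → ℝ) : ℝ :=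
  ∑ m, c.msg m * c.errorGivenMsg K m

/-- Average total variation secrecy `S(W|Z) = d(P_{WZ}, Q^unif P_Z)`. -/
def avgSecrecy (c : SecrecyCode A B M) (K : A → B × C → ℝ) : ℝ :=
  tvDist (fun mz : Fin M × C => c.msg mz.1 * c.eveGivenMsg K mz.1 mz.2)
    (fun mz : Fin M × C => 1 / (M : ℝ) * outDist (c.eveGivenMsg K) c.msg mz.2)

/-- `d(P_{Z|W=m}, Q_Z)`, where `Q_Z` is the eavesdropper's output distribution induced by a
uniformly distributed message. -/
def secrecyGivenMsg (c : SecrecyCode A B M) (K : A → B × C → ℝ) (m : Fin M) : ℝ :=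
  tvDist (c.eveGivenMsg K m) (outDist (c.eveGivenMsg K) (fun _ => 1 / (M : ℝ)))

end SecrecyCode

/-- The two criteria: average error probability and average secrecy, or maximum error probability
and maximum secrecy. -/
inductive Criterion
  | avg
  | max

/-- The code `c` is an `(M, ε, δ)_i` secrecy code for the wiretap channel `K`. -/
def IsSecrecyCode {A B C : Type*} [Fintype A] [Fintype B] [Fintype C] {M : ℕ}
    (i : Criterion) (K : A → B × C → ℝ) (ε δ : ℝ) (c : SecrecyCode A B M) : Prop :=
  match i with
  | .avg => c.avgError K ≤ ε ∧ c.avgSecrecy K ≤ δ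
  | .max => (∀ m, c.errorGivenMsg K m ≤ ε) ∧ (∀ m, c.secrecyGivenMsg K m ≤ δ)

section DMWTC

variable {X Y Z : Type*} [Fintype X] [Fintype Y] [Fintype Z]

/-- The `n`-fold memoryless extension `P_{Yⁿ Zⁿ | Xⁿ}` of the wiretap channel `W = P_{YZ|X}`. -/
def memoryless (W : X → Y × Z → ℝ) (n : ℕ) :
    (Fin n → X) → (Fin n → Y) × (Fin n → Z) → ℝ :=
  fun x yz => ∏ k, W (x k) (yz.1 k, yz.2 k)

/-- The sizes `M` for which an `(n, M, ε, δ)_i` secrecy code exists. -/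
def codeSizes (i : Criterion) (W : X → Y × Z → ℝ) (n : ℕ) (ε δ : ℝ) : Set ℕ :=
  {M | ∃ c : SecrecyCode (Fin n → X) (Fin n → Y) M, IsSecrecyCode i (memoryless W n) ε δ c}

/-- The maximal secrecy rate `R*_i(n, ε, δ)`: the supremum of `(log M) / n`, with value `⊤` if
there are codes of arbitrarily large size. -/
def maxRate (i : Criterion) (W : X → Y × Z → ℝ) (n : ℕ) (ε δ : ℝ) : EReal :=
  ⨆ M ∈ codeSizes i W n ε δ, ((Real.log (M : ℝ) / (n : ℝ) : ℝ) : EReal)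

open Classical in
/-- The legitimate channel is given by the deterministic function `f`:
`P_{Y|X}(y|x) = 1{y = f(x)}`. -/
def IsSemiDeterministic (W : X → Y × Z → ℝ) (f : X → Y) : Prop :=
  ∀ x y, marginalFst (W x) y = if y = f x then 1 else 0

/-- `C_S = max_{P_X} H(Y|Z)`. -/
def secrecyCapacity (W : X → Y × Z → ℝ) : ℝ :=
  ⨆ P : stdSimplex ℝ X, condEntropyFstGivenSnd (outDist W (P : X → ℝ))

/-- `V(P_Y, P_{Z|Y})` for the joint law of `(Y, Z)` induced by the input distribution `P`. -/
def secrecyDispersion (W : X → Y × Z → ℝ) (P : X → ℝ) : ℝ :=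
  infoVariance (marginalFst (outDist W P)) (condSndGivenFst (outDist W P))

end DMWTC

end

end Wiretap

namespace Wiretap

noncomputable section

open MeasureTheory Filter Topology Finset

set_option linter.unusedSectionVars false

/-! ### The standard Gaussian density and the function `gaussianQ` -/

/-! Everything rests on a saddle point. Maximising the conditional entropy of `Y` given `Z` produces
a subnormalised conditional law `Q` of `Y` given `Z` whose expected logarithmic loss is at most the
capacity `C` for every input letter (`exists_saddle`). Equality in Gibbs' inequality then shows that
under the optimal input `Q` is the true conditional law, that every letter in the support has loss
exactly `C`, and that the dispersion `V` is the mean conditional variance of the loss, given either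
`Y` or `X` (`dispersion_eq_sum_fst`, `dispersion_eq_sum_input`).

Converse. `one_shot_converse` tests the pair (message, `z`) by asking whether the decoding region of
the message has mass at least `lam` under an estimate of the legitimate output given `z`. For each
`z` at most `1 / lam` messages pass, so an independent uniform message rarely does. If every input
makes its own output likely enough with probability at least `p`, the true pair passes with
probability at least `p * (1 - ε)`; this product is the source of the quotient `δ / (1 - ε)`. For
block length `n` the estimate is a mixture of product estimates, one per input type, which costs
only a polynomial factor. A type far from the optimal one may have the wrong variance, so its
estimate is tuned: moving `Q` towards the actual conditional law lowers the mean loss quadratically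
(`exists_tilt`), while uniqueness of the optimiser gives a linear error bound
(`exists_error_bound`). Hence a variance deviation of order `ρ` always comes with a mean loss lower
by order `ρ ^ 2` (`exists_converse_estimate`), and completing a square leaves a bounded correction
to the threshold (`eventually_le_prodExp`).

Achievability. Take all legitimate output sequences of one type close to the optimal output law, and
feed the channel with the conditional law of the input given the output. The decoder then makes no
error, and secrecy is a matter of partitioning the sequences into bins whose averaged eavesdropper
laws nearly agree. A greedy second-moment argument gives the bins (`exists_balanced_partition`,
`exists_secret_bins`), at the price of the mass where the likelihood ratio is large; that mass is a
Gaussian tail (`eventually_atypical_le`). The type class has polynomially small probability at worst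
(`exists_le_log_card_mul_prob`), which costs `O(log n)`. Finally, ignoring the message with
probability `ε` and sending an independent uniform one multiplies the secrecy distance by `1 - ε`
(`SecrecyCode.exists_mix`), so a zero-error code of secrecy `δ / (1 - ε)` becomes one with
parameters `ε` and `δ`.

Both tails use `berryEsseen`, proved by Stein's method with the zero-bias coupling. When `ε + δ ≥
1`, the same mixing applied to an uncoded bijection already meets the constraints. -/

/-- The standard Gaussian density. -/
def stdDensity (t : ℝ) : ℝ := 1 / Real.sqrt (2 * Real.pi) * Real.exp (-t ^ 2 / 2)

lemma stdDensity_eq : stdDensity = ProbabilityTheory.gaussianPDFReal 0 1 := by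
  funext t; simp [stdDensity, ProbabilityTheory.gaussianPDFReal]

lemma stdDensity_pos (t : ℝ) : 0 < stdDensity t := by unfold stdDensity; positivity

lemma continuous_stdDensity : Continuous stdDensity := by unfold stdDensity; fun_prop

lemma integrable_stdDensity : Integrable stdDensity :=
  stdDensity_eq ▸ ProbabilityTheory.integrable_gaussianPDFReal 0 1

lemma integral_stdDensity : ∫ t, stdDensity t = 1 := by
  rw [stdDensity_eq]; exact ProbabilityTheory.integral_gaussianPDFReal_eq_one 0 one_ne_zero

lemma stdDensity_neg (t : ℝ) : stdDensity (-t) = stdDensity t := by simp [stdDensity]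

lemma stdDensity_le_one (t : ℝ) : stdDensity t ≤ 1 := by
  unfold stdDensity
  have h1 : 1 ≤ Real.sqrt (2 * Real.pi) := Real.one_le_sqrt.2 (by linarith [Real.pi_gt_three])
  have h2 : Real.exp (-t ^ 2 / 2) ≤ 1 := Real.exp_le_one_iff.2 (by nlinarith [sq_nonneg t])
  have h3 : 1 / Real.sqrt (2 * Real.pi) ≤ 1 := by rw [div_le_one (by positivity)]; exact h1
  calc _ ≤ (1 : ℝ) * 1 := by gcongr
    _ = 1 := one_mul 1

lemma stdDensity_anti {s t : ℝ} (h : |s| ≤ |t|) : stdDensity t ≤ stdDensity s := by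
  unfold stdDensity
  have := sq_le_sq.2 h
  gcongr

lemma hasDerivAt_stdDensity (t : ℝ) : HasDerivAt stdDensity (-t * stdDensity t) t := by
  unfold stdDensity
  have h : HasDerivAt (fun t : ℝ => -t ^ 2 / 2) (-t) t := by
    have := ((hasDerivAt_pow 2 t).neg).div_const 2
    convert! this using 1
    simp; ring
  have := (h.exp).const_mul (1 / Real.sqrt (2 * Real.pi))
  convert! this using 1
  ring

lemma tendsto_stdDensity_atTop : Tendsto stdDensity atTop (𝓝 0) := by
  have h : Tendsto (fun t : ℝ => -t ^ 2 / 2) atTop atBot := by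
    have h2 : Tendsto (fun t : ℝ => t ^ 2 / 2) atTop atTop :=
      (tendsto_pow_atTop two_ne_zero).atTop_div_const (by norm_num)
    have := tendsto_neg_atTop_atBot.comp h2
    refine this.congr fun t => ?_
    simp [neg_div]
  have := (Real.tendsto_exp_atBot.comp h).const_mul (1 / Real.sqrt (2 * Real.pi))
  rw [mul_zero] at this
  exact this

lemma gaussianQ_eq (x : ℝ) : gaussianQ x = ∫ t in Set.Ioi x, stdDensity t := rfl

lemma gaussianQ_nonneg (x : ℝ) : 0 ≤ gaussianQ x :=
  setIntegral_nonneg measurableSet_Ioi fun t _ => (stdDensity_pos t).le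

lemma gaussianQ_eq_Iic (x : ℝ) : gaussianQ (-x) = ∫ t in Set.Iic x, stdDensity t := by
  rw [gaussianQ_eq, ← integral_comp_neg_Iic]
  simp [stdDensity_neg]

lemma Iic_eq_one_sub_gaussianQ (x : ℝ) : ∫ t in Set.Iic x, stdDensity t = 1 - gaussianQ x := by
  have := intervalIntegral.integral_Iic_add_Ioi (b := x) integrable_stdDensity.integrableOn
    integrable_stdDensity.integrableOn
  rw [integral_stdDensity] at this
  rw [gaussianQ_eq]; linarith

lemma gaussianQ_neg (x : ℝ) : gaussianQ (-x) = 1 - gaussianQ x := by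
  rw [gaussianQ_eq_Iic, Iic_eq_one_sub_gaussianQ]

lemma gaussianQ_le_one (x : ℝ) : gaussianQ x ≤ 1 := by
  have := gaussianQ_nonneg (-x)
  rw [gaussianQ_neg] at this; linarith

lemma gaussianQ_sub (x y : ℝ) : gaussianQ x - gaussianQ y = ∫ t in x..y, stdDensity t := by
  have := intervalIntegral.integral_Iic_sub_Iic (a := x) (b := y)
    integrable_stdDensity.integrableOn integrable_stdDensity.integrableOn
  rw [← this, Iic_eq_one_sub_gaussianQ, Iic_eq_one_sub_gaussianQ]; ring

lemma gaussianQ_sub_le {x y : ℝ} (h : x ≤ y) : gaussianQ x - gaussianQ y ≤ y - x := by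
  rw [gaussianQ_sub]
  have := intervalIntegral.integral_mono_on h (continuous_stdDensity.intervalIntegrable (μ := volume) x y)
    (continuous_const.intervalIntegrable (μ := volume) x y) (fun t _ => stdDensity_le_one t)
  simpa using this

lemma le_gaussianQ_sub {x y m : ℝ} (h : x ≤ y) (hm : ∀ t ∈ Set.Icc x y, m ≤ stdDensity t) :
    m * (y - x) ≤ gaussianQ x - gaussianQ y := by
  rw [gaussianQ_sub]
  have := intervalIntegral.integral_mono_on h (continuous_const.intervalIntegrable (μ := volume) x y)
    (continuous_stdDensity.intervalIntegrable (μ := volume) x y) hm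
  simpa [mul_comm] using this

lemma gaussianQ_anti : Antitone gaussianQ := fun x y h => by
  have := le_gaussianQ_sub (m := 0) h fun t _ => (stdDensity_pos t).le
  linarith

lemma continuous_gaussianQ : Continuous gaussianQ := by
  have : LipschitzWith 1 gaussianQ := LipschitzWith.of_dist_le_mul fun x y => by
    rw [Real.dist_eq, Real.dist_eq, NNReal.coe_one, one_mul]
    rcases le_total x y with h | h
    · rw [abs_of_nonneg (sub_nonneg.2 (gaussianQ_anti h)), abs_of_nonpos (by linarith)]
      linarith [gaussianQ_sub_le h]
    · rw [abs_of_nonpos (sub_nonpos.2 (gaussianQ_anti h)), abs_of_nonneg (by linarith)]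
      linarith [gaussianQ_sub_le h]
  exact this.continuous

lemma tendsto_gaussianQ_atTop : Tendsto gaussianQ atTop (𝓝 0) :=
  tendsto_integral_Ioi_zero tendsto_id

lemma gaussianQ_gaussianQInv {p : ℝ} (h0 : 0 < p) (h1 : p < 1) : gaussianQ (gaussianQInv p) = p := by
  refine Function.invFun_eq ?_
  obtain ⟨b, hb⟩ := (tendsto_gaussianQ_atTop.eventually (gt_mem_nhds h0)).exists
  obtain ⟨a, ha⟩ := (tendsto_gaussianQ_atTop.eventually
    (gt_mem_nhds (show (0 : ℝ) < 1 - p by linarith))).exists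
  have ha' : p ≤ gaussianQ (-a) := by rw [gaussianQ_neg]; linarith
  exact mem_range_of_exists_le_of_exists_ge continuous_gaussianQ ⟨b, hb.le⟩ ⟨-a, ha'⟩

/-- The density is bounded below on the unit interval around `r`. Shifting the argument by a
multiple of `1 / √n` therefore buys a proportional change of probability, enough to absorb all
errors of that order. -/
lemma exists_gaussianQ_slope (r : ℝ) : ∃ κ > 0, ∀ u, 0 ≤ u → u ≤ 1 →
    gaussianQ r + κ * u ≤ gaussianQ (r - u) ∧ gaussianQ (r + u) ≤ gaussianQ r - κ * u := by
  refine ⟨stdDensity (|r| + 1), stdDensity_pos _, fun u h0 h1 => ?_⟩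
  have key : ∀ t, |t - r| ≤ 1 → stdDensity (|r| + 1) ≤ stdDensity t := fun t ht =>
    stdDensity_anti <| by
      rw [abs_of_nonneg (by positivity : 0 ≤ |r| + 1)]
      have := abs_add_le (t - r) r
      rw [sub_add_cancel] at this; linarith
  constructor
  · have := le_gaussianQ_sub (x := r - u) (y := r) (by linarith) fun t ht =>
      key t (by rw [abs_le]; constructor <;> linarith [ht.1, ht.2])
    linarith [this, show stdDensity (|r| + 1) * (r - (r - u)) = stdDensity (|r| + 1) * u by ring]
  · have := le_gaussianQ_sub (x := r) (y := r + u) (by linarith) fun t ht =>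
      key t (by rw [abs_le]; constructor <;> linarith [ht.1, ht.2])
    linarith [this, show stdDensity (|r| + 1) * (r + u - r) = stdDensity (|r| + 1) * u by ring]

/-- Mills' bound: on the tail beyond `w` the density is multiplied by at least `w`, and `t *
stdDensity t` integrates there to exactly `stdDensity w`. -/
lemma mul_gaussianQ_le (w : ℝ) (hw : 0 ≤ w) : w * gaussianQ w ≤ stdDensity w := by
  have hder : ∀ x ∈ Set.Ici w, HasDerivAt stdDensity (-x * stdDensity x) x :=
    fun x _ => hasDerivAt_stdDensity x
  have hneg : ∀ x ∈ Set.Ioi w, -x * stdDensity x ≤ 0 := fun x hx => by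
    have := stdDensity_pos x
    have hx' : w < x := hx
    nlinarith
  have hint := integrableOn_Ioi_deriv_of_nonpos' hder hneg tendsto_stdDensity_atTop
  have heq := integral_Ioi_of_hasDerivAt_of_nonpos' hder hneg tendsto_stdDensity_atTop
  rw [gaussianQ_eq, ← integral_const_mul]
  have : ∫ x in Set.Ioi w, w * stdDensity x ≤ ∫ x in Set.Ioi w, -(-x * stdDensity x) := by
    refine setIntegral_mono_on (integrable_stdDensity.integrableOn.const_mul w) hint.neg
      measurableSet_Ioi fun x hx => ?_
    have := stdDensity_pos x
    have hx' : w < x := hx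
    nlinarith
  rw [integral_neg, heq] at this
  linarith

lemma gaussianQ_le_six_mul (w : ℝ) (hw : 0 ≤ w) : gaussianQ w ≤ 6 * stdDensity w := by
  rcases le_total 1 w with h | h
  · have h1 := mul_gaussianQ_le w hw
    have h2 := gaussianQ_nonneg w
    have h3 := stdDensity_pos w
    nlinarith
  · have h1 := gaussianQ_le_one w
    have h2 : stdDensity 1 ≤ stdDensity w := stdDensity_anti (by
      rw [abs_of_nonneg hw, abs_one]; exact h)
    have h3 : 1 / 6 ≤ stdDensity 1 := by
      unfold stdDensity
      have h4 : Real.sqrt (2 * Real.pi) ≤ 3 := Real.sqrt_le_iff.2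
        ⟨by norm_num, by linarith [Real.pi_lt_four]⟩
      have h5 : (1 : ℝ) / 2 ≤ Real.exp (-1 ^ 2 / 2) := by
        have := Real.add_one_le_exp (-1 ^ 2 / 2 : ℝ)
        linarith
      have h6 : (1 : ℝ) / 3 ≤ 1 / Real.sqrt (2 * Real.pi) :=
        one_div_le_one_div_of_le (by positivity) h4
      calc (1 : ℝ) / 6 = 1 / 3 * (1 / 2) := by norm_num
        _ ≤ _ := by gcongr
    linarith

/-! ### Stein's equation -/

/-- The bounded solution of Stein's equation `f'(w) = w f(w) + h(w) - ∫ h φ`. -/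
def steinSol (h : ℝ → ℝ) (w : ℝ) : ℝ :=
  (stdDensity w)⁻¹ * ∫ t in Set.Iic w, (h t - ∫ s, h s * stdDensity s) * stdDensity t

section Stein
variable {h : ℝ → ℝ} (hc : Continuous h) (h0 : ∀ t, 0 ≤ h t) (h1 : ∀ t, h t ≤ 1)
include hc h0 h1

lemma integrable_mul_stdDensity : Integrable fun t => h t * stdDensity t := by
  refine integrable_stdDensity.mono (hc.mul continuous_stdDensity).aestronglyMeasurable ?_
  refine Eventually.of_forall fun t => ?_
  rw [norm_mul, Real.norm_of_nonneg (h0 t)]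
  exact mul_le_of_le_one_left (norm_nonneg _) (h1 t)

lemma integral_mul_stdDensity_mem :
    0 ≤ ∫ t, h t * stdDensity t ∧ ∫ t, h t * stdDensity t ≤ 1 := by
  constructor
  · exact integral_nonneg fun t => mul_nonneg (h0 t) (stdDensity_pos t).le
  · rw [← integral_stdDensity]
    exact integral_mono (integrable_mul_stdDensity hc h0 h1) integrable_stdDensity fun t =>
      mul_le_of_le_one_left (stdDensity_pos t).le (h1 t)

lemma integrable_centered :
    Integrable fun t => (h t - ∫ s, h s * stdDensity s) * stdDensity t := by
  simp_rw [sub_mul]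
  exact (integrable_mul_stdDensity hc h0 h1).sub (integrable_stdDensity.const_mul _)

lemma abs_centered_le (t : ℝ) : |h t - ∫ s, h s * stdDensity s| ≤ 1 := by
  have := integral_mul_stdDensity_mem hc h0 h1
  rw [abs_le]; constructor <;> linarith [h0 t, h1 t]

lemma integral_centered :
    ∫ t, (h t - ∫ s, h s * stdDensity s) * stdDensity t = 0 := by
  simp_rw [sub_mul]
  rw [integral_sub (integrable_mul_stdDensity hc h0 h1) (integrable_stdDensity.const_mul _),
    integral_const_mul, integral_stdDensity]
  ring

lemma hasDerivAt_steinSol (w : ℝ) :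
    HasDerivAt (steinSol h) (w * steinSol h w + h w - ∫ s, h s * stdDensity s) w := by
  set μ := ∫ s, h s * stdDensity s with hμ
  have hcont : Continuous fun t => (h t - μ) * stdDensity t :=
    (hc.sub continuous_const).mul continuous_stdDensity
  have hint := integrable_centered hc h0 h1
  have hF : HasDerivAt (fun w => ∫ t in Set.Iic w, (h t - μ) * stdDensity t)
      ((h w - μ) * stdDensity w) w := by
    have h2 := (intervalIntegral.integral_hasDerivAt_right (hcont.intervalIntegrable 0 w)
      (hcont.stronglyMeasurableAtFilter _ _) hcont.continuousAt).const_add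
      (∫ t in Set.Iic 0, (h t - μ) * stdDensity t)
    refine h2.congr_of_eventuallyEq (Eventually.of_forall fun v => ?_)
    have := intervalIntegral.integral_Iic_sub_Iic (a := 0) (b := v) hint.integrableOn
      hint.integrableOn
    simp only [← hμ] at this
    simp only [← this]; ring
  have hi := (hasDerivAt_stdDensity w).inv (stdDensity_pos w).ne'
  have := hi.mul hF
  refine this.congr_deriv ?_
  have hne := (stdDensity_pos w).ne'
  simp only [steinSol, ← hμ]
  simp
  field_simp
  ring

lemma abs_steinSol_le (w : ℝ) : |steinSol h w| ≤ (stdDensity w)⁻¹ * gaussianQ |w| := by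
  set μ := ∫ s, h s * stdDensity s with hμ
  have hint := integrable_centered hc h0 h1
  have hle : ∀ t, |(h t - μ) * stdDensity t| ≤ stdDensity t := fun t => by
    rw [abs_mul, abs_of_pos (stdDensity_pos t)]
    exact mul_le_of_le_one_left (stdDensity_pos t).le (abs_centered_le hc h0 h1 t)
  unfold steinSol
  rw [abs_mul, abs_of_pos (inv_pos.2 (stdDensity_pos w))]
  refine mul_le_mul_of_nonneg_left ?_ (inv_pos.2 (stdDensity_pos w)).le
  rcases le_total 0 w with hw | hw
  -- The centred integrand has total integral zero, so for `w ≥ 0` the integral over the left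
  -- half-line is minus that over the right tail, which is the small one.
  · have := intervalIntegral.integral_Iic_add_Ioi (b := w) hint.integrableOn hint.integrableOn
    rw [integral_centered hc h0 h1] at this
    rw [eq_neg_of_add_eq_zero_left this, abs_neg, abs_of_nonneg hw, gaussianQ_eq]
    refine (abs_integral_le_integral_abs).trans ?_
    exact setIntegral_mono hint.abs.integrableOn integrable_stdDensity.integrableOn hle
  · rw [abs_of_nonpos hw, gaussianQ_eq_Iic]
    refine (abs_integral_le_integral_abs).trans ?_
    exact setIntegral_mono hint.abs.integrableOn integrable_stdDensity.integrableOn hle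

lemma abs_steinSol_le_six (w : ℝ) : |steinSol h w| ≤ 6 := by
  refine (abs_steinSol_le hc h0 h1 w).trans ?_
  have := gaussianQ_le_six_mul |w| (abs_nonneg w)
  have h2 : stdDensity |w| = stdDensity w := by simp [stdDensity]
  rw [h2] at this
  rw [inv_mul_le_iff₀ (stdDensity_pos w)]; linarith

lemma abs_mul_steinSol_le_one (w : ℝ) : |w * steinSol h w| ≤ 1 := by
  rw [abs_mul]
  have := mul_gaussianQ_le |w| (abs_nonneg w)
  have h2 : stdDensity |w| = stdDensity w := by simp [stdDensity]
  rw [h2] at this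
  calc |w| * |steinSol h w| ≤ |w| * ((stdDensity w)⁻¹ * gaussianQ |w|) := by
        gcongr; exact abs_steinSol_le hc h0 h1 w
    _ = (stdDensity w)⁻¹ * (|w| * gaussianQ |w|) := by ring
    _ ≤ 1 := by rw [inv_mul_le_iff₀ (stdDensity_pos w)]; linarith

lemma abs_steinSol_sub_le (v w : ℝ) : |steinSol h v - steinSol h w| ≤ 2 * |v - w| := by
  have := Convex.norm_image_sub_le_of_norm_hasDerivWithin_le (f := steinSol h) (s := Set.univ)
    (C := 2) (x := w) (y := v)
    (fun x _ => (hasDerivAt_steinSol hc h0 h1 x).hasDerivWithinAt)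
    (fun x _ => by
      have h2 := abs_mul_steinSol_le_one hc h0 h1 x
      have h3 := abs_centered_le hc h0 h1 x
      rw [Real.norm_eq_abs, add_sub_assoc]
      exact (abs_add_le _ _).trans (by linarith)) convex_univ trivial trivial
  simpa [Real.norm_eq_abs] using this

/-- Only boundedness and the Lipschitz property of the solution enter, so the bound needs no
regularity of `h` beyond continuity. This is what allows arbitrarily steep test functions later. -/
lemma abs_mul_steinSol_sub_le (v u : ℝ) :
    |(v + u) * steinSol h (v + u) - v * steinSol h v| ≤ (2 * |v| + 6) * |u| := by
  have h2 := abs_steinSol_sub_le hc h0 h1 (v + u) v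
  have h3 := abs_steinSol_le_six hc h0 h1 (v + u)
  rw [add_sub_cancel_left] at h2
  calc _ = |v * (steinSol h (v + u) - steinSol h v) + u * steinSol h (v + u)| := by ring_nf
    _ ≤ |v| * |steinSol h (v + u) - steinSol h v| + |u| * |steinSol h (v + u)| := by
      refine (abs_add_le _ _).trans ?_; rw [abs_mul, abs_mul]
    _ ≤ |v| * (2 * |u|) + |u| * 6 := by gcongr
    _ = _ := by ring

end Stein

/-! ### Expectations over finite product distributions -/

section ProdExp
variable {ι A : Type*} [Fintype ι] [DecidableEq ι] [Fintype A]

/-- The expectation of `F` under the product of the distributions `w k`. -/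
def prodExp (w : ι → A → ℝ) (F : (ι → A) → ℝ) : ℝ := ∑ z, (∏ k, w k (z k)) * F z

variable {w : ι → A → ℝ} (hw : ∀ k, w k ∈ stdSimplex ℝ A)

lemma prodExp_add (F G : (ι → A) → ℝ) :
    prodExp w (fun z => F z + G z) = prodExp w F + prodExp w G := by
  simp [prodExp, mul_add, sum_add_distrib]

lemma prodExp_sub (F G : (ι → A) → ℝ) :
    prodExp w (fun z => F z - G z) = prodExp w F - prodExp w G := by
  simp [prodExp, mul_sub, sum_sub_distrib]

lemma prodExp_sum {κ : Type*} (s : Finset κ) (F : κ → (ι → A) → ℝ) :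
    prodExp w (fun z => ∑ j ∈ s, F j z) = ∑ j ∈ s, prodExp w (F j) := by
  simp only [prodExp, mul_sum]
  exact sum_comm

lemma prodExp_const_mul (c : ℝ) (F : (ι → A) → ℝ) :
    prodExp w (fun z => c * F z) = c * prodExp w F := by
  simp only [prodExp, mul_sum]
  exact sum_congr rfl fun z _ => by ring

include hw

omit [DecidableEq ι] in
lemma prod_weight_nonneg (z : ι → A) : 0 ≤ ∏ k, w k (z k) :=
  prod_nonneg fun k _ => (hw k).1 _

lemma sum_prod_weight : ∑ z : ι → A, ∏ k, w k (z k) = 1 := by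
  rw [← Fintype.prod_sum]
  exact prod_eq_one fun k _ => (hw k).2

lemma prodExp_const (c : ℝ) : prodExp w (fun _ => c) = c := by
  rw [prodExp, ← sum_mul, sum_prod_weight hw, one_mul]

lemma prodExp_mono {F G : (ι → A) → ℝ} (h : ∀ z, F z ≤ G z) : prodExp w F ≤ prodExp w G :=
  sum_le_sum fun z _ => mul_le_mul_of_nonneg_left (h z) (prod_weight_nonneg hw z)

/-- Resampling one coordinate does not change the expectation. -/
lemma prodExp_update (k : ι) (F : (ι → A) → ℝ) :
    prodExp w F = prodExp w fun z => ∑ a, w k a * F (Function.update z k a) := by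
  have h1 : prodExp w F = ∑ p : (ι → A) × A, (∏ j, w j (p.1 j)) * w k p.2 * F p.1 := by
    rw [Fintype.sum_prod_type]
    refine sum_congr rfl fun z _ => ?_
    simp only [mul_right_comm _ _ (F z)]
    rw [← mul_sum, (hw k).2, mul_one]
  have h2 : (prodExp w fun z => ∑ a, w k a * F (Function.update z k a))
      = ∑ p : (ι → A) × A, (∏ j, w j (p.1 j)) * w k p.2 * F (Function.update p.1 k p.2) := by
    rw [Fintype.sum_prod_type]
    refine sum_congr rfl fun z _ => ?_
    simp only [mul_sum, mul_assoc]
  rw [h1, h2]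
  -- Exchanging the `k`-th coordinate with the independent fresh copy is a weight-preserving
  -- involution.
  let e : (ι → A) × A → (ι → A) × A := fun p => (Function.update p.1 k p.2, p.1 k)
  have he : Function.Involutive e := fun p => by simp [e]
  refine (Fintype.sum_equiv he.toPerm _ _ fun p => ?_).symm
  have : ∏ j, w j (p.1 j) * 1 = (∏ j, w j (p.1 j)) := by simp
  simp only [Function.Involutive.coe_toPerm, e]
  congr 1
  rw [← mul_prod_erase univ (fun j => w j (p.1 j)) (mem_univ k),
    ← mul_prod_erase univ (fun j => w j (Function.update p.1 k p.2 j)) (mem_univ k)]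
  rw [prod_congr rfl (fun j hj => by
    rw [Function.update_of_ne (ne_of_mem_erase hj)] :
    ∀ j ∈ univ.erase k, w j (Function.update p.1 k p.2 j) = w j (p.1 j))]
  simp only [Function.update_self]
  ring

lemma prodExp_apply (k : ι) (g : A → ℝ) : prodExp w (fun z => g (z k)) = ∑ a, w k a * g a := by
  rw [prodExp_update hw k]
  simp only [Function.update_self]
  exact prodExp_const hw _

variable {ξ : ι → A → ℝ} (hξ : ∀ k, ∑ a, w k a * ξ k a = 0)
include hξ

lemma prodExp_mul_self_sum :
    prodExp w (fun z => (∑ k, ξ k (z k)) ^ 2) = ∑ k, ∑ a, w k a * ξ k a ^ 2 := by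
  have h1 : (fun z : ι → A => (∑ k, ξ k (z k)) ^ 2) =
      fun z => ∑ k, ∑ j, ξ j (z j) * ξ k (z k) := by
    funext z; rw [sq, mul_sum]; exact sum_congr rfl fun k _ => sum_mul _ _ _
  rw [h1, prodExp_sum]
  refine sum_congr rfl fun k _ => ?_
  rw [prodExp_sum, sum_eq_single k]
  · rw [← prodExp_apply hw k (fun a => ξ k a ^ 2)]
    simp only [sq]
  · intro j _ hj
    rw [prodExp_update hw k]
    simp only [Function.update_self, Function.update_of_ne hj, mul_left_comm (w k _), ← mul_sum,
      hξ k, mul_zero]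
    exact prodExp_const hw 0
  · simp

/-- Chebyshev's inequality. -/
lemma prodExp_chebyshev {s : ℝ} (hs : 0 < s) :
    prodExp w (fun z => if s < ∑ k, ξ k (z k) then 1 else 0)
      ≤ (∑ k, ∑ a, w k a * ξ k a ^ 2) / s ^ 2 := by
  rw [le_div_iff₀ (by positivity), mul_comm, ← prodExp_const_mul, ← prodExp_mul_self_sum hw hξ]
  refine prodExp_mono hw fun z => ?_
  split_ifs with h
  · rw [mul_one]; gcongr
  · rw [mul_zero]; positivity

end ProdExp

/-! ### A Berry–Esseen bound for bounded summands -/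

section BerryEsseen
variable {ι A : Type*} [Fintype ι] [DecidableEq ι] [Fintype A]
  {w ξ : ι → A → ℝ} (hw : ∀ k, w k ∈ stdSimplex ℝ A) (hξ : ∀ k, ∑ a, w k a * ξ k a = 0)
  (hvar : ∑ k, ∑ a, w k a * ξ k a ^ 2 = 1) {β : ℝ} (hβ : ∀ k a, |ξ k a| ≤ β)

/-- The expectation of `g` under the zero-bias distribution of the sum of the `ξ k`. -/
def zeroBias (w ξ : ι → A → ℝ) (g : ℝ → ℝ) : ℝ :=
  prodExp w fun z => ∑ k, ∑ a, w k a * ξ k a ^ 2 *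
    ∫ θ in (0 : ℝ)..1, g ((∑ j, ξ j (z j)) + (θ * ξ k a - ξ k (z k)))

-- The defining identity of the zero-bias law. With the `k`-th summand resampled, centring allows
-- subtracting the value of `f` at the sum of the other coordinates; the increment of `f` is then
-- written as an integral of its derivative.
include hw hξ in
lemma zeroBias_deriv {f f' : ℝ → ℝ} (hf : ∀ x, HasDerivAt f (f' x) x) (hf' : Continuous f') :
    prodExp w (fun z => (∑ k, ξ k (z k)) * f (∑ k, ξ k (z k))) = zeroBias w ξ f' := by
  simp only [zeroBias, sum_mul]
  rw [prodExp_sum, prodExp_sum]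
  refine sum_congr rfl fun k _ => ?_
  rw [prodExp_update hw k]
  unfold prodExp
  refine sum_congr rfl fun z _ => ?_
  congr 1
  set s := (∑ j, ξ j (z j)) - ξ k (z k) with hs
  have h1 : ∀ a, ∑ j, ξ j (Function.update z k a j) = s + ξ k a := fun a => by
    rw [hs, ← add_sum_erase univ _ (mem_univ k), ← add_sum_erase univ (fun j => ξ j (z j))
      (mem_univ k), Function.update_self, sum_congr rfl (fun j hj => by
      rw [Function.update_of_ne (ne_of_mem_erase hj)] :
      ∀ j ∈ univ.erase k, ξ j (Function.update z k a j) = ξ j (z j))]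
    ring
  have h2 : ∀ a, ξ k a * ∫ θ in (0 : ℝ)..1, f' (s + θ * ξ k a) = f (s + ξ k a) - f s := by
    intro a
    have := intervalIntegral.integral_eq_sub_of_hasDerivAt (a := (0 : ℝ)) (b := 1)
      (f := fun θ => f (s + θ * ξ k a)) (f' := fun θ => f' (s + θ * ξ k a) * ξ k a)
      (fun θ _ => by
        have := (hf (s + θ * ξ k a)).comp θ (((hasDerivAt_id θ).mul_const (ξ k a)).const_add s)
        simpa [Function.comp_def] using this)
      (Continuous.intervalIntegrable (by fun_prop) _ _)
    rw [intervalIntegral.integral_mul_const] at this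
    rw [mul_comm, this]; simp
  calc ∑ a, w k a * (ξ k (Function.update z k a k) * f (∑ j, ξ j (Function.update z k a j)))
      = ∑ a, (w k a * ξ k a * (f (s + ξ k a) - f s) + w k a * ξ k a * f s) := by
        refine sum_congr rfl fun a _ => ?_
        rw [h1, Function.update_self]; ring
    _ = ∑ a, w k a * ξ k a * (f (s + ξ k a) - f s) := by
        rw [sum_add_distrib, ← sum_mul, hξ k, zero_mul, add_zero]
    _ = _ := by
        refine sum_congr rfl fun a _ => ?_
        rw [← h2]
        have : ∀ θ : ℝ, ∑ j, ξ j (z j) + (θ * ξ k a - ξ k (z k)) = s + θ * ξ k a := fun θ => by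
          rw [hs]; ring
        simp only [this]; ring

include hw hvar hβ in
/-- The zero-bias distribution is within `2 β` of the distribution itself. -/
lemma zeroBias_le_of_forall {g : ℝ → ℝ} (hg : Continuous g) {F : ℝ → ℝ}
    (h : ∀ v u, |u| ≤ 2 * β → g (v + u) ≤ F v) :
    zeroBias w ξ g ≤ prodExp w fun z => F (∑ k, ξ k (z k)) := by
  refine prodExp_mono hw fun z => ?_
  calc _ ≤ ∑ k, ∑ a, w k a * ξ k a ^ 2 * F (∑ k, ξ k (z k)) := by
        refine sum_le_sum fun k _ => sum_le_sum fun a _ =>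
          mul_le_mul_of_nonneg_left ?_ (mul_nonneg ((hw k).1 a) (sq_nonneg _))
        have := intervalIntegral.integral_mono_on (μ := volume) (a := (0 : ℝ)) (b := 1) zero_le_one
          (f := fun θ => g ((∑ j, ξ j (z j)) + (θ * ξ k a - ξ k (z k))))
          (g := fun _ => F (∑ k, ξ k (z k)))
          (Continuous.intervalIntegrable (by fun_prop) _ _)
          (Continuous.intervalIntegrable (by fun_prop) _ _) (fun θ hθ => h _ _ ?_)
        · simpa using this
        · have h1 := hβ k a
          have h2 := hβ k (z k)
          have h3 : |θ * ξ k a| ≤ β := by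
            rw [abs_mul, abs_of_nonneg hθ.1]
            exact (mul_le_of_le_one_left (abs_nonneg _) hθ.2).trans h1
          exact (abs_sub _ _).trans (by linarith)
    _ = _ := by simp only [← sum_mul]; rw [hvar, one_mul]

lemma zeroBias_neg (g : ℝ → ℝ) : zeroBias w ξ (-g) = - zeroBias w ξ g := by
  simp [zeroBias, prodExp, intervalIntegral.integral_neg]

include hw hvar hβ in
lemma le_zeroBias_of_forall {g : ℝ → ℝ} (hg : Continuous g) {F : ℝ → ℝ}
    (h : ∀ v u, |u| ≤ 2 * β → F v ≤ g (v + u)) :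
    prodExp w (fun z => F (∑ k, ξ k (z k))) ≤ zeroBias w ξ g := by
  have := zeroBias_le_of_forall hw hvar hβ hg.neg (F := fun v => - F v)
    fun v u hu => neg_le_neg (h v u hu)
  rw [zeroBias_neg] at this
  have h2 : prodExp w (fun z => -F (∑ k, ξ k (z k))) = - prodExp w fun z => F (∑ k, ξ k (z k)) := by
    simp [prodExp]
  rw [h2] at this; linarith

lemma zeroBias_add {g₁ g₂ : ℝ → ℝ} (h₁ : Continuous g₁) (h₂ : Continuous g₂) :
    zeroBias w ξ (g₁ + g₂) = zeroBias w ξ g₁ + zeroBias w ξ g₂ := by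
  unfold zeroBias
  rw [← prodExp_add]
  congr 1; funext z
  simp_rw [← sum_add_distrib, ← mul_add]
  refine sum_congr rfl fun k _ => sum_congr rfl fun a _ => ?_
  simp only [Pi.add_apply]
  rw [intervalIntegral.integral_add] <;> exact Continuous.intervalIntegrable (by fun_prop) _ _

include hw hξ hvar in
lemma prodExp_abs_sum_le_one : prodExp w (fun z => |∑ k, ξ k (z k)|) ≤ 1 := by
  have h := prodExp_mul_self_sum hw hξ
  rw [hvar] at h
  have : prodExp w (fun z => |∑ k, ξ k (z k)|)
      ≤ prodExp w (fun z => 1 / 2 + 1 / 2 * (∑ k, ξ k (z k)) ^ 2) :=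
    prodExp_mono hw fun z => by nlinarith [sq_abs (∑ k, ξ k (z k)), sq_nonneg (|∑ k, ξ k (z k)| - 1)]
  rw [prodExp_add, prodExp_const hw, prodExp_const_mul, h] at this
  linarith

-- Inserting Stein's equation into the zero-bias identity turns the error into the difference
-- between the expectations of `v * steinSol h v` under the law of the sum and under its zero-bias
-- law. The two variables are coupled within `2 * β`, and the first absolute moment is at most one,
-- whence `(2 + 6) * 2 * β`.
include hw hξ hvar hβ in
lemma abs_zeroBias_sub_le (hβ0 : 0 ≤ β) {h : ℝ → ℝ} (hc : Continuous h) (h0 : ∀ t, 0 ≤ h t)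
    (h1 : ∀ t, h t ≤ 1) : |zeroBias w ξ h - ∫ t, h t * stdDensity t| ≤ 16 * β := by
  set μ := ∫ t, h t * stdDensity t with hμ
  have hder := hasDerivAt_steinSol hc h0 h1
  have hfc : Continuous (steinSol h) :=
    continuous_iff_continuousAt.2 fun x => (hder x).continuousAt
  set G : ℝ → ℝ := fun v => v * steinSol h v with hG
  have hGc : Continuous G := continuous_id.mul hfc
  have h2 := zeroBias_deriv hw hξ hder ((hGc.add hc).sub continuous_const)
  have h3 : zeroBias w ξ (fun w => w * steinSol h w + h w - ∫ s, h s * stdDensity s)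
      = zeroBias w ξ G + zeroBias w ξ h - μ := by
    have h4 : zeroBias w ξ (fun _ => -μ) = -μ := by
      unfold zeroBias
      simp only [intervalIntegral.integral_const, sub_zero, one_smul, ← sum_mul]
      rw [hvar, prodExp_const hw, one_mul]
    have := zeroBias_add (w := w) (ξ := ξ) (g₂ := fun _ => -μ) (hGc.add hc) continuous_const
    rw [zeroBias_add hGc hc, h4] at this
    rw [sub_eq_add_neg, ← this]
    rfl
  rw [h3] at h2
  have hbd : ∀ v u, |u| ≤ 2 * β → |G (v + u) - G v| ≤ (2 * |v| + 6) * (2 * β) := fun v u hu =>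
    (abs_mul_steinSol_sub_le hc h0 h1 v u).trans (by gcongr)
  have hE : prodExp w (fun z => (2 * |∑ k, ξ k (z k)| + 6) * (2 * β)) ≤ 16 * β := by
    have := prodExp_abs_sum_le_one hw hξ hvar
    have h5 : (fun z : ι → A => (2 * |∑ k, ξ k (z k)| + 6) * (2 * β))
        = fun z => 4 * β * |∑ k, ξ k (z k)| + 12 * β := by funext z; ring
    rw [h5, prodExp_add, prodExp_const hw, prodExp_const_mul]
    nlinarith
  have hup := zeroBias_le_of_forall hw hvar hβ hGc (F := fun v => G v + (2 * |v| + 6) * (2 * β))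
    fun v u hu => by linarith [(abs_le.1 (hbd v u hu)).2]
  have hlo := le_zeroBias_of_forall hw hvar hβ hGc (F := fun v => G v - (2 * |v| + 6) * (2 * β))
    fun v u hu => by linarith [(abs_le.1 (hbd v u hu)).1]
  rw [prodExp_add] at hup
  rw [prodExp_sub] at hlo
  have h6 : prodExp w (fun z => G (∑ k, ξ k (z k)))
      = prodExp w (fun z => (∑ k, ξ k (z k)) * steinSol h (∑ k, ξ k (z k))) := rfl
  rw [h6] at hup hlo
  rw [abs_le]; constructor <;> linarith

/-- A continuous step of width `β` from `1` on `(-∞, a]` to `0` on `[a + β, ∞)`. -/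
def rampStep (β a x : ℝ) : ℝ := max 0 (min 1 (1 - (x - a) / β))

lemma continuous_rampStep (β a : ℝ) : Continuous (rampStep β a) := by
  unfold rampStep; fun_prop

lemma rampStep_nonneg (β a x : ℝ) : 0 ≤ rampStep β a x := le_max_left _ _

lemma rampStep_le_one (β a x : ℝ) : rampStep β a x ≤ 1 :=
  max_le zero_le_one (min_le_left _ _)

lemma rampStep_eq_one {β a x : ℝ} (hβ : 0 < β) (hx : x ≤ a) : rampStep β a x = 1 := by
  have : (x - a) / β ≤ 0 := div_nonpos_of_nonpos_of_nonneg (by linarith) hβ.le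
  rw [rampStep, min_eq_left (by linarith), max_eq_right zero_le_one]

lemma rampStep_eq_zero {β a x : ℝ} (hβ : 0 < β) (hx : a + β ≤ x) : rampStep β a x = 0 := by
  have : 1 ≤ (x - a) / β := (one_le_div hβ).2 (by linarith)
  rw [rampStep, max_eq_left ((min_le_right _ _).trans (by linarith))]

lemma integral_rampStep_le {β : ℝ} (hβ : 0 < β) (a : ℝ) :
    ∫ t, rampStep β a t * stdDensity t ≤ 1 - gaussianQ (a + β) := by
  rw [← Iic_eq_one_sub_gaussianQ, ← integral_indicator measurableSet_Iic]
  refine integral_mono (integrable_mul_stdDensity (continuous_rampStep β a) (rampStep_nonneg β a)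
    (rampStep_le_one β a)) (integrable_stdDensity.indicator measurableSet_Iic) fun t => ?_
  have := stdDensity_pos t
  simp only [Set.indicator, Set.mem_Iic]
  split_ifs with h
  · exact mul_le_of_le_one_left this.le (rampStep_le_one β a t)
  · rw [rampStep_eq_zero hβ (by linarith), zero_mul]

lemma le_integral_rampStep {β : ℝ} (hβ : 0 < β) (a : ℝ) :
    1 - gaussianQ a ≤ ∫ t, rampStep β a t * stdDensity t := by
  rw [← Iic_eq_one_sub_gaussianQ, ← integral_indicator measurableSet_Iic]
  refine integral_mono (integrable_stdDensity.indicator measurableSet_Iic)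
    (integrable_mul_stdDensity (continuous_rampStep β a) (rampStep_nonneg β a)
    (rampStep_le_one β a)) fun t => ?_
  have := stdDensity_pos t
  simp only [Set.indicator, Set.mem_Iic]
  split_ifs with h
  · rw [rampStep_eq_one hβ h, one_mul]
  · exact mul_nonneg (rampStep_nonneg β a t) this.le

-- A half-line indicator is sandwiched by ramps shifted so as to survive a displacement of `2 * β`.
-- The preceding bound is independent of the slope of the ramp, so a ramp of width `β` costs only
-- `16 * β` plus a shift of `3 * β` in the Gaussian argument.
include hw hξ hvar hβ in
lemma berryEsseen_normalized (hβ0 : 0 < β) (t : ℝ) :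
    |prodExp w (fun z => if ∑ k, ξ k (z k) ≤ t then 1 else 0) - gaussianQ (-t)| ≤ 20 * β := by
  rw [gaussianQ_neg]
  have hA := abs_zeroBias_sub_le hw hξ hvar hβ hβ0.le (continuous_rampStep β (t + 2 * β))
    (rampStep_nonneg _ _) (rampStep_le_one _ _)
  have hB := abs_zeroBias_sub_le hw hξ hvar hβ hβ0.le (continuous_rampStep β (t - 3 * β))
    (rampStep_nonneg _ _) (rampStep_le_one _ _)
  have h1 := integral_rampStep_le hβ0 (t + 2 * β)
  have h2 := le_integral_rampStep hβ0 (t - 3 * β)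
  have h3 : gaussianQ t - gaussianQ (t + 2 * β + β) ≤ t + 2 * β + β - t :=
    gaussianQ_sub_le (by linarith)
  have h4 : gaussianQ (t - 3 * β) - gaussianQ t ≤ t - (t - 3 * β) :=
    gaussianQ_sub_le (by linarith)
  have hup := le_zeroBias_of_forall hw hvar hβ (continuous_rampStep β (t + 2 * β))
    (F := fun v => if v ≤ t then 1 else 0) fun v u hu => by
      split_ifs with h
      · rw [rampStep_eq_one hβ0 (by linarith [(abs_le.1 hu).2])]
      · exact rampStep_nonneg _ _ _
  have hlo := zeroBias_le_of_forall hw hvar hβ (continuous_rampStep β (t - 3 * β))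
    (F := fun v => if v ≤ t then 1 else 0) fun v u hu => by
      split_ifs with h
      · exact rampStep_le_one _ _ _
      · rw [rampStep_eq_zero hβ0 (by linarith [(abs_le.1 hu).1])]
  rw [abs_le] at hA hB ⊢
  constructor <;> linarith

end BerryEsseen

/-- **Berry–Esseen** for a sum of independent finite-valued variables bounded by `b`. -/
theorem berryEsseen {ι A : Type*} [Fintype ι] [DecidableEq ι] [Fintype A] {w u : ι → A → ℝ}
    (hw : ∀ k, w k ∈ stdSimplex ℝ A) {b : ℝ} (hb : 0 < b) (hu : ∀ k a, |u k a| ≤ b) {σ : ℝ}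
    (hσ : 0 < σ)
    (hvar : ∑ k, (∑ a, w k a * u k a ^ 2 - (∑ a, w k a * u k a) ^ 2) = σ ^ 2) (t : ℝ) :
    |prodExp w (fun z => if ∑ k, u k (z k) ≤ t then 1 else 0)
      - gaussianQ ((∑ k, ∑ a, w k a * u k a - t) / σ)| ≤ 40 * b / σ := by
  set m : ι → ℝ := fun k => ∑ a, w k a * u k a with hm
  set ξ : ι → A → ℝ := fun k a => (u k a - m k) / σ with hξdef
  have hmb : ∀ k, |m k| ≤ b := fun k => by
    calc |m k| ≤ ∑ a, |w k a * u k a| := abs_sum_le_sum_abs _ _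
      _ ≤ ∑ a, w k a * b := sum_le_sum fun a _ => by
          rw [abs_mul, abs_of_nonneg ((hw k).1 a)]
          exact mul_le_mul_of_nonneg_left (hu k a) ((hw k).1 a)
      _ = b := by rw [← sum_mul, (hw k).2, one_mul]
  have hξ : ∀ k, ∑ a, w k a * ξ k a = 0 := fun k => by
    simp only [hξdef, mul_div_assoc', ← sum_div, mul_sub, sum_sub_distrib, ← sum_mul, (hw k).2]
    simp [hm]
  have hv : ∑ k, ∑ a, w k a * ξ k a ^ 2 = 1 := by
    have : ∀ k, ∑ a, w k a * ξ k a ^ 2 = (∑ a, w k a * u k a ^ 2 - m k ^ 2) / σ ^ 2 := fun k => by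
      have h1 : ∀ a, w k a * ξ k a ^ 2
          = (w k a * u k a ^ 2 - 2 * m k * (w k a * u k a) + w k a * m k ^ 2) / σ ^ 2 := fun a => by
        simp only [hξdef, div_pow]; ring
      simp only [h1, ← sum_div, sum_add_distrib, sum_sub_distrib, ← mul_sum, ← sum_mul, (hw k).2]
      rw [show ∑ a, w k a * u k a = m k from rfl]; ring
    simp only [this, ← sum_div]
    rw [hvar, div_self (by positivity)]
  -- Centring at most doubles the bound `b`; this is the factor between `20` and `40`.
  have hβ : ∀ k a, |ξ k a| ≤ 2 * b / σ := fun k a => by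
    rw [hξdef, abs_div, abs_of_pos hσ]
    have := (abs_sub (u k a) (m k)).trans (add_le_add (hu k a) (hmb k))
    gcongr; linarith
  have := berryEsseen_normalized hw hξ hv hβ (by positivity) ((t - ∑ k, m k) / σ)
  have h2 : ∀ z : ι → A, ∑ k, ξ k (z k) ≤ (t - ∑ k, m k) / σ ↔ ∑ k, u k (z k) ≤ t := fun z => by
    simp only [hξdef, ← sum_div, sum_sub_distrib]
    rw [div_le_div_iff_of_pos_right hσ, sub_le_sub_iff_right]
  simp only [h2] at this
  rw [show -((t - ∑ k, m k) / σ) = (∑ k, m k - t) / σ by ring] at this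
  exact this.trans (le_of_eq (by ring))

/-! ### One-shot bounds -/

section Basic
variable {A B C : Type*} [Fintype A] [Fintype B] [Fintype C]

lemma outDist_mem {K : A → B → ℝ} (hK : ∀ a, K a ∈ stdSimplex ℝ B) {P : A → ℝ}
    (hP : P ∈ stdSimplex ℝ A) : outDist K P ∈ stdSimplex ℝ B := by
  refine ⟨fun b => sum_nonneg fun a _ => mul_nonneg (hP.1 a) ((hK a).1 b), ?_⟩
  simp only [outDist]
  rw [sum_comm]
  simp only [← mul_sum, (hK _).2, mul_one, hP.2]

lemma marginalFst_mem {P : B × C → ℝ} (hP : P ∈ stdSimplex ℝ (B × C)) :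
    marginalFst P ∈ stdSimplex ℝ B :=
  ⟨fun b => sum_nonneg fun c _ => hP.1 _, by
    simp only [marginalFst]; rw [← Fintype.sum_prod_type', ← hP.2]⟩

lemma marginalSnd_mem {P : B × C → ℝ} (hP : P ∈ stdSimplex ℝ (B × C)) :
    marginalSnd P ∈ stdSimplex ℝ C :=
  ⟨fun c => sum_nonneg fun b _ => hP.1 _, by
    simp only [marginalSnd]; rw [sum_comm, ← Fintype.sum_prod_type', ← hP.2]⟩

lemma uniform_mem {M : ℕ} (hM : 0 < M) : (fun _ : Fin M => 1 / (M : ℝ)) ∈ stdSimplex ℝ (Fin M) :=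
  ⟨fun _ => by positivity, by
    have : (M : ℝ) ≠ 0 := by positivity
    simp [this]⟩

lemma outDist_add_smul (K : A → B → ℝ) (P R : A → ℝ) (s t : ℝ) :
    outDist K (fun a => s * P a + t * R a) = fun b => s * outDist K P b + t * outDist K R b := by
  funext b
  simp only [outDist, mul_sum, ← sum_add_distrib]
  exact sum_congr rfl fun a _ => by ring

lemma outDist_outDist {D : Type*} [Fintype D] (K : A → B → ℝ) (E : D → A → ℝ) (P : D → ℝ) :
    outDist K (outDist E P) = outDist (fun d => outDist K (E d)) P := by
  funext b
  simp only [outDist, sum_mul, mul_sum]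
  rw [sum_comm]
  exact sum_congr rfl fun a _ => sum_congr rfl fun d _ => by ring

lemma marginalFst_add_smul (P R : B × C → ℝ) (s t : ℝ) :
    marginalFst (fun x => s * P x + t * R x) =
      fun b => s * marginalFst P b + t * marginalFst R b := by
  funext b; simp [marginalFst, mul_sum, sum_add_distrib]

lemma marginalSnd_add_smul (P R : B × C → ℝ) (s t : ℝ) :
    marginalSnd (fun x => s * P x + t * R x) =
      fun b => s * marginalSnd P b + t * marginalSnd R b := by
  funext b; simp [marginalSnd, mul_sum, sum_add_distrib]

lemma marginalSnd_outDist {D : Type*} [Fintype D] (J : D → B × C → ℝ) (P : D → ℝ) :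
    marginalSnd (outDist J P) = outDist (fun d => marginalSnd (J d)) P := by
  funext c
  simp only [marginalSnd, outDist, mul_sum]
  exact sum_comm

lemma marginalFst_outDist {D : Type*} [Fintype D] (J : D → B × C → ℝ) (P : D → ℝ) :
    marginalFst (outDist J P) = outDist (fun d => marginalFst (J d)) P := by
  funext c
  simp only [marginalFst, outDist, mul_sum]
  exact sum_comm

lemma tvDist_le_one {P Q : A → ℝ} (hP : P ∈ stdSimplex ℝ A) (hQ : Q ∈ stdSimplex ℝ A) :
    tvDist P Q ≤ 1 := by
  have : ∑ a, |P a - Q a| ≤ ∑ a, (P a + Q a) := sum_le_sum fun a _ =>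
    (abs_sub _ _).trans (by rw [abs_of_nonneg (hP.1 a), abs_of_nonneg (hQ.1 a)])
  rw [sum_add_distrib, hP.2, hQ.2] at this
  unfold tvDist; linarith

open Classical in
lemma sum_ite_sub_le_tvDist {P Q : A → ℝ} (h : ∑ a, P a = ∑ a, Q a) (S : A → Prop) :
    (∑ a, if S a then P a - Q a else 0) ≤ tvDist P Q := by
  have h1 : (∑ a, if S a then P a - Q a else 0) + (∑ a, if S a then 0 else P a - Q a) = 0 := by
    have h0 : ∑ a, (P a - Q a) = 0 := by rw [sum_sub_distrib, h, sub_self]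
    rw [← sum_add_distrib]
    refine Eq.trans ?_ h0
    exact sum_congr rfl fun a _ => by split_ifs <;> ring
  have h2 : (∑ a, if S a then P a - Q a else 0) - (∑ a, if S a then 0 else P a - Q a)
      ≤ ∑ a, |P a - Q a| := by
    rw [← sum_sub_distrib]
    refine sum_le_sum fun a _ => ?_
    split_ifs
    · rw [sub_zero]; exact le_abs_self _
    · rw [zero_sub]; exact neg_le_abs _
  unfold tvDist; linarith

/-- For equal total masses the distance is the sum of the positive parts of `Q - P`, so a one-sided
bound suffices. This avoids charging the atypical mass twice in the binning argument. -/
lemma tvDist_le_of_le {P Q F : A → ℝ} (h : ∑ a, P a = ∑ a, Q a) (hF : ∀ a, 0 ≤ F a)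
    (hle : ∀ a, Q a - P a ≤ F a) : tvDist P Q ≤ ∑ a, F a := by
  have h1 : ∑ a, |P a - Q a| = ∑ a, (2 * max (Q a - P a) 0 + (P a - Q a)) :=
    sum_congr rfl fun a _ => by
      rcases le_total (Q a) (P a) with h | h
      · rw [max_eq_right (by linarith), abs_of_nonneg (by linarith)]; ring
      · rw [max_eq_left (by linarith), abs_of_nonpos (by linarith)]; ring
  rw [tvDist, h1, sum_add_distrib, sum_sub_distrib, h, sub_self, add_zero, ← mul_sum, ← mul_assoc]
  norm_num
  exact sum_le_sum fun a _ => max_le (hle a) (hF a)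

end Basic

/-! ### Operations on secrecy codes -/

namespace SecrecyCode
variable {A B C : Type*} [Fintype A] [Fintype B] [Fintype C] {M : ℕ}

lemma size_pos (c : SecrecyCode A B M) : 0 < M := by
  rcases Nat.eq_zero_or_pos M with rfl | h
  · have := c.msg_mem.2; simp at this
  · exact h

variable {K : A → B × C → ℝ} (hK : ∀ a, K a ∈ stdSimplex ℝ (B × C))
include hK

lemma legitGivenMsg_mem (c : SecrecyCode A B M) (m : Fin M) :
    c.legitGivenMsg K m ∈ stdSimplex ℝ B :=
  marginalFst_mem (outDist_mem hK (c.enc_mem m))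

lemma eveGivenMsg_mem (c : SecrecyCode A B M) (m : Fin M) :
    c.eveGivenMsg K m ∈ stdSimplex ℝ C :=
  marginalSnd_mem (outDist_mem hK (c.enc_mem m))

lemma errorGivenMsg_le_one (c : SecrecyCode A B M) (m : Fin M) : c.errorGivenMsg K m ≤ 1 := by
  rw [← (c.legitGivenMsg_mem hK m).2]
  refine sum_le_sum fun b _ => ?_
  split_ifs
  · exact le_rfl
  · exact (c.legitGivenMsg_mem hK m).1 b

lemma secrecyGivenMsg_le_one (c : SecrecyCode A B M) (m : Fin M) : c.secrecyGivenMsg K m ≤ 1 :=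
  tvDist_le_one (c.eveGivenMsg_mem hK m) (outDist_mem (c.eveGivenMsg_mem hK)
    (uniform_mem c.size_pos))

omit hK in
/-- With a uniform message, a code for the maximum criteria is a code for the average criteria. -/
lemma exists_avg_of_max {ε δ : ℝ} (c : SecrecyCode A B M) (hc : IsSecrecyCode .max K ε δ c) :
    ∃ c' : SecrecyCode A B M, IsSecrecyCode .avg K ε δ c' := by
  have hM : (0 : ℝ) < M := by exact_mod_cast c.size_pos
  have havg : ∀ {g : Fin M → ℝ} {x : ℝ}, (∀ m, g m ≤ x) → ∑ m, 1 / (M : ℝ) * g m ≤ x := by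
    intro g x h
    calc ∑ m, 1 / (M : ℝ) * g m ≤ ∑ _m : Fin M, 1 / (M : ℝ) * x :=
          sum_le_sum fun m _ => mul_le_mul_of_nonneg_left (h m) (by positivity)
      _ = x := by simp [hM.ne']
  refine ⟨⟨fun _ => 1 / (M : ℝ), uniform_mem c.size_pos, c.enc, c.enc_mem, c.dec⟩, havg hc.1, ?_⟩
  refine le_trans (le_of_eq ?_) (havg hc.2)
  simp only [avgSecrecy, secrecyGivenMsg, tvDist, Fintype.sum_prod_type, mul_sum]
  refine sum_congr rfl fun m _ => sum_congr rfl fun z _ => ?_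
  rw [← mul_sub, abs_mul, abs_of_pos (by positivity)]
  exact mul_left_comm _ _ _

/-- Sending an independent copy of the code with probability `p` trades errors for secrecy. -/
lemma exists_mix (c : SecrecyCode A B M) {p d : ℝ} (hp0 : 0 ≤ p) (hp1 : p ≤ 1)
    (herr : ∀ m, c.errorGivenMsg K m = 0) (hsec : ∀ m, c.secrecyGivenMsg K m ≤ d) :
    ∃ c' : SecrecyCode A B M, IsSecrecyCode .max K p ((1 - p) * d) c' := by
  have hU := uniform_mem c.size_pos
  -- The encoder that ignores its message and encodes an independent uniform one.
  set e := outDist c.enc (fun _ => 1 / (M : ℝ)) with he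
  have heM : e ∈ stdSimplex ℝ A := outDist_mem c.enc_mem hU
  let c₁ : SecrecyCode A B M := ⟨c.msg, c.msg_mem, fun _ => e, fun _ => heM, c.dec⟩
  let c' : SecrecyCode A B M := ⟨c.msg, c.msg_mem, fun m a => (1 - p) * c.enc m a + p * e a,
    fun m => ⟨fun a => add_nonneg (mul_nonneg (by linarith) ((c.enc_mem m).1 a))
      (mul_nonneg hp0 (heM.1 a)), by
      rw [sum_add_distrib, ← mul_sum, ← mul_sum, (c.enc_mem m).2, heM.2]; ring⟩, c.dec⟩
  have hlegit : ∀ m, c'.legitGivenMsg K m =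
      fun b => (1 - p) * c.legitGivenMsg K m b + p * c₁.legitGivenMsg K m b := fun m => by
    simp only [legitGivenMsg, c', c₁, outDist_add_smul, marginalFst_add_smul]
  have heve : ∀ m, c'.eveGivenMsg K m =
      fun z => (1 - p) * c.eveGivenMsg K m z + p * c₁.eveGivenMsg K m z := fun m => by
    simp only [eveGivenMsg, c', c₁, outDist_add_smul, marginalSnd_add_smul]
  have h₁ : ∀ m, c₁.eveGivenMsg K m = outDist (c.eveGivenMsg K) (fun _ => 1 / (M : ℝ)) := fun m => by
    simp only [eveGivenMsg, c₁, he]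
    rw [outDist_outDist, marginalSnd_outDist]
    rfl
  refine ⟨c', fun m => ?_, fun m => ?_⟩
  · have h2 : c'.errorGivenMsg K m = (1 - p) * c.errorGivenMsg K m + p * c₁.errorGivenMsg K m := by
      simp only [errorGivenMsg, hlegit, mul_sum, ← sum_add_distrib]
      refine sum_congr rfl fun b _ => ?_
      simp only [c', c₁]
      split_ifs <;> simp
    rw [h2, herr, mul_zero, zero_add]
    exact mul_le_of_le_one_right hp0 (errorGivenMsg_le_one hK c₁ m)
  -- Mixing in the uniform average leaves that average unchanged, so each conditional law contracts
  -- towards a fixed reference by the factor `1 - p`.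
  · have h3 : outDist (c'.eveGivenMsg K) (fun _ => 1 / (M : ℝ))
        = outDist (c.eveGivenMsg K) (fun _ => 1 / (M : ℝ)) := by
      funext z
      have hM : (M : ℝ) ≠ 0 := by exact_mod_cast c.size_pos.ne'
      have : ∀ m, c'.eveGivenMsg K m z = (1 - p) * c.eveGivenMsg K m z
          + p * outDist (c.eveGivenMsg K) (fun _ => 1 / (M : ℝ)) z := fun m => by rw [heve, h₁]
      conv_lhs => rw [outDist]
      simp only [this, mul_add, sum_add_distrib, mul_left_comm _ (1 - p), ← mul_sum]
      rw [show 1 / (M : ℝ) * ∑ x, c.eveGivenMsg K x z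
        = outDist (c.eveGivenMsg K) (fun _ => 1 / (M : ℝ)) z from mul_sum _ _ _]
      simp only [sum_const, card_univ, Fintype.card_fin, nsmul_eq_mul]
      field_simp
      ring
    have h4 : c'.secrecyGivenMsg K m = (1 - p) * c.secrecyGivenMsg K m := by
      rw [secrecyGivenMsg, secrecyGivenMsg, h3, tvDist, tvDist, mul_left_comm (1 - p),
        mul_sum univ _ (1 - p)]
      congr 1
      refine sum_congr rfl fun z _ => ?_
      have h5 : c'.eveGivenMsg K m z - outDist (c.eveGivenMsg K) (fun _ => 1 / (M : ℝ)) z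
          = (1 - p) * (c.eveGivenMsg K m z
            - outDist (c.eveGivenMsg K) (fun _ => 1 / (M : ℝ)) z) := by
        rw [heve, h₁]; ring
      rw [h5, abs_mul, abs_of_nonneg (by linarith)]
    rw [h4]
    exact mul_le_mul_of_nonneg_left (hsec m) (by linarith)

/-! ### The one-shot converse for deterministic legitimate outputs -/

section Converse
variable {F : A → B} (hF : ∀ a b z, b ≠ F a → K a (b, z) = 0)

omit [Fintype A] hK in
include hF in
lemma sum_deterministic (a : A) (z : C) : ∑ b, K a (b, z) = K a (F a, z) :=
  sum_eq_single (F a) (fun b _ hb => hF a b z hb) (by simp)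

omit [Fintype A] in
include hF in
lemma deterministic_mem (a : A) : (fun z => K a (F a, z)) ∈ stdSimplex ℝ C :=
  ⟨fun z => (hK a).1 _, by
    rw [← (hK a).2, Fintype.sum_prod_type_right]
    exact sum_congr rfl fun z _ => (sum_deterministic hF a z).symm⟩

omit hK in
include hF in
lemma eveGivenMsg_deterministic (c : SecrecyCode A B M) (m : Fin M) (z : C) :
    c.eveGivenMsg K m z = ∑ a, c.enc m a * K a (F a, z) := by
  simp only [eveGivenMsg, marginalSnd, outDist]
  rw [sum_comm]
  simp only [← mul_sum, sum_deterministic hF]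

include hF in
lemma errorGivenMsg_deterministic (c : SecrecyCode A B M) (m : Fin M) :
    c.errorGivenMsg K m = ∑ a, if c.dec (F a) ≠ m then c.enc m a else 0 := by
  have h1 : ∀ b, (if c.dec b ≠ m then c.legitGivenMsg K m b else 0)
      = ∑ a, c.enc m a * ∑ z, if c.dec b ≠ m then K a (b, z) else 0 := fun b => by
    split_ifs with h
    · simp only [legitGivenMsg, marginalFst, outDist]
      rw [sum_comm]; simp only [mul_sum]
    · simp
  simp only [errorGivenMsg, h1]
  rw [sum_comm]
  refine sum_congr rfl fun a _ => ?_
  rw [← mul_sum, sum_eq_single (F a)]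
  · split_ifs
    · rw [(deterministic_mem hK hF a).2, mul_one]
    · simp
  · intro b _ hb
    refine sum_eq_zero fun z _ => ?_
    rw [hF a b z hb]; simp
  · simp

open Classical in
include hF in
/-- One-shot converse for channels with a deterministic legitimate output. -/
theorem one_shot_converse (c : SecrecyCode A B M) {ε δ p lam : ℝ} (hlam : 0 < lam) (hp : 0 ≤ p)
    (hc : IsSecrecyCode .avg K ε δ c) {Q : C → B → ℝ} (hQ0 : ∀ z b, 0 ≤ Q z b)
    (hQ1 : ∀ z, ∑ b, Q z b ≤ 1)
    (hQ : ∀ a, p ≤ ∑ z, if lam ≤ Q z (F a) then K a (F a, z) else 0) :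
    p * (1 - ε) ≤ δ + 1 / (M * lam) := by
  have hM : (0 : ℝ) < M := by exact_mod_cast c.size_pos
  -- The test: the estimate `Q z` gives the decoding region of `m` mass at least `lam`. Since `Q z`
  -- has total mass at most one, each `z` admits at most `1 / lam` such messages.
  set E : Fin M → C → Prop := fun m z => lam ≤ ∑ b, if c.dec b = m then Q z b else 0 with hE
  have heve := c.eveGivenMsg_mem hK
  have hPZ := outDist_mem heve c.msg_mem
  have htv := sum_ite_sub_le_tvDist
    (P := fun mz : Fin M × C => c.msg mz.1 * c.eveGivenMsg K mz.1 mz.2)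
    (Q := fun mz : Fin M × C => 1 / (M : ℝ) * outDist (c.eveGivenMsg K) c.msg mz.2)
    (by
      simp only [Fintype.sum_prod_type, ← mul_sum, (heve _).2, mul_one, c.msg_mem.2, hPZ.2]
      simp [hM.ne']) (fun mz => E mz.1 mz.2)
  have h1 := htv.trans hc.2
  have hsplit : (∑ mz : Fin M × C, if E mz.1 mz.2 then c.msg mz.1 * c.eveGivenMsg K mz.1 mz.2
        - 1 / (M : ℝ) * outDist (c.eveGivenMsg K) c.msg mz.2 else 0)
      = (∑ m, c.msg m * ∑ z, if E m z then c.eveGivenMsg K m z else 0)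
        - ∑ z, outDist (c.eveGivenMsg K) c.msg z * (1 / (M : ℝ) * ∑ m, if E m z then 1 else 0) := by
    have : ∀ mz : Fin M × C, (if E mz.1 mz.2 then c.msg mz.1 * c.eveGivenMsg K mz.1 mz.2
        - 1 / (M : ℝ) * outDist (c.eveGivenMsg K) c.msg mz.2 else 0)
        = (c.msg mz.1 * if E mz.1 mz.2 then c.eveGivenMsg K mz.1 mz.2 else 0)
        - (outDist (c.eveGivenMsg K) c.msg mz.2 * (1 / (M : ℝ) * if E mz.1 mz.2 then 1 else 0)) :=
      fun mz => by split_ifs <;> ring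
    simp only [this, sum_sub_distrib]
    rw [Fintype.sum_prod_type, Fintype.sum_prod_type_right]
    simp only [mul_sum]
  have hunif : ∑ z, outDist (c.eveGivenMsg K) c.msg z * (1 / (M : ℝ) * ∑ m, if E m z then 1 else 0)
      ≤ 1 / (M * lam) := by
    calc _ ≤ ∑ z, outDist (c.eveGivenMsg K) c.msg z * (1 / (M : ℝ) * (1 / lam)) := by
          refine sum_le_sum fun z _ => mul_le_mul_of_nonneg_left ?_ (hPZ.1 z)
          refine mul_le_mul_of_nonneg_left ?_ (by positivity)
          rw [le_div_iff₀ hlam, sum_mul]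
          calc ∑ m, (if E m z then 1 else 0) * lam
              ≤ ∑ m, ∑ b, if c.dec b = m then Q z b else 0 := by
                refine sum_le_sum fun m _ => ?_
                split_ifs with h
                · rw [one_mul]; exact h
                · rw [zero_mul]; exact sum_nonneg fun b _ => by split_ifs <;> simp [hQ0]
            _ = ∑ b, Q z b := by rw [sum_comm]; simp
            _ ≤ 1 := hQ1 z
      _ = _ := by rw [← sum_mul, hPZ.2]; field_simp
  -- Correct decoding of `F a` places `F a` in the region of `m`, so `lam ≤ Q z (F a)` forces the
  -- test to pass. As `p` is a lower bound for every input `a`, it multiplies the probability of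
  -- correct decoding.
  have hjoint : p * (1 - ε) ≤ ∑ m, c.msg m * ∑ z, if E m z then c.eveGivenMsg K m z else 0 := by
    have herr : 1 - ε ≤ ∑ m, c.msg m * (1 - c.errorGivenMsg K m) := by
      have := hc.1
      simp only [avgError] at this
      simp only [mul_sub, mul_one, sum_sub_distrib, c.msg_mem.2]
      linarith
    refine (mul_le_mul_of_nonneg_left herr hp).trans ?_
    rw [mul_sum]
    refine sum_le_sum fun m _ => ?_
    rw [mul_left_comm]
    refine mul_le_mul_of_nonneg_left ?_ (c.msg_mem.1 m)
    have h2 : (1 : ℝ) - c.errorGivenMsg K m = ∑ a, if c.dec (F a) = m then c.enc m a else 0 := by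
      rw [errorGivenMsg_deterministic hK hF, ← (c.enc_mem m).2, ← sum_sub_distrib]
      exact sum_congr rfl fun a _ => by split_ifs <;> simp_all
    have h3 : (∑ z, if E m z then c.eveGivenMsg K m z else 0)
        = ∑ a, c.enc m a * ∑ z, if E m z then K a (F a, z) else 0 := by
      simp only [mul_sum]
      rw [sum_comm]
      refine sum_congr rfl fun z _ => ?_
      split_ifs
      · exact eveGivenMsg_deterministic hF c m z
      · simp
    rw [h2, h3, mul_sum]
    refine sum_le_sum fun a _ => ?_
    split_ifs with h
    · rw [mul_comm]
      refine mul_le_mul_of_nonneg_left ((hQ a).trans (sum_le_sum fun z _ => ?_)) ((c.enc_mem m).1 a)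
      split_ifs with h4 h5 h5
      · exact le_rfl
      · refine absurd (h4.trans ?_) h5
        have := single_le_sum (f := fun b => if c.dec b = m then Q z b else 0)
          (fun b _ => by split_ifs <;> simp [hQ0]) (mem_univ (F a))
        simpa [h] using this
      · exact (hK a).1 _
      · exact le_rfl
    · rw [mul_zero]
      refine mul_nonneg ((c.enc_mem m).1 a) (sum_nonneg fun z _ => ?_)
      split_ifs
      · exact (hK a).1 _
      · exact le_rfl
  rw [hsplit] at h1
  linarith

-- The converse applied to the uniform estimate with threshold `1 / |B|`, for which the test
-- condition holds surely and `p = 1`. It makes the set of code sizes bounded, so that the supremum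
-- is attained.
include hF in
lemma size_mul_le_card (c : SecrecyCode A B M) {ε δ : ℝ} (hc : IsSecrecyCode .avg K ε δ c) :
    (M : ℝ) * (1 - ε - δ) ≤ Fintype.card B := by
  have hM : (0 : ℝ) < M := by exact_mod_cast c.size_pos
  have hB : (0 : ℝ) < Fintype.card B := by
    have : Nonempty B := by
      by_contra h
      rw [not_nonempty_iff] at h
      have := (c.legitGivenMsg_mem hK ⟨0, c.size_pos⟩).2
      simp at this
    exact_mod_cast Fintype.card_pos
  have := one_shot_converse hK hF c (p := 1) (lam := 1 / (Fintype.card B : ℝ)) (by positivity)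
    zero_le_one hc (Q := fun _ _ => 1 / (Fintype.card B : ℝ)) (fun _ _ => by positivity)
    (fun _ => by simp [hB.ne']) (fun a => by simp [(deterministic_mem hK hF a).2])
  have h2 : 1 / (M * (1 / (Fintype.card B : ℝ))) = Fintype.card B / M := by field_simp
  rw [h2] at this
  have h3 : 1 - ε - δ ≤ Fintype.card B / M := by linarith
  rw [le_div_iff₀ hM] at h3
  linarith

end Converse
end SecrecyCode

/-! ### Balanced partitions and one-shot achievability -/

/-- A family of vectors can be partitioned into `M` bins with nearly equal sums. -/
lemma exists_balanced_partition {T D : Type*} [Fintype T] [Fintype D] {M : ℕ} (hM : 0 < M)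
    (v : T → D → ℝ) : ∃ h : T → Fin M,
      ∑ m, ∑ d, (∑ y, ((if h y = m then 1 else 0) - 1 / (M : ℝ)) * v y d) ^ 2
        ≤ ∑ y, ∑ d, v y d ^ 2 := by
  classical
  have hMR : (0 : ℝ) < M := by exact_mod_cast hM
  have : Nonempty (Fin M) := ⟨⟨0, hM⟩⟩
  suffices ∀ s : Finset T, ∃ h : T → Fin M,
      ∑ m, ∑ d, (∑ y ∈ s, ((if h y = m then 1 else 0) - 1 / (M : ℝ)) * v y d) ^ 2
        ≤ ∑ y ∈ s, ∑ d, v y d ^ 2 from this univ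
  intro s
  induction s using Finset.induction_on with
  | empty => exact ⟨fun _ => ⟨0, hM⟩, by simp⟩
  | insert y₀ s hy ih =>
    obtain ⟨h, hh⟩ := ih
    set S : Fin M → D → ℝ :=
      fun m d => ∑ y ∈ s, ((if h y = m then 1 else 0) - 1 / (M : ℝ)) * v y d with hS
    -- Centred indicator of the bin chosen for the new vector. Averaged over a uniform bin it
    -- vanishes, which kills the cross terms with the sums already formed; some bin does no worse
    -- than the average.
    set e : Fin M → Fin M → ℝ := fun j m => (if j = m then 1 else 0) - 1 / (M : ℝ) with he
    have he1 : ∀ m, ∑ j, e j m = 0 := fun m => by simp [he, hMR.ne']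
    have he2 : ∀ m, ∑ j, e j m ^ 2 ≤ 1 := fun m => by
      have : ∀ j, e j m ^ 2 = (1 - 2 / M) * (if j = m then 1 else 0) + 1 / (M : ℝ) ^ 2 := fun j => by
        simp only [he]; split_ifs <;> ring
      simp only [this, sum_add_distrib, ← mul_sum]
      simp
      have h3 : (M : ℝ) * ((M : ℝ) ^ 2)⁻¹ = 1 / M := by field_simp
      have h4 : 2 / (M : ℝ) = 2 * (1 / M) := by ring
      have h5 : 0 < 1 / (M : ℝ) := by positivity
      rw [h3, h4]; linarith
    have hsum : ∑ j, ∑ m, ∑ d, (S m d + e j m * v y₀ d) ^ 2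
        ≤ ∑ _j : Fin M, ∑ y ∈ insert y₀ s, ∑ d, v y d ^ 2 := by
      calc ∑ j, ∑ m, ∑ d, (S m d + e j m * v y₀ d) ^ 2
          = ∑ m, ∑ d, ∑ j, (S m d + e j m * v y₀ d) ^ 2 := by
            rw [sum_comm]; exact sum_congr rfl fun m _ => sum_comm
        _ = ∑ m, ∑ d, (M * S m d ^ 2 + (∑ j, e j m ^ 2) * v y₀ d ^ 2) := by
            refine sum_congr rfl fun m _ => sum_congr rfl fun d _ => ?_
            have : ∀ j, (S m d + e j m * v y₀ d) ^ 2
                = S m d ^ 2 + 2 * S m d * v y₀ d * e j m + e j m ^ 2 * v y₀ d ^ 2 :=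
              fun j => by ring
            simp only [this, sum_add_distrib, ← mul_sum, ← sum_mul, he1]
            simp
        _ ≤ ∑ m : Fin M, ∑ d, (M * S m d ^ 2 + 1 * v y₀ d ^ 2) := by gcongr; exact he2 _
        _ = M * (∑ m, ∑ d, S m d ^ 2) + M * ∑ d, v y₀ d ^ 2 := by
            simp only [sum_add_distrib, ← mul_sum, one_mul]
            simp
        _ ≤ M * (∑ y ∈ s, ∑ d, v y d ^ 2) + M * ∑ d, v y₀ d ^ 2 := by gcongr
        _ = _ := by rw [sum_insert hy]; simp; ring
    obtain ⟨j, -, hj⟩ := exists_le_of_sum_le univ_nonempty hsum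
    refine ⟨Function.update h y₀ j, le_trans (le_of_eq ?_) hj⟩
    refine sum_congr rfl fun m _ => sum_congr rfl fun d _ => ?_
    rw [sum_insert hy, Function.update_self, add_comm]
    congr 2
    refine sum_congr rfl fun y hy' => ?_
    rw [Function.update_of_ne (fun (h' : y = y₀) => hy (h' ▸ hy'))]

set_option maxHeartbeats 800000 in
open Classical in
/-- **Binning**: `N` output distributions, each of which exceeds `γ` times a reference
distribution with probability at most `η`, can be partitioned into `M` bins such that at least half
of the bin averages are nearly indistinguishable up to `η`. -/
theorem exists_secret_bins {T C : Type*} [Fintype T] [Nonempty T] [Fintype C] {V : T → C → ℝ}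
    (hV : ∀ y, V y ∈ stdSimplex ℝ C) {R : C → ℝ} (hR : R ∈ stdSimplex ℝ C) {γ η ρ : ℝ}
    (hγ : 1 ≤ γ) (hη : ∀ y, (∑ z, if V y z ≤ γ * R z then 0 else V y z) ≤ η) {M : ℕ} (hM : 0 < M)
    (hρ0 : 0 < ρ) (hρ1 : ρ ≤ 1 / 4) (hρ : M * γ ≤ ρ ^ 2 * Fintype.card T) :
    ∃ (h : T → Fin M) (G : Finset (Fin M)), M ≤ 2 * G.card ∧
      (∀ m ∈ G, (univ.filter fun y => h y = m).Nonempty) ∧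
      ∀ m ∈ G, tvDist (fun z => (∑ y, if h y = m then V y z else 0)
            / ((univ.filter fun y => h y = m).card : ℝ))
          (fun z => 1 / (G.card : ℝ) * ∑ m' ∈ G, (∑ y, if h y = m' then V y z else 0)
            / ((univ.filter fun y => h y = m').card : ℝ)) ≤ η + 8 * ρ := by
  have hMR : (0 : ℝ) < M := by exact_mod_cast hM
  set N : ℝ := (Fintype.card T : ℝ) with hN
  have hN0 : 0 < N := by rw [hN]; exact_mod_cast Fintype.card_pos
  set L : ℝ := N / M with hL
  have hL0 : 0 < L := by positivity
  have hγ0 : 0 < γ := by linarith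
  have hρL : γ ≤ ρ ^ 2 * L := by
    rw [hL, mul_div_assoc', le_div_iff₀ hMR]; linarith
  set vt : T → C → ℝ := fun y z => if V y z ≤ γ * R z then V y z else 0 with hvt
  have hvt0 : ∀ y z, 0 ≤ vt y z := fun y z => by
    simp only [hvt]; split_ifs
    · exact (hV y).1 z
    · exact le_rfl
  have hvtR : ∀ y z, vt y z ≤ γ * R z := fun y z => by
    simp only [hvt]; split_ifs with h
    · exact h
    · exact mul_nonneg hγ0.le (hR.1 z)
  have hvt1 : ∀ y, ∑ z, vt y z ≤ 1 := fun y => by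
    rw [← (hV y).2]
    refine sum_le_sum fun z _ => ?_
    simp only [hvt]; split_ifs
    · exact le_rfl
    · exact (hV y).1 z
  -- The coordinate `none` counts bin sizes; the others carry the truncated laws weighted by `1 /
  -- √(γ R)`. The truncation `vt ≤ γ R` bounds each squared norm by `1 + 1`.
  obtain ⟨h, hh⟩ := exists_balanced_partition hM
    (fun (y : T) (d : Option C) => d.elim (1 : ℝ) fun z => vt y z / Real.sqrt (γ * R z))
  set b : Fin M → ℝ := fun m => ((univ.filter fun y => h y = m).card : ℝ) with hb
  set a : Fin M → C → ℝ := fun m z => ∑ y, if h y = m then vt y z else 0 with ha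
  set ab : C → ℝ := fun z => 1 / (M : ℝ) * ∑ y, vt y z with hab
  set Φ : Fin M → ℝ := fun m => (b m - L) ^ 2 + ∑ z, ((a m z - ab z) / Real.sqrt (γ * R z)) ^ 2
    with hΦ
  have hΦsum : ∑ m, Φ m ≤ 2 * N := by
    refine le_trans (le_of_eq (sum_congr rfl fun m _ => ?_)) (hh.trans ?_)
    · rw [Fintype.sum_option, hΦ]
      simp only [Option.elim]
      congr 1
      · simp only [mul_one, sum_sub_distrib, hb, hL, hN]
        simp; ring
      · refine sum_congr rfl fun z _ => ?_
        simp only [mul_div_assoc', ← sum_div, sub_mul, sum_sub_distrib, ite_mul, one_mul, zero_mul,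
          ← mul_sum, ha, hab]
    · simp only [Fintype.sum_option, Option.elim]
      calc _ ≤ ∑ _y : T, (2 : ℝ) := by
            refine sum_le_sum fun y _ => ?_
            have : ∑ z, (vt y z / Real.sqrt (γ * R z)) ^ 2 ≤ ∑ z, vt y z := by
              refine sum_le_sum fun z _ => ?_
              have hs := mul_nonneg hγ0.le (hR.1 z)
              rw [div_pow, Real.sq_sqrt hs]
              refine div_le_of_le_mul₀ hs (hvt0 y z) ?_
              rw [sq]; exact mul_le_mul_of_nonneg_left (hvtR y z) (hvt0 y z)
            linarith [hvt1 y]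
        _ = 2 * N := by simp [hN]; ring
  -- The average of `Φ` is at most `2 * L`, so by Markov's inequality at least half of the bins stay
  -- below twice that value.
  set G := univ.filter fun m => Φ m ≤ 4 * L with hG
  have hΦ0 : ∀ m, 0 ≤ Φ m := fun m => add_nonneg (sq_nonneg _) (sum_nonneg fun z _ => sq_nonneg _)
  have hGcard : M ≤ 2 * G.card := by
    have h1 : (univ.filter fun m => ¬ Φ m ≤ 4 * L).card * (4 * L) ≤ 2 * N := by
      refine le_trans ?_ hΦsum
      rw [← nsmul_eq_mul, ← sum_const]
      refine (sum_le_sum fun m hm => ?_).trans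
        (sum_le_sum_of_subset_of_nonneg (filter_subset _ _) fun m _ _ => hΦ0 m)
      exact (not_le.1 (mem_filter.1 hm).2).le
    have h2 : G.card + (univ.filter fun m => ¬ Φ m ≤ 4 * L).card = M := by
      rw [hG, card_filter_add_card_filter_not]; simp
    have h3 : ((univ.filter fun m => ¬ Φ m ≤ 4 * L).card : ℝ) * 2 ≤ M := by
      have : N = L * M := by rw [hL]; field_simp
      rw [this] at h1
      have h4 : ((univ.filter fun m => ¬ Φ m ≤ 4 * L).card : ℝ) * 2 * (2 * L) ≤ M * (2 * L) := by
        linarith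
      exact le_of_mul_le_mul_right h4 (by positivity)
    have h5 : (univ.filter fun m => ¬ Φ m ≤ 4 * L).card * 2 ≤ M := by exact_mod_cast h3
    omega
  have hgood : ∀ m ∈ G, 0 < b m ∧ ∑ z, |a m z / b m - ab z / L| ≤ 4 * ρ := by
    intro m hm
    have hm' : Φ m ≤ 4 * L := (mem_filter.1 hm).2
    have hz0 : 0 ≤ ∑ z, ((a m z - ab z) / Real.sqrt (γ * R z)) ^ 2 :=
      sum_nonneg fun z _ => sq_nonneg _
    have hb1 : |b m - L| ≤ 2 * ρ * L := by
      refine abs_le_of_sq_le_sq ?_ (by positivity)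
      have : (b m - L) ^ 2 ≤ 4 * L := by simp only [hΦ] at hm'; linarith
      nlinarith
    have hb2 : 0 < b m := by
      have := (abs_le.1 hb1).1
      nlinarith
    have ha1 : ∑ z, |a m z - ab z| ≤ 2 * ρ * L := by
      refine (le_abs_self _).trans (abs_le_of_sq_le_sq ?_ (by positivity))
      -- Cauchy–Schwarz converts the weighted quadratic deviation to an `ℓ¹` deviation: the weights
      -- `γ R` sum to `γ ≤ ρ ^ 2 * L`. Where a weight vanishes, all truncated laws vanish too.
      have hCS := sum_sq_le_sum_mul_sum_of_sq_le_mul univ (r := fun z => |a m z - ab z|)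
        (f := fun z => ((a m z - ab z) / Real.sqrt (γ * R z)) ^ 2) (g := fun z => γ * R z)
        (fun z _ => sq_nonneg _) (fun z _ => mul_nonneg hγ0.le (hR.1 z)) (fun z _ => by
          have hs := mul_nonneg hγ0.le (hR.1 z)
          rw [sq_abs, div_pow, Real.sq_sqrt hs]
          rcases hs.eq_or_lt with h0 | h0
          · have hz : ∀ y, vt y z = 0 := fun y => le_antisymm (h0 ▸ hvtR y z) (hvt0 y z)
            simp [ha, hab, hz]
          · rw [div_mul_cancel₀ _ h0.ne'])
      rw [← mul_sum, hR.2, mul_one] at hCS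
      have : ∑ z, ((a m z - ab z) / Real.sqrt (γ * R z)) ^ 2 ≤ 4 * L := by
        simp only [hΦ] at hm'; linarith [sq_nonneg (b m - L)]
      calc _ ≤ _ := hCS
        _ ≤ 4 * L * (ρ ^ 2 * L) := by gcongr
        _ = _ := by ring
    have ha0 : ∀ z, 0 ≤ a m z := fun z => sum_nonneg fun y _ => by
      split_ifs
      · exact hvt0 y z
      · exact le_rfl
    have ha2 : ∑ z, a m z ≤ b m := by
      simp only [ha]
      rw [sum_comm]
      calc _ ≤ ∑ y, if h y = m then (1 : ℝ) else 0 := sum_le_sum fun y _ => by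
            split_ifs
            · exact hvt1 y
            · simp
        _ = b m := by simp [hb]
    refine ⟨hb2, ?_⟩
    calc ∑ z, |a m z / b m - ab z / L|
        ≤ ∑ z, (|a m z - ab z| / L + a m z * (|b m - L| / (b m * L))) := by
          refine sum_le_sum fun z _ => ?_
          have : a m z / b m - ab z / L = (a m z - ab z) / L + a m z * ((L - b m) / (b m * L)) := by
            field_simp; ring
          rw [this]
          refine (abs_add_le _ _).trans (le_of_eq ?_)
          rw [abs_div (a m z - ab z) L, abs_mul, abs_div (L - b m), abs_of_pos hL0, abs_of_nonneg (ha0 z),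
            abs_of_pos (mul_pos hb2 hL0), abs_sub_comm L]
      _ = (∑ z, |a m z - ab z|) / L + (∑ z, a m z) * (|b m - L| / (b m * L)) := by
          rw [sum_add_distrib, sum_div, sum_mul]
      _ ≤ 2 * ρ * L / L + b m * (2 * ρ * L / (b m * L)) := by gcongr
      _ = 4 * ρ := by field_simp; ring
  refine ⟨h, G, hGcard, fun m hm => ?_, fun m hm => ?_⟩
  · have := (hgood m hm).1
    simp only [hb] at this
    exact card_pos.1 (by exact_mod_cast this)
  have hG0 : 0 < G.card := by omega
  have hGR : (0 : ℝ) < G.card := by exact_mod_cast hG0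
  set U : Fin M → C → ℝ := fun m z => (∑ y, if h y = m then V y z else 0) / b m with hU
  set U' : Fin M → C → ℝ := fun m z =>
    (∑ y, if h y = m then (if V y z ≤ γ * R z then 0 else V y z) else 0) / b m with hU'
  have hUs : ∀ m z, U m z = a m z / b m + U' m z := fun m z => by
    simp only [hU, hU', ha, ← add_div, ← sum_add_distrib]
    congr 1
    refine sum_congr rfl fun y _ => ?_
    simp only [hvt]; split_ifs <;> simp
  have hU'0 : ∀ m z, 0 ≤ U' m z := fun m z => by
    refine div_nonneg (sum_nonneg fun y _ => ?_) (by simp [hb])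
    split_ifs
    · exact le_rfl
    · exact (hV y).1 z
    · exact le_rfl
  have hU'1 : ∀ m ∈ G, ∑ z, U' m z ≤ η := fun m hm => by
    simp only [hU', ← sum_div]
    rw [div_le_iff₀ (hgood m hm).1, sum_comm]
    calc _ ≤ ∑ y, if h y = m then η else 0 := sum_le_sum fun y _ => by
          split_ifs
          · exact hη y
          · simp
      _ = η * b m := by rw [← sum_filter, sum_const, nsmul_eq_mul, mul_comm]
  have hU1 : ∀ m ∈ G, ∑ z, U m z = 1 := fun m hm => by
    simp only [hU, ← sum_div]
    rw [div_eq_one_iff_eq (hgood m hm).1.ne', sum_comm]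
    calc _ = ∑ y, if h y = m then (1 : ℝ) else 0 := sum_congr rfl fun y _ => by
          split_ifs
          · exact (hV y).2
          · simp
      _ = b m := by simp [hb]
  have havg : ∀ {g : Fin M → ℝ} {x : ℝ}, (∀ m ∈ G, g m ≤ x) →
      1 / (G.card : ℝ) * ∑ m' ∈ G, g m' ≤ x := fun {g x} hg => by
    rw [one_div, inv_mul_le_iff₀ hGR, ← nsmul_eq_mul, ← sum_const]
    exact sum_le_sum hg
  have hD : ∀ m' ∈ G, ∑ z, |a m' z / b m' - a m z / b m| ≤ 8 * ρ := fun m' hm' => by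
    calc _ ≤ ∑ z, (|a m' z / b m' - ab z / L| + |a m z / b m - ab z / L|) :=
          sum_le_sum fun z _ => by
            rw [abs_sub_comm (a m z / b m)]; exact abs_sub_le _ _ _
      _ ≤ 4 * ρ + 4 * ρ := by
          rw [sum_add_distrib]; exact add_le_add (hgood m' hm').2 (hgood m hm).2
      _ = _ := by ring
  -- Only the excess of the averaged law over `U m` has to be bounded, so the discarded mass of bin
  -- `m` itself can be dropped and `η` appears once. The truncated parts of two good bins differ by
  -- at most `8 * ρ`.
  calc tvDist (U m) (fun z => 1 / (G.card : ℝ) * ∑ m' ∈ G, U m' z)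
      ≤ ∑ z, (1 / (G.card : ℝ) * ∑ m' ∈ G, (U' m' z + |a m' z / b m' - a m z / b m|)) := by
        refine tvDist_le_of_le ?_ (fun z => mul_nonneg (by positivity) (sum_nonneg fun m' _ =>
          add_nonneg (hU'0 m' z) (abs_nonneg _))) fun z => ?_
        · rw [hU1 m hm, ← mul_sum, sum_comm, sum_congr rfl hU1, sum_const, nsmul_eq_mul, mul_one,
            one_div_mul_cancel hGR.ne']
        · have : U m z = 1 / (G.card : ℝ) * ∑ _m' ∈ G, U m z := by
            rw [sum_const, nsmul_eq_mul, ← mul_assoc, one_div_mul_cancel hGR.ne', one_mul]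
          rw [this, ← mul_sub, ← sum_sub_distrib]
          refine mul_le_mul_of_nonneg_left (sum_le_sum fun m' _ => ?_) (by positivity)
          rw [hUs m' z, hUs m z]
          linarith [le_abs_self (a m' z / b m' - a m z / b m), hU'0 m z]
    _ = 1 / (G.card : ℝ) * ∑ m' ∈ G, (∑ z, U' m' z + ∑ z, |a m' z / b m' - a m z / b m|) := by
        rw [← mul_sum, sum_comm]; simp only [sum_add_distrib]
    _ ≤ η + 8 * ρ := havg fun m' hm' => add_le_add (hU'1 m' hm') (hD m' hm')

open Classical in
/-- One-shot achievability without decoding errors. -/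
theorem one_shot_achievability {A B C T : Type*} [Fintype A] [Fintype B] [Fintype C] [Fintype T]
    [Nonempty T] {K : A → B × C → ℝ} {S : T → A → ℝ} (hS : ∀ y, S y ∈ stdSimplex ℝ A)
    {i : T → B} (hi : Function.Injective i)
    (hSi : ∀ y b, b ≠ i y → marginalFst (outDist K (S y)) b = 0)
    (hV : ∀ y, marginalSnd (outDist K (S y)) ∈ stdSimplex ℝ C)
    {R : C → ℝ} (hR : R ∈ stdSimplex ℝ C) {γ η ρ : ℝ} (hγ : 1 ≤ γ)
    (hη : ∀ y, (∑ z, if marginalSnd (outDist K (S y)) z ≤ γ * R z then 0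
      else marginalSnd (outDist K (S y)) z) ≤ η) {M : ℕ} (hM : 0 < M)
    (hρ0 : 0 < ρ) (hρ1 : ρ ≤ 1 / 4) (hρ : M * γ ≤ ρ ^ 2 * Fintype.card T) :
    ∃ (M' : ℕ) (c : SecrecyCode A B M'), M ≤ 2 * M' ∧ (∀ m, c.errorGivenMsg K m = 0) ∧
      ∀ m, c.secrecyGivenMsg K m ≤ η + 8 * ρ := by
  obtain ⟨h, G, hcard, hne, hsec⟩ := exists_secret_bins hV hR hγ hη hM hρ0 hρ1 hρ
  set b : Fin M → ℝ := fun m => ((univ.filter fun y => h y = m).card : ℝ) with hb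
  have hG0 : 0 < G.card := by omega
  let e : G ≃ Fin G.card := G.equivFin
  have hb0 : ∀ m ∈ G, 0 < b m := fun m hm => by
    simp only [hb]; exact_mod_cast card_pos.2 (hne m hm)
  -- A message selects a uniform element of its bin; only the good bins serve as messages.
  let w : Fin G.card → T → ℝ := fun m y => if h y = (e.symm m : Fin M) then 1 / b (e.symm m) else 0
  have hw : ∀ m, w m ∈ stdSimplex ℝ T := fun m => by
    have hpos := hb0 _ (e.symm m).2
    refine ⟨fun y => ?_, ?_⟩
    · simp only [w]; split_ifs
      · positivity
      · exact le_rfl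
    · simp only [w]
      rw [← sum_filter, sum_const, nsmul_eq_mul, mul_one_div]
      exact div_self hpos.ne'
  -- The decoder value `0` on outputs belonging to no good bin is arbitrary: such outputs have
  -- probability zero.
  let c : SecrecyCode A B G.card := ⟨fun _ => 1 / (G.card : ℝ), uniform_mem hG0,
    fun m => outDist S (w m), fun m => outDist_mem hS (hw m),
    fun x => if hx : ∃ y, i y = x ∧ h y ∈ G then e ⟨h hx.choose, hx.choose_spec.2⟩ else ⟨0, hG0⟩⟩
  have hdec : ∀ y (hy : h y ∈ G), c.dec (i y) = e ⟨h y, hy⟩ := fun y hy => by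
    have hx : ∃ y', i y' = i y ∧ h y' ∈ G := ⟨y, rfl, hy⟩
    have hyy : hx.choose = y := hi hx.choose_spec.1
    simp only [c, dif_pos hx, hyy]
  have heve : ∀ m z, c.eveGivenMsg K m z = (∑ y, if h y = (e.symm m : Fin M) then
      marginalSnd (outDist K (S y)) z else 0) / b (e.symm m) := fun m z => by
    simp only [SecrecyCode.eveGivenMsg, c]
    rw [outDist_outDist, marginalSnd_outDist, outDist, sum_div]
    refine sum_congr rfl fun y _ => ?_
    simp only [w]; split_ifs <;> ring
  refine ⟨G.card, c, hcard, fun m => ?_, fun m => ?_⟩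
  · refine sum_eq_zero fun x _ => ?_
    split_ifs with hx
    · simp only [SecrecyCode.legitGivenMsg]
      rw [show c.enc m = outDist S (w m) from rfl, outDist_outDist, marginalFst_outDist, outDist]
      refine sum_eq_zero fun y _ => ?_
      simp only [w]
      split_ifs with hy
      · rw [hSi y x, mul_zero]
        rintro rfl
        refine hx ?_
        have hyG : h y ∈ G := hy ▸ (e.symm m).2
        rw [hdec y hyG]
        have : (⟨h y, hyG⟩ : G) = e.symm m := Subtype.ext hy
        rw [this, Equiv.apply_symm_apply]
      · rw [zero_mul]
    · rfl
  · have := hsec (e.symm m) (e.symm m).2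
    refine le_trans (le_of_eq ?_) this
    unfold SecrecyCode.secrecyGivenMsg
    congr 1
    · funext z; exact heve m z
    · funext z
      simp only [outDist, ← mul_sum, heve]
      congr 1
      rw [← sum_coe_sort G]
      exact Fintype.sum_equiv e.symm _ _ fun m => rfl

/-! ### Single-letter analysis of semi-deterministic channels -/

section SingleLetter
variable {X Y Z : Type*} [Fintype X] [Fintype Y] [Fintype Z]

/-- The eavesdropper's channel `P_{Z|X}` of a channel with `Y = f(X)`. -/
def eveKernel (W : X → Y × Z → ℝ) (f : X → Y) (x : X) (z : Z) : ℝ := W x (f x, z)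

/-- The expected logarithmic loss of the estimate `Q` of `f(x)` from `Z`. -/
def logLoss (W : X → Y × Z → ℝ) (f : X → Y) (Q : Z → Y → ℝ) (x : X) : ℝ :=
  ∑ z, eveKernel W f x z * -Real.log (Q z (f x))

variable {W : X → Y × Z → ℝ} (hW : ∀ x, W x ∈ stdSimplex ℝ (Y × Z))
  {f : X → Y} (hWf : IsSemiDeterministic W f)
include hW hWf

lemma eq_zero_of_ne (x : X) (y : Y) (z : Z) (h : y ≠ f x) : W x (y, z) = 0 := by
  have := hWf x y
  rw [if_neg h] at this
  exact (sum_eq_zero_iff_of_nonneg fun c _ => (hW x).1 (y, c)).1 this z (mem_univ z)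

lemma eveKernel_mem (x : X) : eveKernel W f x ∈ stdSimplex ℝ Z :=
  SecrecyCode.deterministic_mem hW (eq_zero_of_ne hW hWf) x

lemma sum_joint (P : X → ℝ) (g : Y → Z → ℝ) :
    ∑ y, ∑ z, outDist W P (y, z) * g y z = ∑ x, P x * ∑ z, eveKernel W f x z * g (f x) z := by
  have h1 : ∀ x, ∑ y, ∑ z, W x (y, z) * g y z = ∑ z, eveKernel W f x z * g (f x) z := fun x => by
    rw [sum_eq_single (f x)]
    · rfl
    · intro y _ hy
      exact sum_eq_zero fun z _ => by rw [eq_zero_of_ne hW hWf x y z hy, zero_mul]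
    · simp
  simp only [outDist, sum_mul, ← h1, mul_sum]
  symm
  rw [sum_comm]
  refine sum_congr rfl fun y _ => ?_
  rw [sum_comm]
  exact sum_congr rfl fun z _ => sum_congr rfl fun x _ => by ring

omit hWf in
lemma joint_nonneg {P : X → ℝ} (hP : P ∈ stdSimplex ℝ X) (p : Y × Z) : 0 ≤ outDist W P p :=
  (outDist_mem hW hP).1 p

omit hWf in
lemma joint_le_marginalSnd {P : X → ℝ} (hP : P ∈ stdSimplex ℝ X) (y : Y) (z : Z) :
    outDist W P (y, z) ≤ marginalSnd (outDist W P) z :=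
  single_le_sum (f := fun y => outDist W P (y, z)) (fun _ _ => joint_nonneg hW hP _) (mem_univ y)

/-- **Gibbs' inequality** for conditional entropy. -/
lemma condEntropy_le_logLoss {P : X → ℝ} (hP : P ∈ stdSimplex ℝ X) {Q : Z → Y → ℝ}
    (hQ0 : ∀ z y, 0 ≤ Q z y) (hQ1 : ∀ z, ∑ y, Q z y ≤ 1)
    (hpos : ∀ y z, 0 < outDist W P (y, z) → 0 < Q z y) :
    condEntropyFstGivenSnd (outDist W P) ≤ ∑ x, P x * logLoss W f Q x ∧
    (∑ x, P x * logLoss W f Q x ≤ condEntropyFstGivenSnd (outDist W P) →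
      ∀ y z, outDist W P (y, z) = marginalSnd (outDist W P) z * Q z y) := by
  set J := outDist W P with hJ
  set JZ := marginalSnd J with hJZ
  have hJZ1 : ∑ z, JZ z = 1 := (marginalSnd_mem (outDist_mem hW hP)).2
  have hJZ0 : ∀ z, 0 ≤ JZ z := (marginalSnd_mem (outDist_mem hW hP)).1
  have hJ0 : ∀ p, 0 ≤ J p := joint_nonneg hW hP
  have hlog : ∀ y z, 0 < J (y, z) → 0 < JZ z * Q z y / J (y, z) ∧
      J (y, z) * Real.log (JZ z / J (y, z)) - J (y, z) * -Real.log (Q z y)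
        = J (y, z) * Real.log (JZ z * Q z y / J (y, z)) := fun y z h => by
    have h1 : 0 < JZ z := h.trans_le (joint_le_marginalSnd hW hP y z)
    have h2 := hpos y z h
    refine ⟨by positivity, ?_⟩
    rw [mul_div_right_comm, Real.log_mul (by positivity) h2.ne']
    ring
  have hterm : ∀ y z, J (y, z) * Real.log (JZ z / J (y, z)) - J (y, z) * -Real.log (Q z y)
      ≤ JZ z * Q z y - J (y, z) := fun y z => by
    rcases (hJ0 (y, z)).eq_or_lt with h | h
    · rw [← h]; simp only [zero_mul, sub_zero]; exact mul_nonneg (hJZ0 z) (hQ0 z y)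
    · obtain ⟨h1, h2⟩ := hlog y z h
      rw [h2]
      calc _ ≤ J (y, z) * (JZ z * Q z y / J (y, z) - 1) :=
            mul_le_mul_of_nonneg_left (Real.log_le_sub_one_of_pos h1) h.le
        _ = _ := by field_simp
  have hdiff : condEntropyFstGivenSnd J - ∑ x, P x * logLoss W f Q x
      = ∑ y, ∑ z, (J (y, z) * Real.log (JZ z / J (y, z)) - J (y, z) * -Real.log (Q z y)) := by
    simp only [sum_sub_distrib]
    rw [sum_joint hW hWf P fun y z => -Real.log (Q z y)]
    rfl
  have hR : ∑ y, ∑ z, (JZ z * Q z y - J (y, z)) ≤ 0 := by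
    have hJ1 : ∑ y, ∑ z, J (y, z) = 1 := by
      rw [← (outDist_mem hW hP).2, Fintype.sum_prod_type]
    simp only [sum_sub_distrib]
    rw [sum_comm, hJ1]
    have : ∑ z, ∑ y, JZ z * Q z y ≤ ∑ z, JZ z * 1 := sum_le_sum fun z _ => by
      rw [← mul_sum]; exact mul_le_mul_of_nonneg_left (hQ1 z) (hJZ0 z)
    simp only [mul_one, hJZ1] at this
    linarith
  have hL := sum_le_sum fun y (_ : y ∈ univ) => sum_le_sum fun z (_ : z ∈ univ) => hterm y z
  rw [← hdiff] at hL
  -- In the equality case every slack in `log u ≤ u - 1`, and in the normalisation of `Q`, is used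
  -- up; strictness of the logarithmic inequality away from `u = 1` identifies the joint law
  -- termwise.
  refine ⟨by linarith, fun hle y z => ?_⟩
  have hzero : ∑ y, ∑ z, ((JZ z * Q z y - J (y, z)) -
      (J (y, z) * Real.log (JZ z / J (y, z)) - J (y, z) * -Real.log (Q z y))) = 0 := by
    refine le_antisymm ?_ (sum_nonneg fun y _ => sum_nonneg fun z _ => sub_nonneg.2 (hterm y z))
    simp only [sum_sub_distrib] at hdiff hR ⊢
    linarith
  have h3 := (sum_eq_zero_iff_of_nonneg fun y _ => sum_nonneg fun z _ =>
    sub_nonneg.2 (hterm y z)).1 hzero y (mem_univ y)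
  have h4 := (sum_eq_zero_iff_of_nonneg fun z _ => sub_nonneg.2 (hterm y z)).1 h3 z (mem_univ z)
  rcases (hJ0 (y, z)).eq_or_lt with h | h
  · rw [← h] at h4 ⊢; simp only [zero_mul, sub_zero] at h4; exact h4.symm
  · obtain ⟨h1, h2⟩ := hlog y z h
    rw [h2] at h4
    by_contra hne
    have hne1 : JZ z * Q z y / J (y, z) ≠ 1 := fun h5 => hne (by
      rw [div_eq_one_iff_eq h.ne'] at h5; exact h5.symm)
    have h6 := mul_lt_mul_of_pos_left (Real.log_lt_sub_one_of_pos h1 hne1) h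
    have h7 : J (y, z) * (JZ z * Q z y / J (y, z) - 1) = JZ z * Q z y - J (y, z) := by field_simp
    linarith

lemma sum_logLoss_self {P : X → ℝ} :
    ∑ x, P x * logLoss W f (fun z y => outDist W P (y, z) / marginalSnd (outDist W P) z) x
      = condEntropyFstGivenSnd (outDist W P) := by
  have := sum_joint hW hWf P
    (fun y z => -Real.log (outDist W P (y, z) / marginalSnd (outDist W P) z))
  refine this.symm.trans (sum_congr rfl fun y _ => sum_congr rfl fun z _ => ?_)
  rw [← Real.log_inv, inv_div]

omit hWf in
lemma cond_nonneg {P : X → ℝ} (hP : P ∈ stdSimplex ℝ X) (z : Z) (y : Y) :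
    0 ≤ outDist W P (y, z) / marginalSnd (outDist W P) z :=
  div_nonneg (joint_nonneg hW hP _) ((marginalSnd_mem (outDist_mem hW hP)).1 z)

omit hWf hW in
lemma sum_cond_le (P : X → ℝ) (z : Z) :
    ∑ y, outDist W P (y, z) / marginalSnd (outDist W P) z ≤ 1 := by
  rw [← sum_div]; exact div_self_le_one _

lemma logLoss_nonneg {Q : Z → Y → ℝ} (hQ0 : ∀ z y, 0 ≤ Q z y) (hQ1 : ∀ z, ∑ y, Q z y ≤ 1) (x : X) :
    0 ≤ logLoss W f Q x :=
  sum_nonneg fun z _ => mul_nonneg ((eveKernel_mem hW hWf x).1 z) <| neg_nonneg.2 <|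
    Real.log_nonpos (hQ0 _ _) ((single_le_sum (f := Q z) (fun y _ => hQ0 z y)
      (mem_univ (f x))).trans (hQ1 z))

lemma condEntropy_le_capacity {P : X → ℝ} (hP : P ∈ stdSimplex ℝ X) :
    condEntropyFstGivenSnd (outDist W P) ≤ secrecyCapacity W := by
  have hbdd : BddAbove (Set.range fun P : stdSimplex ℝ X =>
      condEntropyFstGivenSnd (outDist W (P : X → ℝ))) := by
    refine ⟨Real.log (Fintype.card Y), ?_⟩
    rintro _ ⟨P, rfl⟩
    have : Nonempty X := by
      by_contra h
      rw [not_nonempty_iff] at h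
      have := P.2.2
      simp at this
    have : Nonempty Y := this.map f
    have hY : (0 : ℝ) < Fintype.card Y := by exact_mod_cast Fintype.card_pos
    refine (condEntropy_le_logLoss hW hWf P.2 (Q := fun _ _ => 1 / (Fintype.card Y : ℝ))
      (fun _ _ => by positivity) (fun _ => by simp [hY.ne']) (fun _ _ _ => by positivity)).1.trans
      (le_of_eq ?_)
    simp only [logLoss, ← sum_mul, (eveKernel_mem hW hWf _).2, P.2.2]
    simp
  exact le_ciSup hbdd ⟨P, hP⟩

omit hWf in
lemma continuousOn_condEntropy :
    ContinuousOn (fun P : X → ℝ => condEntropyFstGivenSnd (outDist W P)) (stdSimplex ℝ X) := by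
  have hc : Continuous fun P : X → ℝ => (∑ y, ∑ z, Real.negMulLog (outDist W P (y, z)))
      - ∑ z, Real.negMulLog (∑ y, outDist W P (y, z)) := by
    have : ∀ p, Continuous fun P : X → ℝ => outDist W P p := fun p => by
      unfold outDist; fun_prop
    fun_prop
  refine hc.continuousOn.congr fun P hP => ?_
  have : ∀ z, Real.negMulLog (∑ y, outDist W P (y, z))
      = ∑ y, outDist W P (y, z) * -Real.log (marginalSnd (outDist W P) z) := fun z => by
    rw [← sum_mul, Real.negMulLog, marginalSnd]; ring
  simp only [this]
  rw [sum_comm (s := (univ : Finset Z)) (t := (univ : Finset Y)), ← sum_sub_distrib]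
  simp only [← sum_sub_distrib]
  refine sum_congr rfl fun y _ => sum_congr rfl fun z _ => ?_
  rcases (joint_nonneg hW hP (y, z)).eq_or_lt with h | h
  · simp [← h]
  · have := h.trans_le (joint_le_marginalSnd hW hP y z)
    rw [Real.log_div this.ne' h.ne', Real.negMulLog]; ring

/-- The entropy is maximised over inputs smoothed by a uniform component of weight `lam`. Every
letter then has positive probability, so the losses of the induced conditional law are finite and
continuous in the input; the price is the factor `1 / (1 - lam)`. -/
lemma exists_approx_saddle [Nonempty X] {lam : ℝ} (h0 : 0 < lam) (h1 : lam < 1) :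
    ∃ Q : Z → Y → ℝ, (∀ z y, 0 ≤ Q z y) ∧ (∀ z, ∑ y, Q z y ≤ 1) ∧
      (∀ x z, 0 < eveKernel W f x z → 0 < Q z (f x)) ∧
      ∀ x, logLoss W f Q x ≤ secrecyCapacity W / (1 - lam) := by
  classical
  set U : X → ℝ := fun _ => 1 / (Fintype.card X : ℝ) with hU
  have hX : (0 : ℝ) < Fintype.card X := by exact_mod_cast Fintype.card_pos
  have hUm : U ∈ stdSimplex ℝ X := ⟨fun _ => by positivity, by simp [hU, hX.ne']⟩
  have hmix : ∀ {P R : X → ℝ} {t : ℝ}, P ∈ stdSimplex ℝ X → R ∈ stdSimplex ℝ X → 0 ≤ t → t ≤ 1 →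
      (fun x => (1 - t) * P x + t * R x) ∈ stdSimplex ℝ X := fun {P R t} hP hR ht0 ht1 =>
    ⟨fun x => add_nonneg (mul_nonneg (by linarith) (hP.1 x)) (mul_nonneg ht0 (hR.1 x)), by
      rw [sum_add_distrib, ← mul_sum, ← mul_sum, hP.2, hR.2]; ring⟩
  set m : (X → ℝ) → X → ℝ := fun P x => (1 - lam) * P x + lam * U x with hm
  have hmm : ∀ {P}, P ∈ stdSimplex ℝ X → m P ∈ stdSimplex ℝ X := fun hP =>
    hmix hP hUm h0.le h1.le
  obtain ⟨P, hP, hmax⟩ := (isCompact_stdSimplex ℝ X).exists_isMaxOn ⟨U, hUm⟩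
    (f := fun P => condEntropyFstGivenSnd (outDist W (m P)))
    ((continuousOn_condEntropy hW).comp (Continuous.continuousOn (by fun_prop))
      fun P hP => hmm hP)
  set Qs : (X → ℝ) → Z → Y → ℝ := fun R z y => outDist W R (y, z) / marginalSnd (outDist W R) z
    with hQs
  have hposJ : ∀ {R : X → ℝ}, R ∈ stdSimplex ℝ X → ∀ x z, 0 < eveKernel W f x z →
      0 < outDist W (m R) (f x, z) := fun {R} hR x z hxz => by
    have h2 : m R x * W x (f x, z) ≤ outDist W (m R) (f x, z) :=
      single_le_sum (f := fun x' => m R x' * W x' (f x, z))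
        (fun x' _ => mul_nonneg ((hmm hR).1 x') ((hW x').1 _)) (mem_univ x)
    have h3 : 0 < m R x := add_pos_of_nonneg_of_pos (mul_nonneg (by linarith) (hR.1 x))
      (by positivity)
    exact (mul_pos h3 hxz).trans_le h2
  have hposQ : ∀ {R : X → ℝ}, R ∈ stdSimplex ℝ X → ∀ x z, 0 < eveKernel W f x z →
      0 < Qs (m R) z (f x) := fun {R} hR x z hxz =>
    div_pos (hposJ hR x z hxz)
      ((hposJ hR x z hxz).trans_le (joint_le_marginalSnd hW (hmm hR) _ _))
  -- First-order optimality without differentiation. For the perturbed input `Pt t`, its entropy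
  -- equals the expected loss of its own conditional law, while Gibbs' inequality bounds the entropy
  -- of the maximiser by the expectation of the same loss. Subtracting leaves a multiple of `t`;
  -- dividing it out and letting `t → 0` gives the claim.
  have hkkt : ∀ x, logLoss W f (Qs (m P)) x ≤ ∑ x', P x' * logLoss W f (Qs (m P)) x' := by
    intro x
    set Pt : ℝ → X → ℝ := fun t x' => (1 - t) * P x' + t * (if x' = x then 1 else 0) with hPt
    have hex : (fun x' => if x' = x then (1 : ℝ) else 0) ∈ stdSimplex ℝ X :=
      ⟨fun x' => by dsimp only; split_ifs <;> norm_num, by simp⟩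
    have hPt0 : Pt 0 = P := by funext x'; simp [hPt]
    have hcont : ∀ x', ContinuousAt (fun t => logLoss W f (Qs (m (Pt t))) x') 0 := fun x' => by
      unfold logLoss
      refine tendsto_finsetSum _ fun z _ => ?_
      rcases ((eveKernel_mem hW hWf x').1 z).eq_or_lt with h | h
      · rw [← h]; simp
      · have hp := hposJ hP x' z h
        have hp2 := hp.trans_le (joint_le_marginalSnd hW (hmm hP) (f x') z)
        have hc1 : Continuous fun t => outDist W (m (Pt t)) (f x', z) := by
          simp only [outDist, hm, hPt]; fun_prop
        have hc2 : Continuous fun t => marginalSnd (outDist W (m (Pt t))) z := by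
          simp only [marginalSnd, outDist, hm, hPt]; fun_prop
        have := (hc1.continuousAt (x := 0)).div hc2.continuousAt (by rw [hPt0]; exact hp2.ne')
        refine ((this.log ?_).neg).const_mul _
        change outDist W (m (Pt 0)) (f x', z) / marginalSnd (outDist W (m (Pt 0))) z ≠ 0
        rw [hPt0]; exact (div_pos hp hp2).ne'
    have hcont2 : ContinuousAt (fun t => logLoss W f (Qs (m (Pt t))) x
        - ∑ x', P x' * logLoss W f (Qs (m (Pt t))) x') 0 :=
      (hcont x).sub (tendsto_finsetSum _ fun x' _ => (hcont x').const_mul _)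
    have hlim := hcont2.tendsto.mono_left (nhdsWithin_le_nhds (s := Set.Ioi 0))
    rw [hPt0] at hlim
    refine sub_nonpos.1 (le_of_tendsto hlim ?_)
    filter_upwards [Ioo_mem_nhdsGT (zero_lt_one' ℝ)] with t ht
    have hPtm : Pt t ∈ stdSimplex ℝ X := hmix hP hex ht.1.le ht.2.le
    have hle : condEntropyFstGivenSnd (outDist W (m (Pt t)))
        ≤ condEntropyFstGivenSnd (outDist W (m P)) := hmax hPtm
    have hG := (condEntropy_le_logLoss hW hWf (hmm hP) (Q := Qs (m (Pt t)))
      (cond_nonneg hW (hmm hPtm)) (sum_cond_le _) (fun y z hyz => by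
        obtain ⟨x', -, hx'⟩ := exists_ne_zero_of_sum_ne_zero hyz.ne'
        have hWpos : 0 < W x' (y, z) :=
          ((hW x').1 _).lt_of_ne (right_ne_zero_of_mul hx').symm
        have hy : y = f x' := by
          by_contra hne
          rw [eq_zero_of_ne hW hWf x' y z hne] at hWpos
          exact lt_irrefl _ hWpos
        rw [hy] at hWpos ⊢
        exact hposQ hPtm x' z hWpos)).1
    rw [← sum_logLoss_self hW hWf] at hle
    set D := logLoss W f (Qs (m (Pt t))) with hD
    have h5 : ∑ x', m (Pt t) x' * D x'
        = ∑ x', m P x' * D x' + t * (1 - lam) * (D x - ∑ x', P x' * D x') := by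
      have : ∀ x', m (Pt t) x' * D x' = m P x' * D x'
          + (t * (1 - lam) * ((if x' = x then D x' else 0) - P x' * D x')) := fun x' => by
        simp only [hm, hPt]; split_ifs <;> ring
      simp only [this, sum_add_distrib, ← mul_sum, sum_sub_distrib]
      simp
    have h6 : ∑ x', m (Pt t) x' * D x' ≤ ∑ x', m P x' * D x' := hle.trans hG
    rw [h5] at h6
    have h7 : 0 < t * (1 - lam) := mul_pos ht.1 (by linarith)
    by_contra hcon
    rw [not_le] at hcon
    have := mul_pos h7 hcon
    linarith
  have hQ0 := cond_nonneg hW (hmm hP)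
  refine ⟨Qs (m P), hQ0, sum_cond_le _, hposQ hP, fun x => (hkkt x).trans ?_⟩
  rw [le_div_iff₀ (by linarith)]
  refine le_trans ?_ (condEntropy_le_capacity hW hWf (hmm hP))
  rw [← sum_logLoss_self hW hWf]
  have h8 : 0 ≤ ∑ x, lam * U x * logLoss W f (Qs (m P)) x := sum_nonneg fun x _ =>
    mul_nonneg (mul_nonneg h0.le (hUm.1 x)) (logLoss_nonneg hW hWf hQ0 (sum_cond_le _) x)
  rw [sum_mul]
  calc _ ≤ ∑ x, P x * logLoss W f (Qs (m P)) x * (1 - lam)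
        + ∑ x, lam * U x * logLoss W f (Qs (m P)) x := le_add_of_nonneg_right h8
    _ = _ := by
      rw [← sum_add_distrib]
      exact sum_congr rfl fun x _ => by simp only [hm]; ring

/-- A saddle point: a conditional law of `Y` given `Z` whose logarithmic loss is at most the
secrecy capacity for every channel input. -/
theorem exists_saddle [Nonempty X] :
    ∃ Q : Z → Y → ℝ, (∀ z y, 0 ≤ Q z y) ∧ (∀ z, ∑ y, Q z y ≤ 1) ∧
      (∀ x z, 0 < eveKernel W f x z → 0 < Q z (f x)) ∧
      ∀ x, logLoss W f Q x ≤ secrecyCapacity W := by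
  have hl : ∀ k : ℕ, 0 < 1 / ((k : ℝ) + 2) ∧ 1 / ((k : ℝ) + 2) ≤ 1 / 2 := fun k =>
    ⟨by positivity, by gcongr; linarith [(Nat.cast_nonneg k : (0 : ℝ) ≤ k)]⟩
  have hlim : Tendsto (fun k : ℕ => 1 / ((k : ℝ) + 2)) atTop (𝓝 0) := by
    have := (tendsto_one_div_add_atTop_nhds_zero_nat (𝕜 := ℝ)).comp (tendsto_add_atTop_nat 1)
    refine this.congr fun k => ?_
    simp only [Function.comp_apply]; push_cast; ring
  choose Qk hk0 hk1 hkpos hkle using fun k : ℕ =>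
    exists_approx_saddle hW hWf (hl k).1 (by linarith [(hl k).2])
  have hle1 : ∀ k z y, Qk k z y ≤ 1 := fun k z y =>
    (single_le_sum (f := Qk k z) (fun y _ => hk0 k z y) (mem_univ y)).trans (hk1 k z)
  obtain ⟨Q, -, φ, hφ, hQ⟩ := (isCompact_Icc (a := (0 : Z → Y → ℝ)) (b := 1)).tendsto_subseq
    (x := Qk) fun k => ⟨fun z y => hk0 k z y, fun z y => hle1 k z y⟩
  have hQzy : ∀ z y, Tendsto (fun k => Qk (φ k) z y) atTop (𝓝 (Q z y)) := fun z y =>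
    (tendsto_pi_nhds.1 (tendsto_pi_nhds.1 hQ z) y)
  obtain ⟨x₀⟩ := ‹Nonempty X›
  have hC0 : 0 ≤ secrecyCapacity W := by
    have h1 := logLoss_nonneg hW hWf (hk0 0) (hk1 0) x₀
    have h2 := h1.trans (hkle 0 x₀)
    have h3 := (hl 0).2
    by_contra hneg
    have := div_neg_of_neg_of_pos (not_le.1 hneg) (by linarith : 0 < 1 - 1 / (((0 : ℕ) : ℝ) + 2))
    linarith
  -- The loss bound keeps positivity in the limit: the smoothing weight is at most `1 / 2`, so each
  -- term of the loss is at most `2 * C`, bounding the estimates below uniformly.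
  have hpos : ∀ x z, 0 < eveKernel W f x z → 0 < Q z (f x) := fun x z hxz => by
    have hlow : ∀ k, Real.exp (-(2 * secrecyCapacity W / eveKernel W f x z)) ≤ Qk k z (f x) := by
      intro k
      rw [← Real.le_log_iff_exp_le (hkpos k x z hxz), neg_le, le_div_iff₀ hxz, mul_comm]
      have h1 : eveKernel W f x z * -Real.log (Qk k z (f x)) ≤ logLoss W f (Qk k) x :=
        single_le_sum (f := fun z => eveKernel W f x z * -Real.log (Qk k z (f x)))
          (fun z _ => mul_nonneg ((eveKernel_mem hW hWf x).1 z) (neg_nonneg.2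
            (Real.log_nonpos (hk0 k z _) (hle1 k z _)))) (mem_univ z)
      refine h1.trans ((hkle k x).trans ?_)
      rw [div_le_iff₀ (by linarith [(hl k).2])]
      nlinarith [(hl k).2]
    exact (Real.exp_pos _).trans_le (ge_of_tendsto' (hQzy z (f x)) fun k => hlow _)
  refine ⟨Q, fun z y => ge_of_tendsto' (hQzy z y) fun k => hk0 _ z y, fun z =>
    le_of_tendsto' (tendsto_finsetSum _ fun y _ => hQzy z y) fun k => hk1 _ z, hpos, fun x => ?_⟩
  have hT : Tendsto (fun k => logLoss W f (Qk (φ k)) x) atTop (𝓝 (logLoss W f Q x)) := by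
    refine tendsto_finsetSum _ fun z _ => ?_
    rcases ((eveKernel_mem hW hWf x).1 z).eq_or_lt with h | h
    · rw [← h]; simp
    · exact (((hQzy z (f x)).log (hpos x z h).ne').neg).const_mul _
  have hT2 : Tendsto (fun k => secrecyCapacity W / (1 - 1 / ((φ k : ℝ) + 2))) atTop
      (𝓝 (secrecyCapacity W)) := by
    have := (tendsto_const_nhds (x := secrecyCapacity W)).div
      ((hlim.comp hφ.tendsto_atTop).const_sub 1) (by norm_num)
    simp only [sub_zero, div_one] at this
    exact this
  exact le_of_tendsto_of_tendsto' hT hT2 fun k => hkle _ x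

end SingleLetter

/-! ### Consequences of the saddle point for the optimal input -/

section Saddle
variable {X Y Z : Type*} [Fintype X] [Fintype Y] [Fintype Z]

/-- The variance of the logarithmic loss given the channel input. -/
def lossVar (W : X → Y × Z → ℝ) (f : X → Y) (Q : Z → Y → ℝ) (x : X) : ℝ :=
  (∑ z, eveKernel W f x z * Real.log (Q z (f x)) ^ 2) - logLoss W f Q x ^ 2

/-- The deviation of the joint law induced by `P` from having conditional law `Q`. -/
def condDefect (W : X → Y × Z → ℝ) (Q : Z → Y → ℝ) (P : X → ℝ) (y : Y) (z : Z) : ℝ :=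
  outDist W P (y, z) - marginalSnd (outDist W P) z * Q z y

/-- `Q` is a (sub-)conditional law of `Y` given `Z` whose logarithmic loss is at most the secrecy
capacity for every channel input. -/
structure IsSaddle (W : X → Y × Z → ℝ) (f : X → Y) (Q : Z → Y → ℝ) : Prop where
  nonneg : ∀ z y, 0 ≤ Q z y
  sum_le : ∀ z, ∑ y, Q z y ≤ 1
  pos : ∀ x z, 0 < eveKernel W f x z → 0 < Q z (f x)
  loss_le : ∀ x, logLoss W f Q x ≤ secrecyCapacity W

lemma IsSaddle.le_one {W : X → Y × Z → ℝ} {f : X → Y} {Q : Z → Y → ℝ} (h : IsSaddle W f Q)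
    (z : Z) (y : Y) : Q z y ≤ 1 :=
  (single_le_sum (f := Q z) (fun y _ => h.nonneg z y) (mem_univ y)).trans (h.sum_le z)

variable {W : X → Y × Z → ℝ} (hW : ∀ x, W x ∈ stdSimplex ℝ (Y × Z))
  {f : X → Y} (hWf : IsSemiDeterministic W f) {Q : Z → Y → ℝ} (hQ : IsSaddle W f Q)

lemma condDefect_add_smul (P v : X → ℝ) (t : ℝ) (y : Y) (z : Z) :
    condDefect W Q (fun x => P x + t * v x) y z
      = condDefect W Q P y z + t * condDefect W Q v y z := by
  have := outDist_add_smul W P v 1 t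
  simp only [one_mul] at this
  have h2 := marginalSnd_add_smul (outDist W P) (outDist W v) 1 t
  simp only [one_mul] at h2
  simp only [condDefect, this, h2]; ring

include hW hWf

lemma pos_of_joint_pos {P : X → ℝ}
    (hpos : ∀ x z, 0 < eveKernel W f x z → 0 < Q z (f x)) (y : Y) (z : Z)
    (h : 0 < outDist W P (y, z)) : 0 < Q z y := by
  obtain ⟨x, -, hx⟩ := exists_ne_zero_of_sum_ne_zero h.ne'
  have hWpos : 0 < W x (y, z) := ((hW x).1 _).lt_of_ne (right_ne_zero_of_mul hx).symm
  have hy : y = f x := by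
    by_contra hne
    rw [eq_zero_of_ne hW hWf x y z hne] at hWpos
    exact lt_irrefl _ hWpos
  subst hy
  exact hpos x z hWpos

lemma condEntropy_eq_logLoss {P : X → ℝ} (hP : P ∈ stdSimplex ℝ X)
    (h : ∀ y z, condDefect W Q P y z = 0) :
    condEntropyFstGivenSnd (outDist W P) = ∑ x, P x * logLoss W f Q x := by
  refine Eq.trans ?_ (sum_joint hW hWf P fun y z => -Real.log (Q z y))
  refine sum_congr rfl fun y _ => sum_congr rfl fun z _ => ?_
  rcases (joint_nonneg hW hP (y, z)).eq_or_lt with h0 | h0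
  · rw [← h0, zero_mul, zero_mul]
  · have h1 := h0.trans_le (joint_le_marginalSnd hW hP y z)
    have h2 : outDist W P (y, z) = marginalSnd (outDist W P) z * Q z y := sub_eq_zero.1 (h y z)
    rw [← Real.log_inv]
    congr 2
    rw [h2]
    rw [div_mul_eq_div_div, div_self h1.ne', one_div]

section Optimal
variable {Pstar : X → ℝ} (hmem : Pstar ∈ stdSimplex ℝ X)
  (hopt : condEntropyFstGivenSnd (outDist W Pstar) = secrecyCapacity W)
include hQ hmem hopt

lemma sum_logLoss_optimal : ∑ x, Pstar x * logLoss W f Q x = secrecyCapacity W := by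
  refine le_antisymm ?_ ?_
  · calc _ ≤ ∑ x, Pstar x * secrecyCapacity W :=
        sum_le_sum fun x _ => mul_le_mul_of_nonneg_left (hQ.loss_le x) (hmem.1 x)
      _ = _ := by rw [← sum_mul, hmem.2, one_mul]
  · rw [← hopt]
    exact (condEntropy_le_logLoss hW hWf hmem hQ.nonneg hQ.sum_le
      (pos_of_joint_pos hW hWf hQ.pos)).1

/-- Complementary slackness: the losses are at most the capacity and their mean under the optimal
input equals it. -/
lemma mul_logLoss_optimal (x : X) : Pstar x * logLoss W f Q x = Pstar x * secrecyCapacity W := by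
  have h1 : ∑ x, Pstar x * (secrecyCapacity W - logLoss W f Q x) = 0 := by
    simp only [mul_sub, sum_sub_distrib, sum_logLoss_optimal hW hWf hQ hmem hopt, ← sum_mul,
      hmem.2]
    ring
  have := (sum_eq_zero_iff_of_nonneg fun x _ => mul_nonneg (hmem.1 x)
    (sub_nonneg.2 (hQ.loss_le x))).1 h1 x (mem_univ x)
  linarith [mul_sub (Pstar x) (secrecyCapacity W) (logLoss W f Q x)]

lemma condDefect_optimal (y : Y) (z : Z) : condDefect W Q Pstar y z = 0 := by
  refine sub_eq_zero.2 ?_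
  refine (condEntropy_le_logLoss hW hWf hmem hQ.nonneg hQ.sum_le
      (pos_of_joint_pos hW hWf hQ.pos)).2 (le_of_eq ?_) y z
  rw [hopt, sum_logLoss_optimal hW hWf hQ hmem hopt]

open Classical in
omit hQ hmem hopt in
lemma marginalFst_joint (P : X → ℝ) (y : Y) :
    marginalFst (outDist W P) y = ∑ x, if f x = y then P x else 0 := by
  rw [marginalFst_outDist, outDist]
  refine sum_congr rfl fun x _ => ?_
  rw [hWf x y]
  simp only [eq_comm, mul_ite, mul_one, mul_zero]

lemma sum_joint_log_optimal (y : Y) : ∑ z, outDist W Pstar (y, z) * -Real.log (Q z y)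
    = marginalFst (outDist W Pstar) y * secrecyCapacity W := by
  classical
  have := sum_joint hW hWf Pstar (fun y' z => if y' = y then -Real.log (Q z y') else 0)
  rw [sum_eq_single y (fun y' _ hy' => by simp [hy']) (by simp)] at this
  simp only [if_true] at this
  rw [this, marginalFst_joint hW hWf, sum_mul]
  refine sum_congr rfl fun x _ => ?_
  split_ifs with h
  · exact mul_logLoss_optimal hW hWf hQ hmem hopt x
  · simp

lemma cond_logLoss_optimal {y : Y} (hy : 0 < marginalFst (outDist W Pstar) y) :
    ∑ z, condSndGivenFst (outDist W Pstar) y z * -Real.log (Q z y) = secrecyCapacity W := by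
  simp only [condSndGivenFst, div_mul_eq_mul_div, ← sum_div]
  rw [sum_joint_log_optimal hW hWf hQ hmem hopt, mul_div_cancel_left₀ _ hy.ne']

/-- Since `Q` is the conditional law of `Y`, the information density is `log (Q z y) - log (p y)`.
Given `y` the second term is constant, so the variance is that of the logarithmic loss, whose
conditional mean is the capacity. -/
lemma dispersion_eq_sum_fst : secrecyDispersion W Pstar =
    ∑ y, marginalFst (outDist W Pstar) y *
      ((∑ z, condSndGivenFst (outDist W Pstar) y z * Real.log (Q z y) ^ 2)
        - secrecyCapacity W ^ 2) := by
  set J := outDist W Pstar with hJ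
  set p := marginalFst J with hp
  have hJ0 : ∀ q, 0 ≤ J q := joint_nonneg hW hmem
  have hJp : ∀ y z, J (y, z) ≤ p y := fun y z =>
    single_le_sum (f := fun z => J (y, z)) (fun _ _ => hJ0 _) (mem_univ z)
  have hout : ∀ z, outDist (condSndGivenFst J) p z = marginalSnd J z := fun z => by
    refine sum_congr rfl fun y _ => ?_
    rw [condSndGivenFst, ← hp]
    rcases ((hJ0 (y, z)).trans (hJp y z)).eq_or_lt with h | h
    · rw [← h, zero_mul]; exact le_antisymm (hJ0 _) (h ▸ hJp y z)
    · field_simp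
  refine sum_congr rfl fun y _ => ?_
  rcases ((marginalFst_mem (outDist_mem hW hmem)).1 y).eq_or_lt with h | h
  · rw [← hJ, ← hp] at h
    change p y * _ = p y * _
    rw [← h, zero_mul, zero_mul]
  rw [← hJ, ← hp] at h
  congr 1
  set V := condSndGivenFst J y with hV
  have hV1 : ∑ z, V z = 1 := by
    simp only [hV, condSndGivenFst, ← sum_div]
    exact div_self h.ne'
  have hlog : ∀ z, V z ≠ 0 → Real.log (V z / outDist (condSndGivenFst J) p z)
      = Real.log (Q z y) - Real.log (p y) := fun z hz => by
    have hJpos : 0 < J (y, z) := (hJ0 _).lt_of_ne fun h0 => hz (by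
      rw [hV, condSndGivenFst, ← h0, zero_div])
    have h1 := hJpos.trans_le (joint_le_marginalSnd hW hmem y z)
    have hQpos := pos_of_joint_pos hW hWf hQ.pos y z hJpos
    rw [hout, ← Real.log_div hQpos.ne' h.ne']
    congr 1
    have h2 : J (y, z) = marginalSnd J z * Q z y :=
      sub_eq_zero.1 (condDefect_optimal hW hWf hQ hmem hopt y z)
    rw [hV, condSndGivenFst, ← hp, h2]
    have h1' : marginalSnd J z ≠ 0 := h1.ne'
    field_simp
  have hmean := cond_logLoss_optimal hW hWf hQ hmem hopt h
  rw [← hJ, ← hV] at hmean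
  simp only [mul_neg, sum_neg_distrib] at hmean
  have h1 : ∑ z, V z * Real.log (V z / outDist (condSndGivenFst J) p z) ^ 2
      = ∑ z, V z * Real.log (Q z y) ^ 2 + 2 * secrecyCapacity W * Real.log (p y)
        + Real.log (p y) ^ 2 := by
    have : ∀ z, V z * Real.log (V z / outDist (condSndGivenFst J) p z) ^ 2
        = V z * Real.log (Q z y) ^ 2 - 2 * Real.log (p y) * (V z * Real.log (Q z y))
          + V z * Real.log (p y) ^ 2 := fun z => by
      by_cases hz : V z = 0
      · simp [hz]
      · rw [hlog z hz]; ring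
    simp only [this, sum_add_distrib, sum_sub_distrib, ← mul_sum, ← sum_mul, hV1, ← hmean]
    ring
  have h2 : relEntropy V (outDist (condSndGivenFst J) p)
      = - secrecyCapacity W - Real.log (p y) := by
    have : ∀ z, V z * Real.log (V z / outDist (condSndGivenFst J) p z)
        = V z * Real.log (Q z y) - V z * Real.log (p y) := fun z => by
      by_cases hz : V z = 0
      · simp [hz]
      · rw [hlog z hz]; ring
    simp only [relEntropy, this, sum_sub_distrib, ← sum_mul, hV1, ← hmean]
    ring
  rw [h1, h2]; ring

/-- Conditioning on `X` instead of `Y = f X` changes nothing on average, because the conditional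
mean of the loss is the capacity in either case. This is the form that matches the input types of
the converse. -/
lemma dispersion_eq_sum_input :
    secrecyDispersion W Pstar = ∑ x, Pstar x * lossVar W f Q x := by
  rw [dispersion_eq_sum_fst hW hWf hQ hmem hopt]
  set C := secrecyCapacity W
  have h1 : ∀ y, marginalFst (outDist W Pstar) y *
      ((∑ z, condSndGivenFst (outDist W Pstar) y z * Real.log (Q z y) ^ 2) - C ^ 2)
      = (∑ z, outDist W Pstar (y, z) * Real.log (Q z y) ^ 2)
        - marginalFst (outDist W Pstar) y * C ^ 2 := fun y => by
    rw [mul_sub, mul_sum]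
    congr 1
    refine sum_congr rfl fun z _ => ?_
    rw [condSndGivenFst]
    have hJp : outDist W Pstar (y, z) ≤ marginalFst (outDist W Pstar) y :=
      single_le_sum (f := fun z => outDist W Pstar (y, z)) (fun _ _ => joint_nonneg hW hmem _)
        (mem_univ z)
    have hJ0 := joint_nonneg hW hmem (y, z)
    rcases (hJ0.trans hJp).eq_or_lt with h | h
    · rw [← h, zero_mul, le_antisymm (h ▸ hJp) hJ0, zero_mul]
    · field_simp
  simp only [h1, sum_sub_distrib, ← sum_mul, (marginalFst_mem (outDist_mem hW hmem)).2]
  rw [sum_joint hW hWf Pstar fun y z => Real.log (Q z y) ^ 2]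
  simp only [lossVar, mul_sub, sum_sub_distrib]
  congr 1
  have h2 : ∀ x, Pstar x * logLoss W f Q x ^ 2 = Pstar x * C ^ 2 := fun x => by
    have := mul_logLoss_optimal hW hWf hQ hmem hopt x
    calc _ = Pstar x * logLoss W f Q x * logLoss W f Q x := by ring
      _ = Pstar x * logLoss W f Q x * C := by rw [this]; linear_combination C * this
      _ = _ := by rw [this]; ring
  simp only [h2, ← sum_mul, hmem.2]

end Optimal

/-! ### A linear error bound from uniqueness of the optimal input -/

section Unique
variable {Pstar : X → ℝ} (hmem : Pstar ∈ stdSimplex ℝ X)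
  (huniq : ∀ P ∈ stdSimplex ℝ X,
    condEntropyFstGivenSnd (outDist W P) = secrecyCapacity W ↔ P = Pstar)
include hQ hmem huniq

/-- An error bound: the distance to the unique optimal input distribution is controlled linearly by
the loss of expected logarithmic loss and by the defect of the conditional law. -/
theorem exists_error_bound : ∃ K : ℝ, 0 ≤ K ∧ ∀ P ∈ stdSimplex ℝ X,
    ∑ x, |P x - Pstar x| ≤ K * (∑ x, P x * (secrecyCapacity W - logLoss W f Q x)
      + ∑ y, ∑ z, |condDefect W Q P y z|) := by
  have hopt := (huniq Pstar hmem).2 rfl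
  set C := secrecyCapacity W
  have hzero : ∀ x, Pstar x ≠ 0 → C - logLoss W f Q x = 0 := fun x hx => by
    have := mul_logLoss_optimal hW hWf hQ hmem hopt x
    rw [mul_right_inj' hx] at this
    exact sub_eq_zero.2 this.symm
  have hdef := condDefect_optimal hW hWf hQ hmem hopt
  -- Unit directions in the tangent cone of the simplex at the optimum. The function `g` is
  -- positively homogeneous, so a positive minimum on this compact set gives the linear bound. A
  -- zero of `g` would be a direction along which the conditional law stays `Q` and the loss stays
  -- optimal, hence a second optimiser.
  set S : Set (X → ℝ) := {v | ∑ x, v x = 0 ∧ (∀ x, Pstar x = 0 → 0 ≤ v x) ∧ ∑ x, |v x| = 1} with hS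
  set g : (X → ℝ) → ℝ := fun v => ∑ x, v x * (C - logLoss W f Q x)
    + ∑ y, ∑ z, |condDefect W Q v y z| with hg
  have hgc : Continuous g := by
    simp only [hg, condDefect, marginalSnd, outDist]; fun_prop
  have hterm0 : ∀ v ∈ S, ∀ x, 0 ≤ v x * (C - logLoss W f Q x) := fun v hv x => by
    by_cases hx : Pstar x = 0
    · exact mul_nonneg (hv.2.1 x hx) (sub_nonneg.2 (hQ.loss_le x))
    · rw [hzero x hx, mul_zero]
  have hpos : ∀ v ∈ S, 0 < g v := by
    intro v hv
    have hA : 0 ≤ ∑ x, v x * (C - logLoss W f Q x) := sum_nonneg fun x _ => hterm0 v hv x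
    have hB : 0 ≤ ∑ y, ∑ z, |condDefect W Q v y z| :=
      sum_nonneg fun y _ => sum_nonneg fun z _ => abs_nonneg _
    refine lt_of_le_of_ne (add_nonneg hA hB) fun h0 => ?_
    have hA0 : ∑ x, v x * (C - logLoss W f Q x) = 0 := by simp only [hg] at h0; linarith
    have hB0 : ∑ y, ∑ z, |condDefect W Q v y z| = 0 := by simp only [hg] at h0; linarith
    have hBz : ∀ y z, condDefect W Q v y z = 0 := fun y z => by
      have h1 := (sum_eq_zero_iff_of_nonneg fun y _ => sum_nonneg fun z _ => abs_nonneg _).1 hB0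
        y (mem_univ y)
      exact abs_eq_zero.1 ((sum_eq_zero_iff_of_nonneg fun z _ => abs_nonneg _).1 h1 z (mem_univ z))
    have hev : ∀ᶠ t : ℝ in 𝓝[>] 0, ∀ x, 0 ≤ Pstar x + t * v x := by
      refine eventually_all.2 fun x => ?_
      by_cases hx : Pstar x = 0
      · filter_upwards [self_mem_nhdsWithin] with t ht
        rw [hx, zero_add]; exact mul_nonneg (le_of_lt ht) (hv.2.1 x hx)
      · have hc : Tendsto (fun t : ℝ => Pstar x + t * v x) (𝓝[>] 0) (𝓝 (Pstar x)) := by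
          have : Continuous fun t : ℝ => Pstar x + t * v x := by fun_prop
          have := (this.tendsto 0).mono_left (nhdsWithin_le_nhds (s := Set.Ioi 0))
          simpa using this
        exact (hc.eventually (lt_mem_nhds ((hmem.1 x).lt_of_ne (Ne.symm hx)))).mono
          fun t ht => ht.le
    obtain ⟨t, ht, ht0⟩ := (hev.and self_mem_nhdsWithin).exists
    have ht0' : 0 < t := ht0
    have hPm : (fun x => Pstar x + t * v x) ∈ stdSimplex ℝ X := ⟨ht, by
      rw [sum_add_distrib, ← mul_sum, hv.1, hmem.2]; ring⟩
    have hH := condEntropy_eq_logLoss hW hWf hPm (Q := Q) fun y z => by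
      rw [condDefect_add_smul, hdef, hBz]; ring
    have hHC : condEntropyFstGivenSnd (outDist W fun x => Pstar x + t * v x) = C := by
      rw [hH]
      have h2 := sum_logLoss_optimal hW hWf hQ hmem hopt
      simp only [mul_sub, sum_sub_distrib, ← sum_mul, hv.1] at hA0
      simp only [add_mul, sum_add_distrib, mul_assoc, ← mul_sum]
      rw [h2]
      linear_combination (-t) * hA0
    have hPeq := (huniq _ hPm).1 hHC
    have hv0 : ∀ x, v x = 0 := fun x => by
      have := congrFun hPeq x
      simp only [add_eq_left, mul_eq_zero, ht0'.ne', false_or] at this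
      exact this
    have := hv.2.2
    simp [hv0] at this
  have hSc : IsCompact S := by
    refine Metric.isCompact_of_isClosed_isBounded ?_ ?_
    · have h1 : IsClosed {v : X → ℝ | ∑ x, v x = 0} :=
        isClosed_eq (by fun_prop) continuous_const
      have h2 : IsClosed {v : X → ℝ | ∀ x, Pstar x = 0 → 0 ≤ v x} := by
        simp only [Set.ofPred_forall]
        exact isClosed_iInter fun x => isClosed_iInter fun _ =>
          isClosed_le continuous_const (continuous_apply x)
      have h3 : IsClosed {v : X → ℝ | ∑ x, |v x| = 1} :=
        isClosed_eq (by fun_prop) continuous_const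
      exact h1.inter (h2.inter h3)
    · refine (Metric.isBounded_closedBall (x := (0 : X → ℝ)) (r := 1)).subset fun v hv => ?_
      rw [mem_closedBall_zero_iff, pi_norm_le_iff_of_nonneg zero_le_one]
      intro x
      rw [← hv.2.2]
      exact single_le_sum (f := fun x => |v x|) (fun x _ => abs_nonneg _) (mem_univ x)
  obtain ⟨c, hc0, hc⟩ : ∃ c : ℝ, 0 < c ∧ ∀ v ∈ S, c ≤ g v := by
    rcases S.eq_empty_or_nonempty with h | h
    · exact ⟨1, one_pos, by simp [h]⟩
    · obtain ⟨v, hv, hmin⟩ := hSc.exists_isMinOn h hgc.continuousOn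
      exact ⟨g v, hpos v hv, fun w hw => hmin hw⟩
  refine ⟨c⁻¹, (inv_pos.2 hc0).le, fun P hP => ?_⟩
  set s := ∑ x, |P x - Pstar x| with hs
  have hs0 : 0 ≤ s := sum_nonneg fun x _ => abs_nonneg _
  have hPcost : ∑ x, P x * (C - logLoss W f Q x)
      = ∑ x, (P x - Pstar x) * (C - logLoss W f Q x) := by
    refine sum_congr rfl fun x _ => ?_
    by_cases hx : Pstar x = 0
    · rw [hx, sub_zero]
    · rw [hzero x hx, mul_zero, mul_zero]
  rcases hs0.eq_or_lt with h | h
  · rw [← h]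
    refine mul_nonneg (inv_pos.2 hc0).le (add_nonneg (sum_nonneg fun x _ => mul_nonneg (hP.1 x)
      (sub_nonneg.2 (hQ.loss_le x))) (sum_nonneg fun y _ => sum_nonneg fun z _ => abs_nonneg _))
  · have hv : (fun x => (P x - Pstar x) / s) ∈ S := by
      refine ⟨?_, fun x hx => ?_, ?_⟩
      · rw [← sum_div, sum_sub_distrib, hP.2, hmem.2, sub_self, zero_div]
      · change 0 ≤ (P x - Pstar x) / s
        rw [hx, sub_zero]; exact div_nonneg (hP.1 x) h.le
      · simp only [abs_div, ← sum_div, abs_of_pos h]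
        exact div_self h.ne'
    have h1 := hc _ hv
    have h2 : ∀ y z, condDefect W Q P y z
        = s * condDefect W Q (fun x => (P x - Pstar x) / s) y z := fun y z => by
      have := condDefect_add_smul (W := W) (Q := Q) Pstar (fun x => (P x - Pstar x) / s) s y z
      rw [hdef, zero_add] at this
      rw [← this]
      congr 1
      funext x
      field_simp; ring
    have h3 : s * g (fun x => (P x - Pstar x) / s) = ∑ x, P x * (C - logLoss W f Q x)
        + ∑ y, ∑ z, |condDefect W Q P y z| := by
      simp only [hg, h2, abs_mul, abs_of_pos h, ← mul_sum, mul_add, hPcost]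
      congr 1
      rw [mul_sum]
      refine sum_congr rfl fun x _ => ?_
      field_simp
    rw [← h3, ← mul_assoc, mul_comm c⁻¹, mul_assoc]
    refine le_mul_of_one_le_right h.le ?_
    rw [inv_mul_eq_div, one_le_div hc0]; exact h1

end Unique
end Saddle

/-! ### Tilting the saddle point: lower mean loss against variance deviation -/

lemma sub_two_mul_sq_le_log {u : ℝ} (hu : |u| ≤ 1 / 2) : u - 2 * u ^ 2 ≤ Real.log (1 + u) := by
  have ⟨h1, h2⟩ := abs_le.1 hu
  have h3 : 0 < 1 + u := by linarith
  have h4 := Real.one_sub_inv_le_log_of_pos h3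
  refine le_trans ?_ h4
  have h5 : 1 - (1 + u)⁻¹ = u / (1 + u) := by field_simp; ring
  rw [h5, le_div_iff₀ h3]
  nlinarith [mul_nonneg (sq_nonneg u) (by linarith : 0 ≤ 1 + 2 * u)]

lemma abs_log_one_add_le {u : ℝ} (hu : |u| ≤ 1 / 2) : |Real.log (1 + u)| ≤ 2 * |u| := by
  have ⟨h1, h2⟩ := abs_le.1 hu
  have h3 : 0 < 1 + u := by linarith
  have h4 := sub_two_mul_sq_le_log hu
  have h5 := Real.log_le_sub_one_of_pos h3
  have h6 : u ^ 2 = |u| ^ 2 := (sq_abs u).symm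
  rw [abs_le]
  constructor
  · nlinarith [neg_abs_le u, abs_nonneg u]
  · linarith [le_abs_self u, abs_nonneg u]

/-- Variances of bounded functions that are uniformly close. -/
lemma abs_var_sub_le {A : Type*} [Fintype A] {w : A → ℝ} (hw : w ∈ stdSimplex ℝ A) {g h : A → ℝ}
    {b e : ℝ} (hg : ∀ a, |g a| ≤ b) (hh : ∀ a, |h a| ≤ b) (he : ∀ a, |g a - h a| ≤ e) :
    |((∑ a, w a * g a ^ 2) - (∑ a, w a * g a) ^ 2)
      - ((∑ a, w a * h a ^ 2) - (∑ a, w a * h a) ^ 2)| ≤ 4 * b * e := by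
  have hE : ∀ {F : A → ℝ} {c : ℝ}, (∀ a, |F a| ≤ c) → |∑ a, w a * F a| ≤ c := fun {F c} hF => by
    calc _ ≤ ∑ a, |w a * F a| := abs_sum_le_sum_abs _ _
      _ ≤ ∑ a, w a * c := sum_le_sum fun a _ => by
          rw [abs_mul, abs_of_nonneg (hw.1 a)]
          exact mul_le_mul_of_nonneg_left (hF a) (hw.1 a)
      _ = c := by rw [← sum_mul, hw.2, one_mul]
  have hmul : ∀ {x y : ℝ}, |x| ≤ b → |y| ≤ b → |x - y| ≤ e → |x ^ 2 - y ^ 2| ≤ 2 * b * e :=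
    fun {x y} hx hy hxy => by
      have h1 : x ^ 2 - y ^ 2 = (x + y) * (x - y) := by ring
      rw [h1, abs_mul]
      have h2 := (abs_add_le x y).trans (add_le_add hx hy)
      calc _ ≤ (b + b) * e := mul_le_mul h2 hxy (abs_nonneg _) ((abs_nonneg _).trans h2)
        _ = _ := by ring
  have h1 : |(∑ a, w a * g a ^ 2) - ∑ a, w a * h a ^ 2| ≤ 2 * b * e := by
    rw [← sum_sub_distrib]
    simp only [← mul_sub]
    exact hE fun a => hmul (hg a) (hh a) (he a)
  have h2 : |(∑ a, w a * g a) ^ 2 - (∑ a, w a * h a) ^ 2| ≤ 2 * b * e := by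
    refine hmul (hE hg) (hE hh) ?_
    rw [← sum_sub_distrib]
    simp only [← mul_sub]
    exact hE he
  rw [abs_le] at *
  constructor <;> linarith

section Tilt
variable {X Y Z : Type*} [Fintype X] [Fintype Y] [Fintype Z]
  {W : X → Y × Z → ℝ} (hW : ∀ x, W x ∈ stdSimplex ℝ (Y × Z))
  {f : X → Y} (hWf : IsSemiDeterministic W f) {Q : Z → Y → ℝ} (hQ : IsSaddle W f Q)
include hW hWf hQ

lemma abs_condDefect_le_one {P : X → ℝ} (hP : P ∈ stdSimplex ℝ X) (y : Y) (z : Z) :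
    |condDefect W Q P y z| ≤ 1 := by
  have hz := marginalSnd_mem (outDist_mem hW hP)
  have h1 : marginalSnd (outDist W P) z ≤ 1 := by
    rw [← hz.2]; exact single_le_sum (fun z _ => hz.1 z) (mem_univ z)
  have h2 := joint_le_marginalSnd hW hP y z
  have h3 := joint_nonneg hW hP (y, z)
  have h4 : 0 ≤ marginalSnd (outDist W P) z * Q z y := mul_nonneg (hz.1 z) (hQ.nonneg z y)
  have h5 : marginalSnd (outDist W P) z * Q z y ≤ 1 :=
    mul_le_one₀ h1 (hQ.nonneg z y) (hQ.le_one z y)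
  rw [condDefect, abs_le]
  constructor <;> linarith

/-- Tilting a saddle point towards the actual conditional law reduces the expected loss by an
amount quadratic in the defect. -/
theorem exists_tilt {P : X → ℝ} (hP : P ∈ stdSimplex ℝ X) (y₀ : Y) (z₀ : Z) {b : ℝ}
    (hb : ∀ x z, |Real.log (Q z (f x))| ≤ b) :
    ∃ Q' : Z → Y → ℝ, (∀ z y, 0 ≤ Q' z y) ∧ (∀ z, ∑ y, Q' z y ≤ 1) ∧
      (∀ x z, 0 < eveKernel W f x z → 0 < Q' z (f x)) ∧
      (∀ x z, |Real.log (Q' z (f x))| ≤ b + 1) ∧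
      ∑ x, P x * logLoss W f Q' x
        ≤ ∑ x, P x * logLoss W f Q x - condDefect W Q P y₀ z₀ ^ 2 / 8 ∧
      ∀ x, |lossVar W f Q' x - lossVar W f Q x| ≤ 2 * (b + 1) * |condDefect W Q P y₀ z₀| := by
  classical
  set a := condDefect W Q P y₀ z₀ with ha
  -- The perturbation `φ` has mean `a` under the law induced by `P`, so the gain is at least `s * a
  -- - 2 * s ^ 2`; `s = a / 4` maximises this, giving `a ^ 2 / 8`. Also `|s| ≤ 1 / 4` keeps the
  -- logarithm within its quadratic estimate.
  set s := a / 4 with hs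
  have ha1 : |a| ≤ 1 := abs_condDefect_le_one hW hWf hQ hP y₀ z₀
  have hs1 : |s| ≤ 1 / 4 := by rw [hs, abs_div]; norm_num; linarith
  set φ : Y → Z → ℝ := fun y z => if z = z₀ then (if y = y₀ then 1 else 0) - Q z₀ y₀ else 0 with hφ
  have hq0 := hQ.nonneg z₀ y₀
  have hq1 := hQ.le_one z₀ y₀
  have hφ1 : ∀ y z, |φ y z| ≤ 1 := fun y z => by
    simp only [hφ]; split_ifs <;> rw [abs_le] <;> constructor <;> linarith
  have hsφ : ∀ y z, |s * φ y z| ≤ |s| := fun y z => by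
    rw [abs_mul]; exact mul_le_of_le_one_right (abs_nonneg _) (hφ1 y z)
  have hsφ' : ∀ y z, |s * φ y z| ≤ 1 / 2 := fun y z => (hsφ y z).trans (by linarith)
  have hpos : ∀ y z, 0 < 1 + s * φ y z := fun y z => by linarith [(abs_le.1 (hsφ' y z)).1]
  have hlog : ∀ y z, |Real.log (1 + s * φ y z)| ≤ |a| / 2 := fun y z => by
    refine (abs_log_one_add_le (hsφ' y z)).trans ?_
    have : |s| = |a| / 4 := by rw [hs, abs_div]; norm_num
    linarith [hsφ y z]
  have hlogmul : ∀ y z, Q z y ≠ 0 →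
      Real.log (Q z y * (1 + s * φ y z)) = Real.log (Q z y) + Real.log (1 + s * φ y z) :=
    fun y z h => Real.log_mul h (hpos y z).ne'
  have hκ := eveKernel_mem hW hWf
  refine ⟨fun z y => Q z y * (1 + s * φ y z), fun z y => mul_nonneg (hQ.nonneg z y) (hpos y z).le,
    fun z => ?_, fun x z h => mul_pos (hQ.pos x z h) (hpos _ z), fun x z => ?_, ?_, fun x => ?_⟩
  · by_cases hz : z = z₀
    · subst hz
      have h1 : ∑ y, Q z y * (1 + s * φ y z)
          = (∑ y, Q z y) + s * Q z y₀ * (1 - ∑ y, Q z y) := by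
        have : ∀ y, Q z y * (1 + s * φ y z)
            = Q z y + (s * (if y = y₀ then Q z y else 0) - s * Q z y₀ * Q z y) := fun y => by
          simp only [hφ, if_true]; split_ifs <;> ring
        simp only [this, sum_add_distrib, sum_sub_distrib, ← mul_sum]
        simp; ring
      have h2 : s * Q z y₀ ≤ 1 := by
        have := mul_le_mul_of_nonneg_right ((abs_le.1 hs1).2) hq0
        linarith
      have h3 := hQ.sum_le z
      rw [h1]
      nlinarith
    · have : ∀ y, Q z y * (1 + s * φ y z) = Q z y := fun y => by simp [hφ, hz]
      simp only [this]; exact hQ.sum_le z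
  · rcases eq_or_ne (Q z (f x)) 0 with h | h
    · simp only [h, zero_mul, Real.log_zero, abs_zero]
      linarith [(abs_nonneg _).trans (hb x z)]
    · rw [hlogmul _ _ h]
      refine (abs_add_le _ _).trans (add_le_add (hb x z) ((hlog _ z).trans (by linarith)))
  · have hloss : ∀ x, logLoss W f (fun z y => Q z y * (1 + s * φ y z)) x
        = logLoss W f Q x - ∑ z, eveKernel W f x z * Real.log (1 + s * φ (f x) z) := fun x => by
      simp only [logLoss]
      rw [← sum_sub_distrib]
      refine sum_congr rfl fun z _ => ?_
      rcases ((hκ x).1 z).eq_or_lt with h | h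
      · rw [← h]; simp
      · rw [hlogmul _ _ (hQ.pos x z h).ne']; ring
    have hgain : a ^ 2 / 8 ≤ ∑ x, P x * ∑ z, eveKernel W f x z * Real.log (1 + s * φ (f x) z) := by
      have h1 : ∑ x, P x * ∑ z, eveKernel W f x z * φ (f x) z = a := by
        rw [← sum_joint hW hWf P φ, ha, condDefect]
        have h2 : ∀ y, ∑ z, outDist W P (y, z) * φ y z
            = (if y = y₀ then outDist W P (y, z₀) else 0) - outDist W P (y, z₀) * Q z₀ y₀ :=
          fun y => by
            rw [sum_eq_single z₀ (fun z _ hz => by simp [hφ, hz]) (by simp)]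
            simp only [hφ, if_true]; split_ifs <;> ring
        simp only [h2, sum_sub_distrib, ← sum_mul]
        simp [marginalSnd]
      calc a ^ 2 / 8 = s * a - 2 * s ^ 2 := by rw [hs]; ring
        _ = ∑ x, P x * ∑ z, eveKernel W f x z * (s * φ (f x) z - 2 * s ^ 2) := by
          simp only [mul_sub, sum_sub_distrib, mul_left_comm _ s, ← mul_sum, h1]
          simp only [← sum_mul, (hκ _).2, one_mul, hP.2]
        _ ≤ _ := by
          refine sum_le_sum fun x _ => mul_le_mul_of_nonneg_left (sum_le_sum fun z _ =>
            mul_le_mul_of_nonneg_left ?_ ((hκ x).1 z)) (hP.1 x)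
          refine le_trans ?_ (sub_two_mul_sq_le_log (hsφ' _ z))
          have : (s * φ (f x) z) ^ 2 ≤ s ^ 2 := sq_le_sq.2 (hsφ _ z)
          linarith
    simp only [hloss, mul_sub, sum_sub_distrib]
    linarith
  · set h : Z → ℝ := fun z => Real.log (Q z (f x)) with hh
    -- Where `Q` vanishes, so does its tilted version, and both logarithms take the default value
    -- `0`; the product rule for the logarithm is needed only elsewhere.
    set g : Z → ℝ := fun z => if Q z (f x) = 0 then 0 else
      Real.log (Q z (f x)) + Real.log (1 + s * φ (f x) z) with hg
    have h1 : ∀ z, Real.log (Q z (f x) * (1 + s * φ (f x) z)) = g z := fun z => by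
      simp only [hg]
      split_ifs with h0
      · simp [h0]
      · exact hlogmul _ _ h0
    have h2 := abs_var_sub_le (hκ x) (g := g) (h := h) (b := b + 1) (e := |a| / 2)
      (fun z => by
        simp only [hg]; split_ifs
        · rw [abs_zero]; linarith [(abs_nonneg _).trans (hb x z)]
        · exact (abs_add_le _ _).trans (add_le_add (hb x z) ((hlog _ z).trans (by linarith))))
      (fun z => (hb x z).trans (by linarith))
      (fun z => by
        simp only [hg, hh]; split_ifs with h0
        · rw [h0, Real.log_zero, sub_zero, abs_zero]; positivity
        · rw [add_sub_cancel_left]; exact hlog _ z)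
    simp only [lossVar, logLoss, h1, mul_neg, sum_neg_distrib, neg_sq]
    exact h2.trans (le_of_eq (by ring))

/-- For every input distribution there is an estimate whose expected loss is below the capacity by
a quadratic term in the deviation of its variance from the dispersion. -/
theorem exists_converse_estimate {Pstar : X → ℝ} (hmem : Pstar ∈ stdSimplex ℝ X)
    (huniq : ∀ P ∈ stdSimplex ℝ X,
      condEntropyFstGivenSnd (outDist W P) = secrecyCapacity W ↔ P = Pstar) :
    ∃ b c K : ℝ, 0 < b ∧ 0 < c ∧ 0 < K ∧ ∀ P : X → ℝ, ∃ Q' : Z → Y → ℝ,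
      (∀ z y, 0 ≤ Q' z y) ∧ (∀ z, ∑ y, Q' z y ≤ 1) ∧ (P ∈ stdSimplex ℝ X →
        (∀ x z, 0 < eveKernel W f x z → 0 < Q' z (f x)) ∧
        (∀ x z, |Real.log (Q' z (f x))| ≤ b) ∧
        ∃ ρ, 0 ≤ ρ ∧ ∑ x, P x * logLoss W f Q' x ≤ secrecyCapacity W - c * ρ ^ 2 ∧
          |∑ x, P x * lossVar W f Q' x - secrecyDispersion W Pstar| ≤ K * ρ) := by
  have hopt := (huniq Pstar hmem).2 rfl
  obtain ⟨KH, hKH, hbound⟩ := exists_error_bound hW hWf hQ hmem huniq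
  set C := secrecyCapacity W with hC
  have hX : Nonempty X := by
    by_contra h
    rw [not_nonempty_iff] at h
    have := hmem.2
    simp at this
  have hY : Nonempty Y := hX.map f
  have hZ : Nonempty Z := by
    by_contra h
    rw [not_nonempty_iff] at h
    have := (eveKernel_mem hW hWf hX.some).2
    simp at this
  obtain ⟨b, hb⟩ : ∃ b : ℝ, ∀ x z, |Real.log (Q z (f x))| ≤ b :=
    ⟨∑ x, ∑ z, |Real.log (Q z (f x))|, fun x z =>
      (single_le_sum (f := fun z => |Real.log (Q z (f x))|) (fun z _ => abs_nonneg _)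
        (mem_univ z)).trans (single_le_sum (f := fun x => ∑ z, |Real.log (Q z (f x))|)
        (fun x _ => sum_nonneg fun z _ => abs_nonneg _) (mem_univ x))⟩
  have hb0 : 0 ≤ b := (abs_nonneg _).trans (hb hX.some hZ.some)
  set B := ∑ x, |lossVar W f Q x| with hB
  have hB0 : 0 ≤ B := sum_nonneg fun x _ => abs_nonneg _
  have hC0 : 0 ≤ C := (logLoss_nonneg hW hWf hQ.nonneg hQ.sum_le hX.some).trans (hQ.loss_le _)
  set N : ℝ := (Fintype.card Y : ℝ) * Fintype.card Z with hN
  have hN0 : 0 < N := mul_pos (by exact_mod_cast Fintype.card_pos) (by exact_mod_cast Fintype.card_pos)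
  -- With `ρ = u + |a|`, for capacity deficit `u` and largest defect `a`, one has `ρ ^ 2 ≤ 2 * u ^ 2
  -- + 2 * a ^ 2`. The first entry makes the quadratic cost of `u` at most `u` itself, as `u ≤ C`;
  -- the second matches the tilting gain `a ^ 2 / 8`.
  have hc0 : 0 < min (1 / (2 * (C + 1))) (1 / 16) := lt_min (by positivity) (by norm_num)
  refine ⟨b + 1, min (1 / (2 * (C + 1))) (1 / 16), 2 * (b + 1) + B * KH * (1 + N),
    by linarith, hc0, by positivity, fun P => ?_⟩
  by_cases hP : P ∈ stdSimplex ℝ X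
  swap
  -- Arguments that are no distributions still need a subnormalised estimate, because the converse
  -- mixes over all count vectors, including those with the wrong total.
  · exact ⟨Q, hQ.nonneg, hQ.sum_le, fun h => absurd h hP⟩
  obtain ⟨⟨y₀, z₀⟩, -, hmax⟩ := exists_max_image (univ : Finset (Y × Z))
    (fun p => |condDefect W Q P p.1 p.2|) univ_nonempty
  obtain ⟨Q', h0, h1, hpos, hlog, hloss, hvar⟩ := exists_tilt hW hWf hQ hP y₀ z₀ hb
  set a := condDefect W Q P y₀ z₀ with ha
  set u := ∑ x, P x * (C - logLoss W f Q x) with hu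
  have hu0 : 0 ≤ u := sum_nonneg fun x _ => mul_nonneg (hP.1 x) (sub_nonneg.2 (hQ.loss_le x))
  have hu' : u = C - ∑ x, P x * logLoss W f Q x := by
    simp only [hu, mul_sub, sum_sub_distrib, ← sum_mul, hP.2, one_mul]
  have huC : u ≤ C := by
    rw [hu']
    have : 0 ≤ ∑ x, P x * logLoss W f Q x := sum_nonneg fun x _ =>
      mul_nonneg (hP.1 x) (logLoss_nonneg hW hWf hQ.nonneg hQ.sum_le x)
    linarith
  refine ⟨Q', h0, h1, fun _ => ⟨hpos, hlog, u + |a|, add_nonneg hu0 (abs_nonneg a), ?_, ?_⟩⟩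
  · refine hloss.trans ?_
    have h2 : u ^ 2 ≤ u * (C + 1) := by rw [sq]; exact mul_le_mul_of_nonneg_left (by linarith) hu0
    have h3 : (u + |a|) ^ 2 ≤ 2 * u ^ 2 + 2 * a ^ 2 := by
      rw [← sq_abs a]; nlinarith [sq_nonneg (u - |a|)]
    have h4 : min (1 / (2 * (C + 1))) (1 / 16) * (2 * u ^ 2) ≤ u := by
      calc _ ≤ 1 / (2 * (C + 1)) * (2 * (u * (C + 1))) := by
            gcongr
            exact min_le_left _ _
        _ = u := by field_simp
    have h5 : min (1 / (2 * (C + 1))) (1 / 16) * (2 * a ^ 2) ≤ a ^ 2 / 8 := by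
      calc _ ≤ 1 / 16 * (2 * a ^ 2) := by gcongr; exact min_le_right _ _
        _ = _ := by ring
    have h6 := mul_le_mul_of_nonneg_left h3 hc0.le
    linarith
  · rw [dispersion_eq_sum_input hW hWf hQ hmem hopt]
    -- The variance moves for two reasons: the tilt, of order `|a|`, and the distance of `P` from
    -- the optimum, controlled linearly by the error bound.
    have h2 : ∑ x, P x * lossVar W f Q' x - ∑ x, Pstar x * lossVar W f Q x
        = ∑ x, P x * (lossVar W f Q' x - lossVar W f Q x)
          + ∑ x, (P x - Pstar x) * lossVar W f Q x := by
      rw [← sum_add_distrib, ← sum_sub_distrib]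
      exact sum_congr rfl fun x _ => by ring
    have h3 : |∑ x, P x * (lossVar W f Q' x - lossVar W f Q x)| ≤ 2 * (b + 1) * |a| := by
      calc _ ≤ ∑ x, |P x * (lossVar W f Q' x - lossVar W f Q x)| := abs_sum_le_sum_abs _ _
        _ ≤ ∑ x, P x * (2 * (b + 1) * |a|) := sum_le_sum fun x _ => by
            rw [abs_mul, abs_of_nonneg (hP.1 x)]
            exact mul_le_mul_of_nonneg_left (hvar x) (hP.1 x)
        _ = _ := by rw [← sum_mul, hP.2, one_mul]
    have h4 : |∑ x, (P x - Pstar x) * lossVar W f Q x| ≤ B * ∑ x, |P x - Pstar x| := by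
      calc _ ≤ ∑ x, |(P x - Pstar x) * lossVar W f Q x| := abs_sum_le_sum_abs _ _
        _ ≤ ∑ x, B * |P x - Pstar x| := sum_le_sum fun x _ => by
            rw [abs_mul, mul_comm]
            exact mul_le_mul_of_nonneg_right (single_le_sum (f := fun x => |lossVar W f Q x|)
              (fun x _ => abs_nonneg _) (mem_univ x)) (abs_nonneg _)
        _ = _ := by rw [mul_sum]
    have h5 : ∑ y, ∑ z, |condDefect W Q P y z| ≤ N * |a| := by
      calc _ ≤ ∑ _y : Y, ∑ _z : Z, |a| :=
            sum_le_sum fun y _ => sum_le_sum fun z _ => hmax (y, z) (mem_univ _)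
        _ = _ := by simp [hN]; ring
    have h6 : B * ∑ x, |P x - Pstar x| ≤ B * (KH * (u + N * |a|)) :=
      mul_le_mul_of_nonneg_left ((hbound P hP).trans
        (mul_le_mul_of_nonneg_left (by linarith) hKH)) hB0
    rw [h2]
    refine (abs_add_le _ _).trans ?_
    have h7 : 0 ≤ B * KH := by positivity
    have h8 : 0 ≤ |a| := abs_nonneg a
    have h9 : B * KH * (u + N * |a|) ≤ B * KH * ((1 + N) * (u + |a|)) := by
      refine mul_le_mul_of_nonneg_left ?_ h7
      nlinarith [mul_nonneg hN0.le hu0]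
    have h10 : 2 * (b + 1) * |a| ≤ 2 * (b + 1) * (u + |a|) := by
      refine mul_le_mul_of_nonneg_left (by linarith) (by linarith)
    linarith [mul_assoc B KH (u + N * |a|), mul_assoc (B * KH) (1 + N) (u + |a|),
      add_mul (2 * (b + 1)) (B * KH * (1 + N)) (u + |a|)]

end Tilt

/-! ### Gaussian approximation of the tails -/

lemma eventually_le_sqrt (T : ℝ) : ∀ᶠ n : ℕ in atTop, T ≤ Real.sqrt n :=
  (Real.tendsto_sqrt_atTop.comp tendsto_natCast_atTop_atTop).eventually_ge_atTop T

lemma gaussianQ_lt_one (r : ℝ) : gaussianQ r < 1 := by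
  obtain ⟨κ, hκ, h⟩ := exists_gaussianQ_slope r
  have h1 := (h 1 zero_le_one le_rfl).1
  have h2 := gaussianQ_le_one (r - 1)
  linarith

lemma abs_sqrt_sub_sqrt_le {s v e : ℝ} (hs : 0 ≤ s) (hv : 0 < v) (h : |s - v| ≤ e) :
    |Real.sqrt s - Real.sqrt v| ≤ e / Real.sqrt v := by
  have h1 := Real.sqrt_pos.2 hv
  have h2 := Real.sqrt_nonneg s
  rw [le_div_iff₀ h1]
  refine le_trans ?_ h
  have : s - v = (Real.sqrt s - Real.sqrt v) * (Real.sqrt s + Real.sqrt v) := by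
    have h3 := Real.sq_sqrt hs
    have h4 := Real.sq_sqrt hv.le
    ring_nf; rw [h3, h4]
  rw [this, abs_mul, abs_of_nonneg (by positivity : 0 ≤ Real.sqrt s + Real.sqrt v)]
  exact mul_le_mul_of_nonneg_left (by linarith) (abs_nonneg _)

lemma prodExp_chebyshev_le {ι A : Type*} [Fintype ι] [DecidableEq ι] [Fintype A] {w u : ι → A → ℝ}
    (hw : ∀ k, w k ∈ stdSimplex ℝ A) {b : ℝ} (hu : ∀ k a, |u k a| ≤ b) {s t : ℝ} (hs : 0 < s)
    (ht : (∑ k, ∑ a, w k a * u k a) + s ≤ t) :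
    1 - Fintype.card ι * b ^ 2 / s ^ 2 ≤ prodExp w (fun z => if ∑ k, u k (z k) ≤ t then 1 else 0) := by
  set m : ι → ℝ := fun k => ∑ a, w k a * u k a with hm
  have hξ : ∀ k, ∑ a, w k a * (u k a - m k) = 0 := fun k => by
    simp only [mul_sub, sum_sub_distrib, ← sum_mul, (hw k).2]; simp [hm]
  have h1 := prodExp_chebyshev hw hξ hs
  have h2 : ∑ k, ∑ a, w k a * (u k a - m k) ^ 2 ≤ Fintype.card ι * b ^ 2 := by
    have : ∀ k, ∑ a, w k a * (u k a - m k) ^ 2 ≤ b ^ 2 := fun k => by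
      have h3 : ∀ a, w k a * (u k a - m k) ^ 2
          = w k a * u k a ^ 2 - 2 * m k * (w k a * u k a) + w k a * m k ^ 2 := fun a => by ring
      simp only [h3, sum_add_distrib, sum_sub_distrib, ← mul_sum, ← sum_mul, (hw k).2]
      have h4 : ∑ a, w k a * u k a ^ 2 ≤ ∑ a, w k a * b ^ 2 := sum_le_sum fun a _ =>
        mul_le_mul_of_nonneg_left (sq_le_sq' (by linarith [(abs_le.1 (hu k a)).1])
          (abs_le.1 (hu k a)).2) ((hw k).1 a)
      rw [← sum_mul, (hw k).2, one_mul] at h4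
      rw [show ∑ a, w k a * u k a = m k from rfl]
      nlinarith [sq_nonneg (m k)]
    calc _ ≤ ∑ _k : ι, b ^ 2 := sum_le_sum fun k _ => this k
      _ = _ := by simp
  have h5 : 1 - prodExp w (fun z => if ∑ k, u k (z k) ≤ t then 1 else 0)
      ≤ prodExp w (fun z => if s < ∑ k, (u k (z k) - m k) then 1 else 0) := by
    have h3 := prodExp_sub (w := w) (fun _ => 1) (fun z => if ∑ k, u k (z k) ≤ t then 1 else 0)
    rw [prodExp_const hw] at h3
    rw [← h3]
    refine prodExp_mono hw fun z => ?_
    rw [sum_sub_distrib]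
    split_ifs <;> linarith
  have h6 : (∑ k, ∑ a, w k a * (u k a - m k) ^ 2) / s ^ 2 ≤ Fintype.card ι * b ^ 2 / s ^ 2 := by
    gcongr
  linarith

/-- A uniform lower bound on the distribution function when the loss in the mean is quadratic in
the deviation of the variance. -/
theorem eventually_le_prodExp {Z : Type*} [Fintype Z] {V c K b r A : ℝ} (hV : 0 < V) (hc : 0 < c)
    (hK : 0 < K) (hb : 0 < b) (hA : 0 ≤ A) : ∃ K₁ : ℝ, 0 ≤ K₁ ∧ ∀ᶠ n : ℕ in atTop,
    ∀ (w u : Fin n → Z → ℝ) (C ρ : ℝ), (∀ k, w k ∈ stdSimplex ℝ Z) → (∀ k a, |u k a| ≤ b) → 0 ≤ ρ →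
      ∑ k, ∑ a, w k a * u k a ≤ n * (C - c * ρ ^ 2) →
      |∑ k, (∑ a, w k a * u k a ^ 2 - (∑ a, w k a * u k a) ^ 2) - n * V| ≤ n * (K * ρ) →
      gaussianQ r + A / Real.sqrt n ≤ prodExp w (fun z =>
        if ∑ k, u k (z k) ≤ n * C - Real.sqrt (n * V) * r + K₁ then 1 else 0) := by
  obtain ⟨κ, hκ, hslope⟩ := exists_gaussianQ_slope r
  set B₁ := 40 * b / Real.sqrt (V / 2) with hB₁
  have hB₁0 : 0 < B₁ := by positivity
  -- Shifting the Gaussian argument by `A' / √n` gains `κ * A' / √n`, which pays for the requested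
  -- margin and for the Berry–Esseen error `B₁ / √n`.
  set A' := (A + B₁) / κ with hA'
  have hA'0 : 0 < A' := by positivity
  -- The first summand is the remainder of the completed square; the second realises the shift by
  -- `A' / √n`, since the standard deviation is at most `√(2 * n * V)`.
  set K₁ := r ^ 2 * K ^ 2 / (4 * c * V) + A' * Real.sqrt (2 * V) with hK₁
  have hK₁0 : 0 ≤ K₁ := by positivity
  -- Below `ρ₀` the variance deviates from `n * V` by at most half, and Berry–Esseen applies. Above
  -- it the mean is lower by a multiple of `n`, and Chebyshev's inequality is enough.
  set ρ₀ := V / (2 * K) with hρ₀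
  have hρ₀0 : 0 < ρ₀ := by positivity
  set D := b ^ 2 / (c * ρ₀ ^ 2 / 2) ^ 2 with hD
  have hD0 : 0 < D := by positivity
  have hq := gaussianQ_lt_one r
  refine ⟨K₁, hK₁0, ?_⟩
  filter_upwards [eventually_le_sqrt 1, eventually_le_sqrt A',
    eventually_le_sqrt (Real.sqrt V * |r| / (c * ρ₀ ^ 2 / 2)),
    eventually_le_sqrt ((D + A) / (1 - gaussianQ r))] with n hn1 hnA hnV hnD
  intro w u C ρ hw hu hρ hmean hvar
  set sn := Real.sqrt n with hsn
  have hsn0 : 0 < sn := by linarith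
  have hn : (n : ℝ) = sn ^ 2 := (Real.sq_sqrt (Nat.cast_nonneg n)).symm
  have hsV : Real.sqrt (n * V) = sn * Real.sqrt V := Real.sqrt_mul (Nat.cast_nonneg n) V
  have hVs := Real.sqrt_pos.2 hV
  have hVsq := Real.sq_sqrt hV.le
  rw [hsV]
  set μ := ∑ k, ∑ a, w k a * u k a with hμ
  rcases le_total ρ ρ₀ with hρρ | hρρ
  · set σ2 := ∑ k, (∑ a, w k a * u k a ^ 2 - (∑ a, w k a * u k a) ^ 2) with hσ2
    have hKρ : n * (K * ρ) ≤ n * (V / 2) := by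
      have : K * ρ ≤ K * ρ₀ := by gcongr
      have h2 : K * ρ₀ = V / 2 := by rw [hρ₀]; field_simp
      rw [h2] at this
      exact mul_le_mul_of_nonneg_left this (Nat.cast_nonneg n)
    have hσlo : n * (V / 2) ≤ σ2 := by linarith [(abs_le.1 hvar).1]
    have hσhi : σ2 ≤ n * (2 * V) := by
      have : 0 ≤ n * V := by positivity
      linarith [(abs_le.1 hvar).2]
    have hσpos : 0 < σ2 := lt_of_lt_of_le (by rw [hn]; positivity) hσlo
    set σ := Real.sqrt σ2 with hσ
    have hσ0 : 0 < σ := Real.sqrt_pos.2 hσpos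
    have hσlo' : sn * Real.sqrt (V / 2) ≤ σ := by
      rw [← Real.sqrt_mul (Nat.cast_nonneg n)]; exact Real.sqrt_le_sqrt hσlo
    have hσhi' : σ ≤ sn * Real.sqrt (2 * V) := by
      rw [← Real.sqrt_mul (Nat.cast_nonneg n)]; exact Real.sqrt_le_sqrt hσhi
    have hBE := berryEsseen hw hb hu hσ0 (Real.sq_sqrt hσpos.le).symm
      (n * C - sn * Real.sqrt V * r + K₁)
    have hBEerr : 40 * b / σ ≤ B₁ / sn := by
      calc 40 * b / σ ≤ 40 * b / (sn * Real.sqrt (V / 2)) := by gcongr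
        _ = B₁ / sn := by rw [hB₁]; field_simp
    have hdiff : |σ - sn * Real.sqrt V| ≤ sn * (K * ρ) / Real.sqrt V := by
      have := abs_sqrt_sub_sqrt_le hσpos.le (by rw [hn]; positivity : 0 < n * V) hvar
      rw [hsV] at this
      refine this.trans (le_of_eq ?_)
      rw [hn]; field_simp
    have harg : (μ - (n * C - sn * Real.sqrt V * r + K₁)) / σ ≤ r - A' / sn := by
      rw [div_le_iff₀ hσ0]
      have h1 : r * (sn * Real.sqrt V - σ) ≤ |r| * (sn * (K * ρ) / Real.sqrt V) := by
        refine (le_abs_self _).trans ?_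
        rw [abs_mul, abs_sub_comm]
        exact mul_le_mul_of_nonneg_left hdiff (abs_nonneg r)
      have h2 : |r| * (sn * (K * ρ) / Real.sqrt V)
          ≤ n * (c * ρ ^ 2) + r ^ 2 * K ^ 2 / (4 * c * V) := by
        -- The deviation of the standard deviation is linear in `√n * ρ`, the gain in the mean
        -- quadratic in it; their difference is a perfect square up to a constant independent of `n`
        -- and `ρ`.
        have h3 : n * (c * ρ ^ 2) + r ^ 2 * K ^ 2 / (4 * c * V)
            - |r| * (sn * (K * ρ) / Real.sqrt V)
            = c * (sn * ρ - |r| * K / (2 * c * Real.sqrt V)) ^ 2 := by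
          rw [hn, ← sq_abs r]
          nth_rewrite 1 [← hVsq]
          field_simp
          ring
        have h4 : 0 ≤ c * (sn * ρ - |r| * K / (2 * c * Real.sqrt V)) ^ 2 := by positivity
        linarith
      have h5 : A' / sn * σ ≤ A' * Real.sqrt (2 * V) := by
        calc A' / sn * σ ≤ A' / sn * (sn * Real.sqrt (2 * V)) := by gcongr
          _ = _ := by field_simp
      have h6 : (r - A' / sn) * σ = r * σ - A' / sn * σ := by ring
      rw [h6, hK₁]
      have h7 : n * (C - c * ρ ^ 2) = n * C - n * (c * ρ ^ 2) := by ring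
      rw [h7] at hmean
      have h8 : r * (sn * Real.sqrt V - σ) = sn * Real.sqrt V * r - r * σ := by ring
      rw [h8] at h1
      linarith
    have hQ := gaussianQ_anti harg
    have hA1 : A' / sn ≤ 1 := by rw [div_le_one hsn0]; exact hnA
    have hs := (hslope (A' / sn) (by positivity) hA1).1
    have hκA : κ * (A' / sn) = A / sn + B₁ / sn := by rw [hA']; field_simp
    linarith [(abs_le.1 hBE).1]
  · set s := n * (c * ρ₀ ^ 2 / 2) with hs
    have hs0 : 0 < s := by rw [hs, hn]; positivity
    have h1 : sn * Real.sqrt V * r ≤ s := by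
      rw [div_le_iff₀ (by positivity)] at hnV
      calc sn * Real.sqrt V * r ≤ sn * (Real.sqrt V * |r|) := by
            rw [mul_assoc]; gcongr; exact le_abs_self r
        _ ≤ sn * (sn * (c * ρ₀ ^ 2 / 2)) := by gcongr
        _ = s := by rw [hs, hn]; ring
    have h2 : n * (c * ρ₀ ^ 2) ≤ n * (c * ρ ^ 2) := by gcongr
    have h3 := prodExp_chebyshev_le hw hu hs0
      (t := n * C - sn * Real.sqrt V * r + K₁) (by
        have : n * (C - c * ρ ^ 2) = n * C - n * (c * ρ ^ 2) := by ring
        rw [this] at hmean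
        have h4 : n * (c * ρ₀ ^ 2) = s + s := by rw [hs]; ring
        linarith)
    refine le_trans ?_ h3
    rw [Fintype.card_fin]
    have h5 : n * b ^ 2 / s ^ 2 = D / sn ^ 2 := by
      rw [hs, hD, ← hn]
      have : (n : ℝ) ≠ 0 := by rw [hn]; positivity
      field_simp
    have h6 : D / sn ^ 2 ≤ D / sn := by
      gcongr; nlinarith
    have h7 : (D + A) / sn ≤ 1 - gaussianQ r := by
      rw [div_le_iff₀ (by linarith)] at hnD
      rw [div_le_iff₀ hsn0]; linarith
    rw [add_div] at h7
    linarith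

/-- An upper bound on the distribution function below the Gaussian quantile. -/
theorem eventually_prodExp_le {Z : Type*} [Fintype Z] {V K b r A : ℝ} (hV : 0 < V)
    (hK : 0 ≤ K) (hb : 0 < b) (hA : 0 ≤ A) : ∃ K₁ : ℝ, 0 ≤ K₁ ∧ ∀ᶠ n : ℕ in atTop,
    ∀ (w u : Fin n → Z → ℝ) (C : ℝ), (∀ k, w k ∈ stdSimplex ℝ Z) → (∀ k a, |u k a| ≤ b) →
      ∑ k, ∑ a, w k a * u k a = n * C →
      |∑ k, (∑ a, w k a * u k a ^ 2 - (∑ a, w k a * u k a) ^ 2) - n * V| ≤ K →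
      prodExp w (fun z => if ∑ k, u k (z k) ≤ n * C - Real.sqrt (n * V) * r - K₁ then 1 else 0)
        ≤ gaussianQ r - A / Real.sqrt n := by
  obtain ⟨κ, hκ, hslope⟩ := exists_gaussianQ_slope r
  set B₁ := 40 * b / Real.sqrt (V / 2) with hB₁
  have hB₁0 : 0 < B₁ := by positivity
  set A' := (A + B₁) / κ with hA'
  have hA'0 : 0 < A' := by positivity
  -- Here the variance is off by a bounded amount only, so the standard deviation is too; the first
  -- summand absorbs this, the second creates the shift by `A' / √n`.
  set K₁ := |r| * K / Real.sqrt V + A' * Real.sqrt (2 * V) with hK₁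
  have hVs := Real.sqrt_pos.2 hV
  have hK₁0 : 0 ≤ K₁ := by positivity
  refine ⟨K₁, hK₁0, ?_⟩
  filter_upwards [eventually_le_sqrt 1, eventually_le_sqrt A',
    eventually_le_sqrt (2 * K / V)] with n hn1 hnA hnV
  intro w u C hw hu hmean hvar
  set sn := Real.sqrt n with hsn
  have hsn0 : 0 < sn := by linarith
  have hn : (n : ℝ) = sn ^ 2 := (Real.sq_sqrt (Nat.cast_nonneg n)).symm
  have hsV : Real.sqrt (n * V) = sn * Real.sqrt V := Real.sqrt_mul (Nat.cast_nonneg n) V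
  rw [hsV]
  set μ := ∑ k, ∑ a, w k a * u k a with hμ
  set σ2 := ∑ k, (∑ a, w k a * u k a ^ 2 - (∑ a, w k a * u k a) ^ 2) with hσ2
  have hKn : K ≤ n * (V / 2) := by
    rw [div_le_iff₀ hV] at hnV
    have h2 : sn * V ≤ n * V := by rw [hn]; gcongr; nlinarith
    linarith
  have hσlo : n * (V / 2) ≤ σ2 := by linarith [(abs_le.1 hvar).1]
  have hσhi : σ2 ≤ n * (2 * V) := by
    have : 0 ≤ n * V := by positivity
    linarith [(abs_le.1 hvar).2]
  have hσpos : 0 < σ2 := lt_of_lt_of_le (by rw [hn]; positivity) hσlo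
  set σ := Real.sqrt σ2 with hσ
  have hσ0 : 0 < σ := Real.sqrt_pos.2 hσpos
  have hσlo' : sn * Real.sqrt (V / 2) ≤ σ := by
    rw [← Real.sqrt_mul (Nat.cast_nonneg n)]; exact Real.sqrt_le_sqrt hσlo
  have hσhi' : σ ≤ sn * Real.sqrt (2 * V) := by
    rw [← Real.sqrt_mul (Nat.cast_nonneg n)]; exact Real.sqrt_le_sqrt hσhi
  have hBE := berryEsseen hw hb hu hσ0 (Real.sq_sqrt hσpos.le).symm
    (n * C - sn * Real.sqrt V * r - K₁)
  have hBEerr : 40 * b / σ ≤ B₁ / sn := by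
    calc 40 * b / σ ≤ 40 * b / (sn * Real.sqrt (V / 2)) := by gcongr
      _ = B₁ / sn := by rw [hB₁]; field_simp
  have hdiff : |σ - sn * Real.sqrt V| ≤ K / Real.sqrt V := by
    have := abs_sqrt_sub_sqrt_le hσpos.le (by rw [hn]; positivity : 0 < n * V) hvar
    rw [hsV] at this
    refine this.trans ?_
    gcongr
    exact le_mul_of_one_le_left hVs.le hn1
  have harg : r + A' / sn ≤ (μ - (n * C - sn * Real.sqrt V * r - K₁)) / σ := by
    rw [le_div_iff₀ hσ0]
    have h1 : r * (σ - sn * Real.sqrt V) ≤ |r| * (K / Real.sqrt V) := by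
      refine (le_abs_self _).trans ?_
      rw [abs_mul]
      exact mul_le_mul_of_nonneg_left hdiff (abs_nonneg r)
    have h5 : A' / sn * σ ≤ A' * Real.sqrt (2 * V) := by
      calc A' / sn * σ ≤ A' / sn * (sn * Real.sqrt (2 * V)) := by gcongr
        _ = _ := by field_simp
    rw [hmean, add_mul, hK₁, mul_div_assoc]
    linarith [mul_sub r σ (sn * Real.sqrt V), mul_comm r (sn * Real.sqrt V)]
  have hQ := gaussianQ_anti harg
  have hA1 : A' / sn ≤ 1 := by rw [div_le_one hsn0]; exact hnA
  have hs := (hslope (A' / sn) (by positivity) hA1).2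
  have hκA : κ * (A' / sn) = A / sn + B₁ / sn := by rw [hA']; field_simp
  linarith [(abs_le.1 hBE).2]

/-! ### Memoryless extensions and the converse -/

lemma sum_prod_pair {Y Z : Type*} [Fintype Y] [Fintype Z] {n : ℕ} (g : Fin n → Y × Z → ℝ) :
    ∑ p : (Fin n → Y) × (Fin n → Z), ∏ k, g k (p.1 k, p.2 k) = ∏ k, ∑ q, g k q := by
  rw [Fintype.prod_sum]
  exact Fintype.sum_equiv (Equiv.arrowProdEquivProdArrow (Fin n) (fun _ => Y) (fun _ => Z)).symm _ _
    fun p => rfl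

section Memoryless
variable {X Y Z : Type*} [Fintype X] [Fintype Y] [Fintype Z]
  {W : X → Y × Z → ℝ} (hW : ∀ x, W x ∈ stdSimplex ℝ (Y × Z))
  {f : X → Y} (hWf : IsSemiDeterministic W f)
include hW

lemma memoryless_mem (n : ℕ) (x : Fin n → X) :
    memoryless W n x ∈ stdSimplex ℝ ((Fin n → Y) × (Fin n → Z)) :=
  ⟨fun p => prod_nonneg fun k _ => (hW _).1 _, by
    simp only [memoryless]
    rw [sum_prod_pair fun k q => W (x k) q]
    exact prod_eq_one fun k _ => (hW _).2⟩

include hWf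

lemma memoryless_eq_zero (n : ℕ) (x : Fin n → X) (y : Fin n → Y) (z : Fin n → Z)
    (h : y ≠ fun k => f (x k)) : memoryless W n x (y, z) = 0 := by
  obtain ⟨k, hk⟩ := Function.ne_iff.1 h
  exact prod_eq_zero (mem_univ k) (eq_zero_of_ne hW hWf _ _ _ hk)

open Classical in
lemma sum_comp_eq_type {n : ℕ} (x : Fin n → X) (hn : 0 < n) (g : X → ℝ) :
    ∑ k, g (x k) = n * ∑ a, ((univ.filter fun k => x k = a).card : ℝ) / n * g a := by
  have hn' : (n : ℝ) ≠ 0 := by positivity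
  rw [mul_sum, ← sum_fiberwise univ x fun k => g (x k)]
  refine sum_congr rfl fun a _ => ?_
  rw [sum_congr rfl fun k hk => by rw [(mem_filter.1 hk).2], sum_const, nsmul_eq_mul]
  field_simp

open Classical in
/-- The converse: an upper bound on the size of secrecy codes. -/
theorem eventually_log_size_le {Pstar : X → ℝ} (hmem : Pstar ∈ stdSimplex ℝ X)
    (huniq : ∀ P ∈ stdSimplex ℝ X,
      condEntropyFstGivenSnd (outDist W P) = secrecyCapacity W ↔ P = Pstar)
    (hV : 0 < secrecyDispersion W Pstar) {ε δ r : ℝ} (hε : ε < 1)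
    (hr : gaussianQ r = δ / (1 - ε)) :
    ∃ K : ℝ, ∀ᶠ n : ℕ in atTop, ∀ M ∈ codeSizes .avg W n ε δ,
      Real.log M ≤ n * secrecyCapacity W - Real.sqrt (n * secrecyDispersion W Pstar) * r
        + K * Real.log n := by
  have hX : Nonempty X := by
    by_contra h
    rw [not_nonempty_iff] at h
    have := hmem.2
    simp at this
  obtain ⟨Q₀, hQ₀, hQ₁, hQ₂, hQ₃⟩ := exists_saddle hW hWf
  obtain ⟨b, c, K, hb, hc, hK, hest⟩ := exists_converse_estimate hW hWf
    (⟨hQ₀, hQ₁, hQ₂, hQ₃⟩ : IsSaddle W f Q₀) hmem huniq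
  choose Qf hQf0 hQf1 hQf using hest
  have hε' : 0 < 1 - ε := by linarith
  -- The margin `1 / (1 - ε)` is chosen so that, after multiplication by `1 - ε`, the test succeeds
  -- with probability at least `δ + 1 / √n`; the surplus `1 / √n` then bounds the code size.
  obtain ⟨K₁, hK₁, hev⟩ := eventually_le_prodExp (Z := Z) (r := r) (A := 1 / (1 - ε)) hV hc hK hb
    (by positivity)
  set C := secrecyCapacity W with hC
  set V := secrecyDispersion W Pstar with hVdef
  refine ⟨K₁ + 1 + 2 * Fintype.card X, ?_⟩
  filter_upwards [hev, eventually_ge_atTop 3] with n hn hn3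
  rintro M ⟨code, hcode⟩
  have hM : (0 : ℝ) < M := by exact_mod_cast code.size_pos
  have hn0 : 0 < n := by omega
  have hnR : (0 : ℝ) < n := by exact_mod_cast hn0
  have hnR3 : (3 : ℝ) ≤ n := by exact_mod_cast hn3
  set t := n * C - Real.sqrt (n * V) * r + K₁ with ht
  set N : ℝ := ((n : ℝ) + 1) ^ Fintype.card X with hN
  have hN0 : 0 < N := by positivity
  -- One memoryless estimate per vector of letter counts. Given an input, the uniform mixture is at
  -- least `1 / N` times the estimate tuned to its type, and `log N` is of order `log n`.
  set Qc : (X → Fin (n + 1)) → Z → Y → ℝ := fun cnt => Qf fun a => ((cnt a : ℕ) : ℝ) / n with hQc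
  set Qmix : (Fin n → Z) → (Fin n → Y) → ℝ :=
    fun z y => (1 / N) * ∑ cnt : X → Fin (n + 1), ∏ k, Qc cnt (z k) (y k) with hQmix
  have hprod0 : ∀ (cnt : X → Fin (n + 1)) (z : Fin n → Z) (y : Fin n → Y),
      0 ≤ ∏ k, Qc cnt (z k) (y k) := fun cnt z y => prod_nonneg fun k _ => hQf0 _ _ _
  have hmix1 : ∀ z, ∑ y, Qmix z y ≤ 1 := fun z => by
    simp only [hQmix, ← mul_sum]
    rw [sum_comm]
    have h1 : ∀ cnt : X → Fin (n + 1), ∑ y : Fin n → Y, ∏ k, Qc cnt (z k) (y k) ≤ 1 := fun cnt => by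
      rw [← Fintype.prod_sum fun k y => Qc cnt (z k) y]
      exact prod_le_one (fun k _ => sum_nonneg fun y _ => hQf0 _ _ _) fun k _ => hQf1 _ _
    have h2 : ∑ cnt : X → Fin (n + 1), ∑ y : Fin n → Y, ∏ k, Qc cnt (z k) (y k) ≤ N := by
      refine (sum_le_sum fun cnt _ => h1 cnt).trans (le_of_eq ?_)
      simp [hN]
    rw [one_div, inv_mul_le_iff₀ hN0, mul_one]
    exact h2
  have hp : ∀ x : Fin n → X, gaussianQ r + 1 / (1 - ε) / Real.sqrt n ≤
      ∑ z, if Real.exp (-t) / N ≤ Qmix z (fun k => f (x k)) then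
        memoryless W n x (fun k => f (x k), z) else 0 := by
    intro x
    set cnt : X → Fin (n + 1) := fun a => ⟨(univ.filter fun k => x k = a).card,
      Nat.lt_succ_of_le ((card_le_univ _).trans (by simp))⟩ with hcnt
    set P : X → ℝ := fun a => ((cnt a : ℕ) : ℝ) / n with hP
    have hPm : P ∈ stdSimplex ℝ X := by
      refine ⟨fun a => by positivity, ?_⟩
      have := sum_comp_eq_type hW hWf x hn0 fun _ => 1
      simp only [mul_one, sum_const, card_univ, Fintype.card_fin, nsmul_eq_mul] at this
      exact (mul_left_cancel₀ hnR.ne' (by rw [mul_one]; exact this)).symm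
    obtain ⟨hpos, hbd, ρ, hρ, hmean, hvar⟩ := hQf P hPm
    have hmain := hn (fun k => eveKernel W f (x k)) (fun k z => -Real.log (Qf P z (f (x k)))) C ρ
      (fun k => eveKernel_mem hW hWf _) (fun k z => by rw [abs_neg]; exact hbd _ _) hρ
      (by
        have := sum_comp_eq_type hW hWf x hn0 fun a => logLoss W f (Qf P) a
        refine le_trans (le_of_eq this) ?_
        exact mul_le_mul_of_nonneg_left hmean hnR.le)
      (by
        have := sum_comp_eq_type hW hWf x hn0 fun a => lossVar W f (Qf P) a
        simp only [neg_sq]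
        rw [show ∑ k, (∑ z, eveKernel W f (x k) z * Real.log (Qf P z (f (x k))) ^ 2 -
          (∑ z, eveKernel W f (x k) z * -Real.log (Qf P z (f (x k)))) ^ 2)
          = ∑ k, lossVar W f (Qf P) (x k) from rfl, this, ← mul_sub, abs_mul,
          abs_of_pos hnR]
        exact mul_le_mul_of_nonneg_left hvar hnR.le)
    refine hmain.trans (sum_le_sum fun z _ => ?_)
    have hmem0 : memoryless W n x (fun k => f (x k), z) = ∏ k, eveKernel W f (x k) (z k) := rfl
    rw [hmem0]
    change (∏ k, eveKernel W f (x k) (z k)) *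
      (if ∑ k, -Real.log (Qf P (z k) (f (x k))) ≤ t then (1 : ℝ) else 0) ≤ _
    have hprodκ : 0 ≤ ∏ k, eveKernel W f (x k) (z k) :=
      prod_nonneg fun k _ => (eveKernel_mem hW hWf _).1 _
    by_cases hz : ∑ k, -Real.log (Qf P (z k) (f (x k))) ≤ t
    · rw [if_pos hz, mul_one]
      rcases hprodκ.eq_or_lt with h0 | h0
      · rw [← h0]; split_ifs <;> exact le_rfl
      · have hκk : ∀ k, 0 < eveKernel W f (x k) (z k) := fun k =>
          ((eveKernel_mem hW hWf _).1 _).lt_of_ne fun h => h0.ne' (prod_eq_zero (mem_univ k) h.symm)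
        have hQk : ∀ k, 0 < Qf P (z k) (f (x k)) := fun k => hpos _ _ (hκk k)
        rw [if_pos]
        have h1 : Real.exp (-t) ≤ ∏ k, Qc cnt (z k) (f (x k)) := by
          rw [← Real.le_log_iff_exp_le (prod_pos fun k _ => hQk k),
            Real.log_prod fun k _ => (hQk k).ne']
          simp only [sum_neg_distrib] at hz
          have : ∑ k, Real.log (Qc cnt (z k) (f (x k)))
            = ∑ k, Real.log (Qf P (z k) (f (x k))) := rfl
          linarith
        have h2 : ∏ k, Qc cnt (z k) (f (x k))
            ≤ ∑ cnt : X → Fin (n + 1), ∏ k, Qc cnt (z k) (f (x k)) :=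
          single_le_sum (f := fun cnt => ∏ k, Qc cnt (z k) (f (x k)))
            (fun cnt _ => hprod0 cnt z _) (mem_univ cnt)
        simp only [hQmix]
        rw [div_eq_inv_mul, one_div]
        exact mul_le_mul_of_nonneg_left (h1.trans h2) (inv_pos.2 hN0).le
    · rw [if_neg hz, mul_zero]
      split_ifs
      · exact hprodκ
      · exact le_rfl
  have hone := SecrecyCode.one_shot_converse (memoryless_mem hW n)
    (F := fun x k => f (x k)) (memoryless_eq_zero hW hWf n) code
    (lam := Real.exp (-t) / N) (by positivity)
    (add_nonneg (gaussianQ_nonneg r) (by positivity)) hcode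
    (fun z y => mul_nonneg (by positivity) (sum_nonneg fun cnt _ => hprod0 cnt z y)) hmix1 hp
  set sn := Real.sqrt n with hsn
  have hsn0 : 0 < sn := Real.sqrt_pos.2 hnR
  have h1 : (gaussianQ r + 1 / (1 - ε) / sn) * (1 - ε) = δ + 1 / sn := by
    rw [hr]; field_simp
  rw [h1] at hone
  have h2 : 1 / sn ≤ 1 / (M * (Real.exp (-t) / N)) := by linarith
  have h3 : M * (Real.exp (-t) / N) ≤ sn := by
    rwa [one_div_le_one_div hsn0 (by positivity)] at h2
  have h4 : (M : ℝ) ≤ sn * N * Real.exp t := by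
    rw [Real.exp_neg] at h3
    have : M * ((Real.exp t)⁻¹ / N) * (N * Real.exp t) = M := by
      field_simp
    calc (M : ℝ) = M * ((Real.exp t)⁻¹ / N) * (N * Real.exp t) := this.symm
      _ ≤ sn * (N * Real.exp t) := by gcongr
      _ = _ := by ring
  have h5 := Real.log_le_log hM h4
  rw [Real.log_mul (by positivity) (by positivity), Real.log_mul (by positivity) (by positivity),
    Real.log_exp, hN, Real.log_pow, hsn, Real.log_sqrt hnR.le] at h5
  have hlog1 : 1 ≤ Real.log n := by
    rw [Real.le_log_iff_exp_le hnR]; linarith [Real.exp_one_lt_three]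
  have hlog2 : Real.log ((n : ℝ) + 1) ≤ 2 * Real.log n := by
    have : Real.log ((n : ℝ) + 1) ≤ Real.log ((n : ℝ) ^ 2) :=
      Real.log_le_log (by positivity) (by nlinarith)
    rwa [Real.log_pow] at this
  have h6 : (Fintype.card X : ℝ) * Real.log ((n : ℝ) + 1)
      ≤ Fintype.card X * (2 * Real.log n) := by gcongr
  have h7 : K₁ ≤ K₁ * Real.log n := le_mul_of_one_le_right hK₁ hlog1
  rw [ht] at h5
  linarith

end Memoryless

/-! ### Type classes -/

open Classical in
lemma exists_forall_card_fiber_eq {Y : Type*} [Fintype Y] {n : ℕ} (c : Y → ℕ)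
    (hc : ∑ y, c y = n) :
    ∃ y : Fin n → Y, ∀ b, (univ.filter fun k => y k = b).card = c b := by
  have e : Fin n ≃ Σ b, Fin (c b) := Fintype.equivOfCardEq (by simp [hc])
  refine ⟨fun k => (e k).1, fun b => ?_⟩
  rw [← Fintype.card_subtype, ← Fintype.card_fin (c b)]
  exact Fintype.card_congr ((e.subtypeEquiv (q := fun s => s.1 = b) fun k => Iff.rfl).trans
    (Equiv.sigmaSubtype b))

-- Orbit–stabiliser: permuting the positions of one sequence yields sequences of the same type, and
-- each is reached by at most as many permutations as fix that sequence.
open Classical in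
lemma factorial_le_card_type_mul {Y : Type*} [Fintype Y] {n : ℕ} (c : Y → ℕ)
    (hc : ∑ y, c y = n) :
    n.factorial ≤ Fintype.card {y : Fin n → Y // ∀ b, (univ.filter fun k => y k = b).card = c b}
      * ∏ b, (c b).factorial := by
  obtain ⟨y, hy⟩ := exists_forall_card_fiber_eq c hc
  let F : Equiv.Perm (Fin n) → {y : Fin n → Y // ∀ b, (univ.filter fun k => y k = b).card = c b} :=
    fun σ => ⟨y ∘ σ, fun b => by
      rw [← hy b]
      exact card_equiv σ fun k => by simp⟩
  have h := card_le_mul_card_image (f := F) univ (∏ b, (c b).factorial) fun t ht => by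
    obtain ⟨σ, -, rfl⟩ := mem_image.1 ht
    have hst := DomMulAct.stabilizer_card y
    simp only [Fintype.card_subtype, hy] at hst
    rw [← hst]
    refine card_le_card_of_injOn (fun τ => τ * σ⁻¹) (fun τ hτ => ?_)
      (mul_left_injective σ⁻¹).injOn
    have h1 : y ∘ τ = y ∘ σ := Subtype.ext_iff.1 (mem_filter.1 (Finset.mem_coe.1 hτ)).2
    simp only [coe_filter, mem_univ, true_and, Set.mem_ofPred_eq, Equiv.Perm.coe_mul,
      ← Function.comp_assoc, h1]
    rw [Function.comp_assoc, ← Equiv.Perm.coe_mul, mul_inv_cancel, Equiv.Perm.coe_one,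
      Function.comp_id]
  rw [card_univ, Fintype.card_perm, Fintype.card_fin] at h
  rw [mul_comm]
  exact h.trans (Nat.mul_le_mul_left _ (card_le_univ _))

/-- Stirling's sequence decreases, so its value at `1` gives an upper bound valid for every positive
argument. -/
lemma log_factorial_le {c : ℕ} (hc : 0 < c) :
    Real.log c.factorial ≤ c * Real.log c - c + 1 + Real.log c := by
  obtain ⟨k, rfl⟩ := Nat.exists_eq_succ_of_ne_zero hc.ne'
  have h := Stirling.log_stirlingSeq'_antitone (Nat.zero_le k)
  simp only [Function.comp_apply, Stirling.log_stirlingSeq_formula] at h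
  have hk : (0 : ℝ) < (k.succ : ℕ) := by positivity
  have hl : 0 ≤ Real.log ((k.succ : ℕ) : ℝ) := Real.log_natCast_nonneg _
  rw [Real.log_mul two_ne_zero hk.ne', Real.log_div hk.ne' (Real.exp_ne_zero _), Real.log_exp] at h
  norm_num at h
  push_cast at *
  nlinarith

lemma le_log_factorial (n : ℕ) : n * Real.log n - n ≤ Real.log n.factorial := by
  rcases Nat.eq_zero_or_pos n with rfl | hn
  · simp
  · have h := Stirling.le_log_factorial_stirling hn.ne'
    have h1 : 0 ≤ Real.log (n : ℝ) := Real.log_natCast_nonneg _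
    have h2 : 0 ≤ Real.log (2 * Real.pi) := Real.log_nonneg (by linarith [Real.pi_gt_three])
    linarith

open Classical in
lemma exists_counts {Y : Type*} [Fintype Y] {p : Y → ℝ} (hp : p ∈ stdSimplex ℝ Y) (n : ℕ) :
    ∃ c : Y → ℕ, ∑ y, c y = n ∧ (∀ y, p y = 0 → c y = 0) ∧
      ∀ y, |(c y : ℝ) - n * p y| ≤ Fintype.card Y := by
  obtain ⟨y₁, -, hy₁⟩ : ∃ y ∈ univ, p y ≠ 0 :=
    exists_ne_zero_of_sum_ne_zero (by rw [hp.2]; exact one_ne_zero)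
  have hnp : ∀ y, 0 ≤ n * p y := fun y => mul_nonneg n.cast_nonneg (hp.1 y)
  have hsum : ∑ y, n * p y = n := by rw [← mul_sum, hp.2, mul_one]
  have hle : ∀ y, (⌊n * p y⌋₊ : ℝ) ≤ n * p y := fun y => Nat.floor_le (hnp y)
  have hlt : ∀ y, n * p y ≤ (⌊n * p y⌋₊ : ℝ) + 1 := fun y => (Nat.lt_floor_add_one _).le
  have hfl : ∑ y, ⌊n * p y⌋₊ ≤ n := by
    have : (∑ y, (⌊n * p y⌋₊ : ℝ)) ≤ n := (sum_le_sum fun y _ => hle y).trans hsum.le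
    exact_mod_cast this
  obtain ⟨d, hd⟩ := Nat.exists_eq_add_of_le hfl
  have hdR : (n : ℝ) = ∑ y, (⌊n * p y⌋₊ : ℝ) + d := by exact_mod_cast hd
  have hdc : (d : ℝ) ≤ Fintype.card Y := by
    have := sum_le_sum fun y (_ : y ∈ univ) => hlt y
    rw [hsum, sum_add_distrib] at this
    simp only [sum_const, card_univ, nsmul_eq_mul, mul_one] at this
    linarith
  have hY : (1 : ℝ) ≤ Fintype.card Y := by exact_mod_cast Fintype.card_pos_iff.2 ⟨y₁⟩
  have hd0 : (0 : ℝ) ≤ d := d.cast_nonneg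
  -- Rounding down leaves at most `|Y|` positions unassigned; all go to one letter of positive
  -- probability, so the counts vanish wherever `p` does.
  refine ⟨fun y => ⌊n * p y⌋₊ + if y = y₁ then d else 0, ?_, fun y hy => ?_, fun y => ?_⟩
  · rw [sum_add_distrib, sum_ite_eq' univ y₁, if_pos (mem_univ _), ← hd]
  · have : y ≠ y₁ := by rintro rfl; exact hy₁ hy
    simp [hy, this]
  · have h1 := hle y
    have h2 := hlt y
    rw [abs_le]
    push_cast
    split_ifs <;> constructor <;> linarith

/-- A type close to `p` has probability at least polynomially small under `p`. -/
lemma exists_le_log_card_mul_prob {Y : Type*} [Fintype Y] {p : Y → ℝ}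
    (hp : p ∈ stdSimplex ℝ Y) : ∃ K : ℝ, 0 ≤ K ∧ ∀ (n : ℕ) (c : Y → ℕ) (N : ℕ), 0 < n →
      ∑ y, c y = n → (∀ y, p y = 0 → c y = 0) →
      (∀ y, |(c y : ℝ) - n * p y| ≤ Fintype.card Y) → n.factorial ≤ N * ∏ y, (c y).factorial →
      -(K * (1 + Real.log n)) ≤ Real.log (N * ∏ y, p y ^ c y) := by
  obtain ⟨k, hk⟩ : ∃ k : ℝ, k = (Fintype.card Y : ℝ) := ⟨_, rfl⟩
  have hk0 : 0 ≤ k := hk ▸ Nat.cast_nonneg _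
  rw [← hk]
  refine ⟨k + ∑ y, k / p y, add_nonneg (by positivity)
    (sum_nonneg fun y _ => div_nonneg (by positivity) (hp.1 y)), ?_⟩
  intro n c N hn hc hc0 hcp hN
  have hnR : (0 : ℝ) < n := by exact_mod_cast hn
  have hlogn : 0 ≤ Real.log (n : ℝ) := Real.log_natCast_nonneg _
  have hN0 : (N : ℝ) ≠ 0 := by
    rintro h
    rw [Nat.cast_eq_zero.1 h, zero_mul] at hN
    exact (Nat.factorial_pos n).not_ge hN
  have hpc : ∀ y, p y ^ c y ≠ 0 := fun y h => by
    obtain ⟨h1, h2⟩ := pow_eq_zero_iff'.1 h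
    exact h2 (hc0 y h1)
  have hf : ∀ y, (((c y).factorial : ℕ) : ℝ) ≠ 0 := fun y => by positivity
  have h1 : Real.log n.factorial ≤ Real.log N + ∑ y, Real.log (c y).factorial := by
    rw [← Real.log_prod fun y _ => hf y, ← Real.log_mul hN0 (prod_ne_zero_iff.2 fun y _ => hf y)]
    exact Real.log_le_log (by positivity) (by exact_mod_cast hN)
  -- Stirling's bound and `log u ≤ u - 1` at `u = c y / (n * p y)`. Letters of probability zero have
  -- count zero, and there `k / p y` is the default value `0`. Summed over `y`, the terms `n * log n
  -- - n` cancel against those of `log n!`.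
  have h2 : ∀ y, Real.log (c y).factorial - c y * Real.log (p y)
      ≤ c y * Real.log n - c y + (1 + Real.log n) + k / p y := by
    intro y
    rcases Nat.eq_zero_or_pos (c y) with h | h
    · have : 0 ≤ k / p y := div_nonneg (by positivity) (hp.1 y)
      simp only [h]; simp; linarith
    · have hcR : (0 : ℝ) < c y := by exact_mod_cast h
      have hpy : 0 < p y := (hp.1 y).lt_of_ne fun h' => h.ne' (hc0 y h'.symm)
      have hcn : (c y : ℝ) ≤ n := by
        rw [← hc]; exact_mod_cast single_le_sum (f := c) (fun _ _ => Nat.zero_le _) (mem_univ y)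
      have h3 := log_factorial_le h
      have h4 : Real.log (c y) ≤ Real.log n := Real.log_le_log hcR hcn
      have h5 := Real.log_le_sub_one_of_pos (x := c y / (n * p y)) (by positivity)
      rw [Real.log_div hcR.ne' (by positivity), Real.log_mul hnR.ne' hpy.ne'] at h5
      have h6 : c y / (n * p y) - 1 ≤ k / (n * p y) := by
        rw [div_sub_one (by positivity)]
        exact div_le_div_of_nonneg_right ((le_abs_self _).trans (hcp y)) (by positivity)
      have h7 := mul_le_mul_of_nonneg_left (h5.trans h6) hcR.le
      have h8 : c y * (k / (n * p y)) ≤ n * (k / (n * p y)) := by gcongr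
      have h9 : n * (k / (n * p y)) = k / p y := by field_simp
      nlinarith
  have h3 := sum_le_sum fun y (_ : y ∈ univ) => h2 y
  have hcR : ∑ y, (c y : ℝ) = n := by exact_mod_cast hc
  simp only [sum_sub_distrib, sum_add_distrib, ← sum_mul, hcR, sum_const, card_univ,
    nsmul_eq_mul] at h3
  rw [Real.log_mul hN0 (prod_ne_zero_iff.2 fun y _ => hpc y), Real.log_prod fun y _ => hpc y]
  simp only [Real.log_pow]
  have h4 := le_log_factorial n
  have h5 : 0 ≤ (∑ y, k / p y) * Real.log n :=
    mul_nonneg (sum_nonneg fun y _ => div_nonneg (by positivity) (hp.1 y)) hlogn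
  rw [← hk] at h3
  linarith

/-! ### Achievability -/

section Achievability
variable {X Y Z : Type*} [Fintype X] [Fintype Y] [Fintype Z]

lemma outDist_memoryless_prod (W : X → Y × Z → ℝ) {n : ℕ} (S : Fin n → X → ℝ) (y : Fin n → Y)
    (z : Fin n → Z) : outDist (memoryless W n) (fun x => ∏ k, S k (x k)) (y, z)
      = ∏ k, outDist W (S k) (y k, z k) := by
  simp only [outDist, memoryless, Fintype.prod_sum, prod_mul_distrib]

open Classical in
/-- The conditional distribution of the channel input given the legitimate output `y`. -/
def inputGivenFst (W : X → Y × Z → ℝ) (f : X → Y) (P : X → ℝ) (y : Y) (x : X) : ℝ :=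
  (if f x = y then P x else 0) / marginalFst (outDist W P) y

variable {W : X → Y × Z → ℝ} (hW : ∀ x, W x ∈ stdSimplex ℝ (Y × Z))
  {f : X → Y} (hWf : IsSemiDeterministic W f)

lemma condSndGivenFst_mem {P : Y × Z → ℝ} (hP : ∀ p, 0 ≤ P p) {y : Y} (hy : 0 < marginalFst P y) :
    condSndGivenFst P y ∈ stdSimplex ℝ Z :=
  ⟨fun z => div_nonneg (hP _) hy.le, by
    simp only [condSndGivenFst, ← sum_div]
    exact div_self hy.ne'⟩

include hW hWf

lemma inputGivenFst_mem {P : X → ℝ} (hP : P ∈ stdSimplex ℝ X) {y : Y}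
    (hy : 0 < marginalFst (outDist W P) y) : inputGivenFst W f P y ∈ stdSimplex ℝ X := by
  refine ⟨fun x => div_nonneg ?_ hy.le, ?_⟩
  · split_ifs
    · exact hP.1 x
    · exact le_rfl
  · simp only [inputGivenFst, ← sum_div]
    rw [← marginalFst_joint hW hWf, div_self hy.ne']

open Classical in
lemma outDist_inputGivenFst (P : X → ℝ) (y b : Y) (z : Z) :
    outDist W (inputGivenFst W f P y) (b, z)
      = if b = y then condSndGivenFst (outDist W P) y z else 0 := by
  simp only [outDist, inputGivenFst, condSndGivenFst, div_mul_eq_mul_div, ← sum_div]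
  split_ifs with h
  · subst h
    congr 1
    refine sum_congr rfl fun x _ => ?_
    split_ifs with hx
    · rfl
    · rw [eq_zero_of_ne hW hWf x b z (Ne.symm hx), mul_zero, mul_zero]
  · rw [sum_eq_zero, zero_div]
    intro x _
    split_ifs with hx
    · rw [eq_zero_of_ne hW hWf x b z (fun h' => h (h'.trans hx)), mul_zero]
    · rw [zero_mul]

lemma marginalFst_memoryless_inputGivenFst (P : X → ℝ) {n : ℕ} (y b : Fin n → Y) (h : b ≠ y) :
    marginalFst (outDist (memoryless W n) fun x => ∏ k, inputGivenFst W f P (y k) (x k)) b = 0 := by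
  obtain ⟨k, hk⟩ := Function.ne_iff.1 h
  refine sum_eq_zero fun z _ => ?_
  rw [outDist_memoryless_prod]
  refine prod_eq_zero (mem_univ k) ?_
  rw [outDist_inputGivenFst hW hWf, if_neg hk]

lemma marginalSnd_memoryless_inputGivenFst (P : X → ℝ) {n : ℕ} (y : Fin n → Y) (z : Fin n → Z) :
    marginalSnd (outDist (memoryless W n) fun x => ∏ k, inputGivenFst W f P (y k) (x k)) z
      = ∏ k, condSndGivenFst (outDist W P) (y k) (z k) := by
  classical
  simp only [marginalSnd, outDist_memoryless_prod]
  rw [← Fintype.prod_sum fun k b => outDist W (inputGivenFst W f P (y k)) (b, z k)]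
  refine prod_congr rfl fun k _ => ?_
  simp [outDist_inputGivenFst hW hWf]

variable {Q : Z → Y → ℝ} (hQ : IsSaddle W f Q) {Pstar : X → ℝ} (hmem : Pstar ∈ stdSimplex ℝ X)
  (hopt : condEntropyFstGivenSnd (outDist W Pstar) = secrecyCapacity W)
include hQ hmem hopt

/-- Above the threshold, the conditional law of the eavesdropper's output is dominated by the
unconditional one. -/
lemma prod_condSndGivenFst_le {n : ℕ} {y : Fin n → Y}
    (hy : ∀ k, 0 < marginalFst (outDist W Pstar) (y k)) (z : Fin n → Z) {s : ℝ}
    (hs : s < ∑ k, -Real.log (Q (z k) (y k))) :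
    ∏ k, condSndGivenFst (outDist W Pstar) (y k) (z k)
      ≤ Real.exp (-s) / (∏ k, marginalFst (outDist W Pstar) (y k))
        * ∏ k, marginalSnd (outDist W Pstar) (z k) := by
  have hJ := outDist_mem hW hmem
  have hR : 0 ≤ ∏ k, marginalSnd (outDist W Pstar) (z k) :=
    prod_nonneg fun k _ => (marginalSnd_mem hJ).1 _
  have hpi : 0 < ∏ k, marginalFst (outDist W Pstar) (y k) := prod_pos fun k _ => hy k
  by_cases h0 : ∃ k, outDist W Pstar (y k, z k) = 0
  · obtain ⟨k, hk⟩ := h0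
    rw [prod_eq_zero (mem_univ k) (by rw [condSndGivenFst, hk, zero_div])]
    positivity
  · push Not at h0
    have hQk : ∀ k, 0 < Q (z k) (y k) := fun k =>
      pos_of_joint_pos hW hWf hQ.pos _ _ ((hJ.1 _).lt_of_ne (h0 k).symm)
    have h1 : ∀ k, condSndGivenFst (outDist W Pstar) (y k) (z k)
        = marginalSnd (outDist W Pstar) (z k) * Q (z k) (y k)
          / marginalFst (outDist W Pstar) (y k) := fun k => by
      rw [condSndGivenFst, sub_eq_zero.1 (condDefect_optimal hW hWf hQ hmem hopt (y k) (z k))]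
    simp only [h1, prod_div_distrib, prod_mul_distrib]
    rw [div_mul_eq_mul_div, mul_comm]
    refine div_le_div_of_nonneg_right (mul_le_mul_of_nonneg_right ?_ hR) hpi.le
    rw [← Real.log_le_iff_le_exp (prod_pos fun k _ => hQk k), Real.log_prod fun k _ => (hQk k).ne']
    rw [sum_neg_distrib] at hs
    linarith

open Classical in
/-- The atypical mass of the eavesdropper's output, for legitimate outputs of a type close to the
optimal one. -/
lemma eventually_atypical_le {r A : ℝ} (hV : 0 < secrecyDispersion W Pstar) (hA : 0 ≤ A) :
    ∃ K₁ : ℝ, 0 ≤ K₁ ∧ ∀ᶠ n : ℕ in atTop, ∀ y : Fin n → Y,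
      (∀ k, 0 < marginalFst (outDist W Pstar) (y k)) →
      (∀ a, |((univ.filter fun k => y k = a).card : ℝ) - n * marginalFst (outDist W Pstar) a|
        ≤ Fintype.card Y) →
      (∑ z : Fin n → Z, if ∏ k, condSndGivenFst (outDist W Pstar) (y k) (z k) ≤
          Real.exp (-(n * secrecyCapacity W - Real.sqrt (n * secrecyDispersion W Pstar) * r - K₁))
            / (∏ k, marginalFst (outDist W Pstar) (y k))
            * ∏ k, marginalSnd (outDist W Pstar) (z k) then 0
        else ∏ k, condSndGivenFst (outDist W Pstar) (y k) (z k)) ≤ gaussianQ r - A / Real.sqrt n := by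
  set C := secrecyCapacity W with hC
  set p := marginalFst (outDist W Pstar) with hp
  set κ := condSndGivenFst (outDist W Pstar) with hκ
  have hJ := outDist_mem hW hmem
  -- The dispersion is the mean of `v` under the optimal output law, so a type with counts within
  -- `|Y|` of `n * p` has total variance within a constant of `n * V`; the mean is exactly `n * C`.
  set v : Y → ℝ := fun y => (∑ z, κ y z * Real.log (Q z y) ^ 2) - C ^ 2 with hv
  obtain ⟨K₁, hK₁, hev⟩ := eventually_prodExp_le (Z := Z) (r := r) (A := A)
    (K := ∑ y, Fintype.card Y * |v y|) (b := 1 + ∑ z, ∑ y, |Real.log (Q z y)|) hV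
    (by positivity) (by positivity) hA
  refine ⟨K₁, hK₁, ?_⟩
  filter_upwards [hev] with n hn y hy hcount
  have hκm : ∀ k, κ (y k) ∈ stdSimplex ℝ Z := fun k => condSndGivenFst_mem hJ.1 (hy k)
  have hmean : ∀ k, ∑ z, κ (y k) z * -Real.log (Q z (y k)) = C := fun k =>
    cond_logLoss_optimal hW hWf hQ hmem hopt (hy k)
  have hmain := hn (fun k => κ (y k)) (fun k z => -Real.log (Q z (y k))) C hκm
    (fun k z => by
      rw [abs_neg]
      have h1 : |Real.log (Q z (y k))| ≤ ∑ y, |Real.log (Q z y)| :=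
        single_le_sum (f := fun y => |Real.log (Q z y)|) (fun _ _ => abs_nonneg _) (mem_univ _)
      have h2 : ∑ y, |Real.log (Q z y)| ≤ ∑ z, ∑ y, |Real.log (Q z y)| :=
        single_le_sum (f := fun z => ∑ y, |Real.log (Q z y)|)
          (fun _ _ => sum_nonneg fun _ _ => abs_nonneg _) (mem_univ z)
      linarith)
    (by simp only [hmean]; simp)
    (by
      simp only [hmean, neg_sq]
      rw [dispersion_eq_sum_fst hW hWf hQ hmem hopt,
        ← sum_fiberwise univ y fun k => ∑ a, κ (y k) a * Real.log (Q a (y k)) ^ 2 - C ^ 2,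
        mul_sum, ← sum_sub_distrib]
      refine (abs_sum_le_sum_abs _ _).trans (sum_le_sum fun a _ => ?_)
      rw [sum_congr rfl fun k hk => by rw [(mem_filter.1 hk).2], sum_const, nsmul_eq_mul,
        ← mul_assoc, ← sub_mul, abs_mul]
      exact mul_le_mul_of_nonneg_right (hcount a) (abs_nonneg _))
  refine le_trans (sum_le_sum fun z _ => ?_) hmain
  have hprod : 0 ≤ ∏ k, κ (y k) (z k) := prod_nonneg fun k _ => (hκm k).1 _
  change _ ≤ (∏ k, κ (y k) (z k)) * (if ∑ k, -Real.log (Q (z k) (y k)) ≤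
    n * C - Real.sqrt (n * secrecyDispersion W Pstar) * r - K₁ then (1 : ℝ) else 0)
  by_cases hz : ∑ k, -Real.log (Q (z k) (y k)) ≤
    n * C - Real.sqrt (n * secrecyDispersion W Pstar) * r - K₁
  · rw [if_pos hz, mul_one]
    split_ifs
    · exact hprod
    · exact le_rfl
  · rw [if_neg hz, mul_zero, if_pos]
    exact prod_condSndGivenFst_le hW hWf hQ hmem hopt hy z (not_le.1 hz)

end Achievability

lemma SecrecyCode.exists_trivial {A B C : Type*} [Fintype A] [Fintype B] [Fintype C] [Nonempty A]
    (K : A → B × C → ℝ) {ε δ : ℝ} (hε : 0 ≤ ε) (hδ : 0 ≤ δ) :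
    ∃ c : SecrecyCode A B 1, IsSecrecyCode .max K ε δ c := by
  classical
  obtain ⟨a⟩ := ‹Nonempty A›
  refine ⟨⟨fun _ => 1, ⟨fun _ => zero_le_one, by simp⟩, fun _ => Pi.single a 1,
    fun _ => single_mem_stdSimplex ℝ a, fun _ => 0⟩, fun m => ?_, fun m => ?_⟩
  · refine le_trans (le_of_eq (sum_eq_zero fun b _ => if_neg ?_)) hε
    simpa using Subsingleton.elim 0 m
  · refine le_trans (le_of_eq ?_) hδ
    simp [SecrecyCode.secrecyGivenMsg, SecrecyCode.eveGivenMsg, tvDist, outDist]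

section Achievability
variable {X Y Z : Type*} [Fintype X] [Fintype Y] [Fintype Z]
  {W : X → Y × Z → ℝ} (hW : ∀ x, W x ∈ stdSimplex ℝ (Y × Z))
  {f : X → Y} (hWf : IsSemiDeterministic W f)

lemma one_mem_codeSizes [Nonempty X] (W : X → Y × Z → ℝ) (n : ℕ) {ε δ : ℝ} (hε : 0 ≤ ε)
    (hδ : 0 ≤ δ) : 1 ∈ codeSizes .max W n ε δ :=
  SecrecyCode.exists_trivial _ hε hδ

include hW

lemma prod_marginalSnd_mem {P : X → ℝ} (hP : P ∈ stdSimplex ℝ X) (n : ℕ) :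
    (fun z : Fin n → Z => ∏ k, marginalSnd (outDist W P) (z k)) ∈ stdSimplex ℝ (Fin n → Z) :=
  have h := marginalSnd_mem (outDist_mem hW hP)
  ⟨fun _ => prod_nonneg fun _ _ => h.1 _, sum_prod_weight fun _ => h⟩

include hWf

open Classical in
/-- Achievability: a lower bound on the size of the best secrecy codes. -/
theorem eventually_exists_le_log_size {Pstar : X → ℝ} (hmem : Pstar ∈ stdSimplex ℝ X)
    (hopt : condEntropyFstGivenSnd (outDist W Pstar) = secrecyCapacity W)
    (hV : 0 < secrecyDispersion W Pstar) {ε δ r : ℝ} (hε0 : 0 ≤ ε) (hε : ε < 1) (hδ : 0 ≤ δ)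
    (hr : gaussianQ r = δ / (1 - ε)) :
    ∃ K : ℝ, ∀ᶠ n : ℕ in atTop, ∃ M ∈ codeSizes .max W n ε δ,
      n * secrecyCapacity W - Real.sqrt (n * secrecyDispersion W Pstar) * r - K * Real.log n
        ≤ Real.log M := by
  have hX : Nonempty X := by
    by_contra h
    rw [not_nonempty_iff] at h
    have := hmem.2
    simp at this
  obtain ⟨Q, hQ₀, hQ₁, hQ₂, hQ₃⟩ := exists_saddle hW hWf
  have hQ : IsSaddle W f Q := ⟨hQ₀, hQ₁, hQ₂, hQ₃⟩
  have hJ := outDist_mem hW hmem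
  have hpm := marginalFst_mem hJ
  set p := marginalFst (outDist W Pstar) with hp
  set κ := condSndGivenFst (outDist W Pstar) with hκ
  -- The margin `8` offsets the binning error `8 * ρ` with `ρ = 1 / √n`.
  obtain ⟨K₁, hK₁, hev⟩ := eventually_atypical_le hW hWf hQ hmem hopt (r := r) (A := 8) hV
    (by norm_num)
  obtain ⟨K₂, hK₂, htype⟩ := exists_le_log_card_mul_prob hpm
  have hq1 : 0 < 1 - gaussianQ r := by linarith [gaussianQ_lt_one r]
  set a := -Real.log (1 - gaussianQ r) with ha
  have ha0 : 0 ≤ a := by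
    rw [ha, neg_nonneg]
    exact Real.log_nonpos hq1.le (by linarith [gaussianQ_nonneg r])
  refine ⟨2 * K₂ + K₁ + a + 1 + Real.log 4, ?_⟩
  filter_upwards [hev, eventually_ge_atTop 16] with n hn hn16
  have hn0 : 0 < n := by omega
  have hnR16 : (16 : ℝ) ≤ n := by exact_mod_cast hn16
  have hnR : (0 : ℝ) < n := by linarith
  have hlog1 : 1 ≤ Real.log n := by
    rw [Real.le_log_iff_exp_le hnR]; linarith [Real.exp_one_lt_three]
  obtain ⟨c, hc, hc0, hcp⟩ := exists_counts hpm n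
  set T := {y : Fin n → Y // ∀ b, (univ.filter fun k => y k = b).card = c b} with hT
  have hfac := factorial_le_card_type_mul c hc
  have hNπ := htype n c (Fintype.card T) hn0 hc hc0 hcp hfac
  have hTne : Nonempty T := by
    obtain ⟨y, hy⟩ := exists_forall_card_fiber_eq c hc
    exact ⟨⟨y, hy⟩⟩
  have hypos : ∀ (y : T) k, 0 < p (y.1 k) := fun y k => by
    refine (hpm.1 _).lt_of_ne fun h => ?_
    have h1 := y.2 (y.1 k)
    rw [hc0 _ h.symm, card_eq_zero, filter_eq_empty_iff] at h1
    exact h1 (mem_univ k) rfl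
  set π : ℝ := ∏ b, p b ^ c b with hπ
  -- All sequences of one type are equally likely, so a single likelihood threshold serves the whole
  -- type class.
  have hπy : ∀ y : T, ∏ k, p (y.1 k) = π := fun y => by
    rw [← prod_fiberwise univ y.1 fun k => p (y.1 k), hπ]
    refine prod_congr rfl fun b _ => ?_
    rw [prod_congr rfl fun k hk => by rw [(mem_filter.1 hk).2], prod_const, y.2 b]
  have hπ0 : 0 < π := by
    obtain ⟨y⟩ := hTne
    rw [← hπy y]
    exact prod_pos fun k _ => hypos y k
  set s := n * secrecyCapacity W - Real.sqrt (n * secrecyDispersion W Pstar) * r - K₁ with hs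
  set γ₀ := Real.exp (-s) / π with hγ₀
  have hγ₀0 : 0 < γ₀ := by positivity
  have hRm := prod_marginalSnd_mem hW hmem n
  have hatyp : ∀ y : T, (∑ z : Fin n → Z,
      if ∏ k, κ (y.1 k) (z k) ≤ γ₀ * ∏ k, marginalSnd (outDist W Pstar) (z k) then 0
        else ∏ k, κ (y.1 k) (z k)) ≤ gaussianQ r - 8 / Real.sqrt n := fun y => by
    have := hn y.1 (hypos y) fun b => by rw [y.2 b]; exact hcp b
    rwa [hπy y] at this
  have hsn : 4 ≤ Real.sqrt n := Real.le_sqrt_of_sq_le (by linarith)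
  have hκm : ∀ (y : T) k, κ (y.1 k) ∈ stdSimplex ℝ Z := fun y k =>
    condSndGivenFst_mem hJ.1 (hypos y k)
  -- The typical part of each law has mass at most `γ₀` and the atypical part at most the Gaussian
  -- tail; together they have mass one.
  have hγ₀1 : 1 - gaussianQ r ≤ γ₀ := by
    obtain ⟨y⟩ := hTne
    have h1 : ∑ z : Fin n → Z, ∏ k, κ (y.1 k) (z k) = 1 := sum_prod_weight (hκm y)
    have h2 : ∑ z : Fin n → Z, ∏ k, κ (y.1 k) (z k) ≤ (∑ z : Fin n → Z,
      if ∏ k, κ (y.1 k) (z k) ≤ γ₀ * ∏ k, marginalSnd (outDist W Pstar) (z k) then 0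
        else ∏ k, κ (y.1 k) (z k)) +
        ∑ z : Fin n → Z, γ₀ * ∏ k, marginalSnd (outDist W Pstar) (z k) := by
      rw [← sum_add_distrib]
      refine sum_le_sum fun z _ => ?_
      have := mul_nonneg hγ₀0.le (hRm.1 z)
      split_ifs with h
      · rw [zero_add]; exact h
      · linarith
    rw [h1, ← mul_sum, hRm.2, mul_one] at h2
    have h3 : 0 ≤ 8 / Real.sqrt n := by positivity
    linarith [hatyp y]
  -- Rescaling secures `1 ≤ γ`, as binning requires, and lowers the logarithm of the code size only
  -- by the constant `a`.
  set γ := γ₀ / (1 - gaussianQ r) with hγ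
  have hγ1 : 1 ≤ γ := (one_le_div hq1).2 hγ₀1
  have hγ₀γ : γ₀ ≤ γ := le_div_self hγ₀0.le hq1 (by linarith [gaussianQ_nonneg r])
  have hγ0 : 0 < γ := hγ₀0.trans_le hγ₀γ
  set N : ℝ := (Fintype.card T : ℝ) with hN
  have hN0 : 0 < N := by
    rw [hN]; exact_mod_cast Fintype.card_pos
  -- The largest bin number compatible with `M * γ ≤ ρ ^ 2 * N` for `ρ = 1 / √n`. In `log L` the
  -- product `N * π` is the probability of the type class.
  set L := N / (n * γ) with hL
  have hL0 : 0 < L := by positivity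
  have hlogL : n * secrecyCapacity W - Real.sqrt (n * secrecyDispersion W Pstar) * r
      - (2 * K₂ + K₁ + a + 1) * Real.log n ≤ Real.log L := by
    have h1 : Real.log L = Real.log (N * π) + s - a - Real.log n := by
      have : L = N * π * Real.exp s * (1 - gaussianQ r) / n := by
        rw [hL, hγ, hγ₀, Real.exp_neg]; field_simp
      rw [this, Real.log_div (by positivity) hnR.ne', Real.log_mul (by positivity) hq1.ne',
        Real.log_mul (by positivity) (Real.exp_ne_zero _), Real.log_exp, ha]
      ring
    have h2 : K₂ * (1 + Real.log n) ≤ 2 * K₂ * Real.log n := by nlinarith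
    have h3 : K₁ ≤ K₁ * Real.log n := le_mul_of_one_le_right hK₁ hlog1
    have h4 : a ≤ a * Real.log n := le_mul_of_one_le_right ha0 hlog1
    rw [h1, hs]
    linarith
  have hlog4 : 0 ≤ Real.log 4 := Real.log_nonneg (by norm_num)
  have hlog4n : Real.log 4 ≤ Real.log 4 * Real.log n := le_mul_of_one_le_right hlog4 hlog1
  -- If `L < 1` the claimed lower bound is not positive, and the one-message code meets it.
  rcases lt_or_ge L 1 with hL1 | hL1
  · refine ⟨1, one_mem_codeSizes W n hε0 hδ, ?_⟩
    rw [Nat.cast_one, Real.log_one]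
    have := Real.log_nonpos hL0.le hL1.le
    linarith
  · have hM : 0 < ⌊L⌋₊ := Nat.floor_pos.2 hL1
    obtain ⟨M', code, hMM, herr, hsec⟩ := one_shot_achievability (K := memoryless W n)
      (S := fun (y : T) x => ∏ k, inputGivenFst W f Pstar (y.1 k) (x k))
      (fun y => ⟨fun x => prod_nonneg fun k _ => (inputGivenFst_mem hW hWf hmem (hypos y k)).1 _,
        sum_prod_weight fun k => inputGivenFst_mem hW hWf hmem (hypos y k)⟩)
      (i := Subtype.val) Subtype.val_injective
      (fun y b hb => marginalFst_memoryless_inputGivenFst hW hWf Pstar y.1 b hb)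
      (fun y => by
        rw [show marginalSnd (outDist (memoryless W n)
          fun x => ∏ k, inputGivenFst W f Pstar (y.1 k) (x k)) = fun z => ∏ k, κ (y.1 k) (z k) from
          funext fun z => marginalSnd_memoryless_inputGivenFst hW hWf Pstar y.1 z]
        exact ⟨fun z => prod_nonneg fun k _ => (hκm y k).1 _, sum_prod_weight (hκm y)⟩)
      hRm (γ := γ) (η := gaussianQ r - 8 / Real.sqrt n) (ρ := 1 / Real.sqrt n) hγ1
      (fun y => by
        refine le_trans (sum_le_sum fun z _ => ?_) (hatyp y)
        rw [marginalSnd_memoryless_inputGivenFst hW hWf]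
        have h1 : 0 ≤ ∏ k, κ (y.1 k) (z k) := prod_nonneg fun k _ => (hκm y k).1 _
        have h2 := mul_le_mul_of_nonneg_right hγ₀γ (hRm.1 z)
        split_ifs with h3 h4 h4
        · exact le_rfl
        · exact h1
        · exact absurd (h4.trans h2) h3
        · exact le_rfl)
      hM (by positivity)
      (by rw [div_le_div_iff_of_pos_left one_pos (by linarith) (by norm_num)]; exact hsn)
      (by
        rw [div_pow, one_pow, Real.sq_sqrt hnR.le]
        have := Nat.floor_le hL0.le
        calc (⌊L⌋₊ : ℝ) * γ ≤ L * γ := by gcongr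
          _ = _ := by rw [hL, ← hN]; field_simp)
    -- The errors cancel exactly, leaving `gaussianQ r = δ / (1 - ε)`; mixing with weight `ε` then
    -- reduces the distance to `δ`.
    have hsec' : ∀ m, code.secrecyGivenMsg (memoryless W n) m ≤ δ / (1 - ε) := fun m =>
      (hsec m).trans (le_of_eq (by rw [← hr]; ring))
    have hmix := code.exists_mix (memoryless_mem hW n) hε0 hε.le herr hsec'
    rw [mul_div_cancel₀ _ (by linarith : 1 - ε ≠ 0)] at hmix
    refine ⟨M', hmix, ?_⟩
    -- One factor `2` comes from rounding down `L ≥ 1`, the other from keeping only the good half of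
    -- the bins.
    have h1 : L ≤ 4 * M' := by
      have h2 : L < ⌊L⌋₊ + 1 := Nat.lt_floor_add_one L
      have h3 : (1 : ℝ) ≤ ⌊L⌋₊ := by exact_mod_cast hM
      have h4 : (⌊L⌋₊ : ℝ) ≤ 2 * M' := by exact_mod_cast hMM
      linarith
    have h5 := Real.log_le_log hL0 h1
    have hM'0 : (M' : ℝ) ≠ 0 := by
      intro h; rw [h] at h1; linarith
    rw [Real.log_mul (by norm_num) hM'0] at h5
    linarith

end Achievability

/-! ### Rates -/

section Rates
variable {X Y Z : Type*} [Fintype X] [Fintype Y] [Fintype Z]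
  {W : X → Y × Z → ℝ} (hW : ∀ x, W x ∈ stdSimplex ℝ (Y × Z))
  {f : X → Y} (hWf : IsSemiDeterministic W f)

lemma codeSizes_max_subset_avg (W : X → Y × Z → ℝ) (n : ℕ) (ε δ : ℝ) :
    codeSizes .max W n ε δ ⊆ codeSizes .avg W n ε δ :=
  fun _ ⟨c, hc⟩ => c.exists_avg_of_max hc

lemma codeSizes_max_subset (i : Criterion) (W : X → Y × Z → ℝ) (n : ℕ) (ε δ : ℝ) :
    codeSizes .max W n ε δ ⊆ codeSizes i W n ε δ := by
  cases i
  · exact codeSizes_max_subset_avg W n ε δ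
  · exact subset_rfl

lemma codeSizes_subset_avg (i : Criterion) (W : X → Y × Z → ℝ) (n : ℕ) (ε δ : ℝ) :
    codeSizes i W n ε δ ⊆ codeSizes .avg W n ε δ := by
  cases i
  · exact subset_rfl
  · exact codeSizes_max_subset_avg W n ε δ

lemma maxRate_max_le_avg (W : X → Y × Z → ℝ) (n : ℕ) (ε δ : ℝ) :
    maxRate .max W n ε δ ≤ maxRate .avg W n ε δ :=
  biSup_mono fun _ h => codeSizes_max_subset_avg W n ε δ h

lemma le_maxRate {i : Criterion} {W : X → Y × Z → ℝ} {n : ℕ} {ε δ : ℝ} {M : ℕ}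
    (h : M ∈ codeSizes i W n ε δ) :
    ((Real.log (M : ℝ) / (n : ℝ) : ℝ) : EReal) ≤ maxRate i W n ε δ :=
  le_biSup (fun M : ℕ => ((Real.log (M : ℝ) / (n : ℝ) : ℝ) : EReal)) h

lemma maxRate_eq_of_isGreatest {i : Criterion} {W : X → Y × Z → ℝ} {n : ℕ} {ε δ : ℝ} {M : ℕ}
    (h : IsGreatest (codeSizes i W n ε δ) M) :
    maxRate i W n ε δ = ((Real.log (M : ℝ) / (n : ℝ) : ℝ) : EReal) := by
  refine le_antisymm (iSup₂_le fun M' h' => EReal.coe_le_coe_iff.2 ?_) (le_maxRate h.1)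
  have h1 : (M' : ℝ) ≤ M := by exact_mod_cast h.2 h'
  obtain ⟨c, -⟩ := h'
  have h0 : (0 : ℝ) < M' := by exact_mod_cast c.size_pos
  exact div_le_div_of_nonneg_right (Real.log_le_log h0 h1) n.cast_nonneg

include hW hWf

lemma exists_isGreatest_codeSizes [Nonempty X] (i : Criterion) (n : ℕ) {ε δ : ℝ} (hε : 0 ≤ ε)
    (hδ : 0 ≤ δ) (h : ε + δ < 1) : ∃ M, IsGreatest (codeSizes i W n ε δ) M := by
  refine BddAbove.exists_isGreatest_of_nonempty ?_
    ⟨1, codeSizes_max_subset i W n ε δ (one_mem_codeSizes W n hε hδ)⟩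
  refine ⟨⌊(Fintype.card (Fin n → Y) : ℝ) / (1 - ε - δ)⌋₊, fun M hM => Nat.le_floor ?_⟩
  obtain ⟨c, hc⟩ := codeSizes_subset_avg i W n ε δ hM
  rw [le_div_iff₀ (by linarith)]
  exact c.size_mul_le_card (memoryless_mem hW n) (memoryless_eq_zero hW hWf n) hc

/-- Full-rate zero-error codes. -/
lemma card_pow_mem_codeSizes [Nonempty X] (hf : Function.Surjective f) (n : ℕ) {ε δ : ℝ}
    (hε : 0 ≤ ε) (hδ : 0 ≤ δ) (h : 1 ≤ ε + δ) :
    Fintype.card Y ^ n ∈ codeSizes .max W n ε δ := by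
  classical
  have e : Fin (Fintype.card Y ^ n) ≃ (Fin n → Y) :=
    Fintype.equivOfCardEq (by simp)
  set g := Function.surjInv hf with hg
  have hfg : ∀ y, f (g y) = y := Function.surjInv_eq hf
  have hcard : 0 < Fintype.card Y ^ n := by
    obtain ⟨x⟩ := ‹Nonempty X›
    have : 0 < Fintype.card Y := Fintype.card_pos_iff.2 ⟨f x⟩
    positivity
  let c : SecrecyCode (Fin n → X) (Fin n → Y) (Fintype.card Y ^ n) :=
    ⟨fun _ => 1 / ((Fintype.card Y ^ n : ℕ) : ℝ), uniform_mem hcard,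
      fun m => Pi.single (fun k => g (e m k)) 1, fun _ => single_mem_stdSimplex ℝ _, e.symm⟩
  have herr : ∀ m, c.errorGivenMsg (memoryless W n) m = 0 := fun m => by
    rw [SecrecyCode.errorGivenMsg_deterministic (memoryless_mem hW n)
      (memoryless_eq_zero hW hWf n)]
    refine sum_eq_zero fun x _ => ?_
    split_ifs with hx
    · refine Pi.single_eq_of_ne (fun h' => hx ?_) _
      subst h'
      simp [c, hfg]
    · rfl
  -- The uncoded bijection has no errors and secrecy distance at most one, so mixing gives distance
  -- at most `1 - min ε 1 ≤ δ`. The minimum is needed because `ε` may exceed one while the mixing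
  -- weight may not.
  obtain ⟨c', hc'⟩ := c.exists_mix (memoryless_mem hW n) (p := min ε 1) (d := 1)
    (le_min hε zero_le_one) (min_le_right _ _) herr
    (fun m => SecrecyCode.secrecyGivenMsg_le_one (memoryless_mem hW n) c m)
  refine ⟨c', fun m => (hc'.1 m).trans (min_le_left _ _), fun m => (hc'.2 m).trans ?_⟩
  rw [mul_one, sub_le_comm]
  exact le_min (by linarith) (by linarith)

lemma log_card_le_maxRate [Nonempty X] (hf : Function.Surjective f) {n : ℕ} (hn : 1 ≤ n) {ε δ : ℝ}
    (hε : 0 ≤ ε) (hδ : 0 ≤ δ) (h : 1 ≤ ε + δ) :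
    ((Real.log (Fintype.card Y : ℝ) : ℝ) : EReal) ≤ maxRate .max W n ε δ := by
  refine le_trans (le_of_eq ?_) (le_maxRate (card_pow_mem_codeSizes hW hWf hf n hε hδ h))
  have hn' : (n : ℝ) ≠ 0 := by positivity
  rw [Nat.cast_pow, Real.log_pow, mul_div_cancel_left₀ _ hn']

/-- Second-order expansion of the maximal secrecy rate. -/
theorem maxRate_isBigO {Pstar : X → ℝ} (hmem : Pstar ∈ stdSimplex ℝ X)
    (huniq : ∀ P ∈ stdSimplex ℝ X,
      condEntropyFstGivenSnd (outDist W P) = secrecyCapacity W ↔ P = Pstar)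
    (hV : 0 < secrecyDispersion W Pstar) [Nonempty X] {ε δ : ℝ} (hε : 0 ≤ ε) (hδ : 0 < δ)
    (h : ε + δ < 1) (i : Criterion) :
    (fun n : ℕ => (maxRate i W n ε δ).toReal - (secrecyCapacity W
        - Real.sqrt (secrecyDispersion W Pstar / n) * gaussianQInv (δ / (1 - ε))))
      =O[atTop] fun n : ℕ => Real.log n / n := by
  have hε1 : 0 < 1 - ε := by linarith
  have hr := gaussianQ_gaussianQInv (p := δ / (1 - ε)) (by positivity)
    ((div_lt_one hε1).2 (by linarith))
  set r := gaussianQInv (δ / (1 - ε)) with hrdef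
  set C := secrecyCapacity W with hC
  set V := secrecyDispersion W Pstar with hVdef
  obtain ⟨K, hK⟩ := eventually_log_size_le hW hWf hmem huniq hV (by linarith) hr
  obtain ⟨K', hK'⟩ := eventually_exists_le_log_size hW hWf hmem ((huniq Pstar hmem).2 rfl) hV hε
    (by linarith) hδ.le hr
  refine Asymptotics.IsBigO.of_bound (max K K') ?_
  filter_upwards [hK, hK', eventually_ge_atTop 1] with n hup hlow hn
  have hnR : (0 : ℝ) < n := by exact_mod_cast hn
  have hlog : 0 ≤ Real.log (n : ℝ) := Real.log_natCast_nonneg n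
  obtain ⟨M, hM⟩ := exists_isGreatest_codeSizes hW hWf i n hε hδ.le h
  rw [maxRate_eq_of_isGreatest hM, EReal.toReal_coe]
  have h1 := hup M (codeSizes_subset_avg i W n ε δ hM.1)
  obtain ⟨M', hM', h2⟩ := hlow
  have hM'0 : (0 : ℝ) < M' := by
    obtain ⟨c, -⟩ := hM'
    exact_mod_cast c.size_pos
  have h3 : Real.log M' ≤ Real.log M := Real.log_le_log hM'0
    (by exact_mod_cast hM.2 (codeSizes_max_subset i W n ε δ hM'))
  have h4 : Real.sqrt (V / n) = Real.sqrt (n * V) / n := by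
    rw [Real.sqrt_div hV.le, Real.sqrt_mul hnR.le, div_eq_div_iff (by positivity) hnR.ne']
    rw [mul_right_comm, Real.mul_self_sqrt hnR.le, mul_comm]
  have h5 : Real.log M / n - (C - Real.sqrt (V / n) * r)
      = (Real.log M - (n * C - Real.sqrt (n * V) * r)) / n := by
    rw [h4]; field_simp
  rw [h5, Real.norm_eq_abs, Real.norm_eq_abs, abs_div, abs_of_pos hnR,
    abs_of_nonneg (div_nonneg hlog hnR.le), ← mul_div_assoc]
  refine div_le_div_of_nonneg_right ?_ hnR.le
  have h6 : K * Real.log n ≤ max K K' * Real.log n :=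
    mul_le_mul_of_nonneg_right (le_max_left _ _) hlog
  have h7 : K' * Real.log n ≤ max K K' * Real.log n :=
    mul_le_mul_of_nonneg_right (le_max_right _ _) hlog
  rw [abs_le]
  constructor <;> linarith

end Rates

end

end Wiretap

/-! ### The main theorem -/

theorem mainTheorem1 {X Y Z : Type*} [Fintype X] [Fintype Y] [Fintype Z]
    (W : X → Y × Z → ℝ) (hW : ∀ x, W x ∈ stdSimplex ℝ (Y × Z))
    (f : X → Y) (hf : Function.Surjective f) (hWf : Wiretap.IsSemiDeterministic W f)
    (Pstar : X → ℝ)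
    (hPstar : ∀ P ∈ stdSimplex ℝ X,
      Wiretap.condEntropyFstGivenSnd (Wiretap.outDist W P) = Wiretap.secrecyCapacity W ↔ P = Pstar)
    (hPstar_mem : Pstar ∈ stdSimplex ℝ X)
    (hV : 0 < Wiretap.secrecyDispersion W Pstar)
    (ε δ : ℝ) (hε : 0 ≤ ε) :
    (0 < δ → ε + δ < 1 → ∀ i : Wiretap.Criterion,
      (∀ n : ℕ, 1 ≤ n → ∃ M ∈ Wiretap.codeSizes i W n ε δ,
        Wiretap.maxRate i W n ε δ = ((Real.log (M : ℝ) / (n : ℝ) : ℝ) : EReal)) ∧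
      (fun n : ℕ => (Wiretap.maxRate i W n ε δ).toReal
          - (Wiretap.secrecyCapacity W
            - Real.sqrt (Wiretap.secrecyDispersion W Pstar / (n : ℝ))
              * Wiretap.gaussianQInv (δ / (1 - ε))))
        =O[Filter.atTop] (fun n : ℕ => Real.log (n : ℝ) / (n : ℝ))) ∧
    (0 ≤ δ → 1 ≤ ε + δ → ∀ n : ℕ, 1 ≤ n →
      Wiretap.maxRate .max W n ε δ ≤ Wiretap.maxRate .avg W n ε δ ∧
      ((Real.log (Fintype.card Y : ℝ) : ℝ) : EReal) ≤ Wiretap.maxRate .max W n ε δ) := by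
  have hX : Nonempty X := by
    by_contra h
    rw [not_nonempty_iff] at h
    have := hPstar_mem.2
    simp at this
  refine ⟨fun hδ h i => ⟨fun n _ => ?_, ?_⟩, fun hδ h n hn => ⟨?_, ?_⟩⟩
  · obtain ⟨M, hM⟩ := Wiretap.exists_isGreatest_codeSizes hW hWf i n hε hδ.le h
    exact ⟨M, hM.1, Wiretap.maxRate_eq_of_isGreatest hM⟩
  · exact Wiretap.maxRate_isBigO hW hWf hPstar_mem hPstar hV hε hδ h i
  · exact Wiretap.maxRate_max_le_avg W n ε δ
  · exact Wiretap.log_card_le_maxRate hW hWf hf hn hε hδ h
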